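/- \textbf{Setting.} Let $T\ge 1$ and $K$ be integers, $\mu\in\mathbb R^K$, $\sigma>0$ and $\gamma_T>0$. Put $[n]=\{1,\dots,n\}$, $\mu_*=\max_{b\in[K]}\mu_b$ and $\Delta_a=\mu_*-\mu_a$, and assume that $\Delta_a>0$ for at least one $a\in[K]$. At each round $t\in[T]$ a player chooses an arm $A_t\in[K]$ on the basis of the past rewards $R_1,\dots,R_{t-1}$ and receives $R_t=\mu_{A_t}+\sigma\xi_t$, where $\xi_1,\dots,\xi_T$ are i.i.d. $\mathcal N(0,1)$. For $t\geq 0$ and $a\in[K]$ let $n_{a;t}=\sum_{s\le t}\mathbf 1_{A_s=a}$ and $\hat\mu_{a;t}=n_{a;t}^{-1}\sum_{s\le t}R_s\mathbf 1_{A_s=a}$. The arms are chosen by \texttt{UCB1} with exploration rate $\gamma_T$: each arm is pulled once in the first $K$ rounds (in any order), and for $K<t\le T$ $$A_t\in\arg\max_{a\in[K]}\Big\{\hat\mu_{a;t-1}+\frac{\sigma\gamma_T}{\sqrt{n_{a;t-1}}}\Big\},$$ with ties broken in any way that depends only on the past rewards. Write $\Theta=(T,K,\Delta,\sigma,\gamma_T)$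 and let $R(\Theta)=\mathbb E\sum_{t=1}^T(\mu_*-R_t)$ be the expected regret. Let $n_*=n_*(\Theta)>0$ be the unique positive solution of $$\sum_{a\in[K]} n_*\Big(1+\frac{n_*^{1/2}\Delta_a}{\sigma\gamma_T}\Big)^{-2}=T,$$ and put $$n^*_{a;T}=n_*\Big(1+\frac{n_*^{1/2}\Delta_a}{\sigma\gamma_T}\Big)^{-2},\qquad \mathrm{Reg}^*_T(\Theta)=\sum_{a\in[K]}\Delta_a\,n^*_{a;T}.$$ Define $$\mathrm{err}(\Theta)=\frac{\sqrt{\log\gamma_T}+\sqrt{\log\log T}}{\gamma_T}+\frac KT+\frac{\max_{a\in[K]}(\Delta_a/\sigma)^2}{\gamma_T^2},\qquad \vartheta^*_T=\gamma_T^{-2}\,T\,e^{-\gamma_T^2/2},$$ where $\log\log 1$ and the square root of a negative number are read as $0$. \textbf{Theorem.} There is a universal constant $C>0$ such that in every such setting with $\mathrm{err}(\Theta)\le 1/C$, $$\Big|\frac{R(\Theta)}{\mathrm{Reg}^*_T(\Theta)}-1\Big|\le C\big(\mathrm{err}(\Theta)+\vartheta^*_T\big).$$ -/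

import Mathlib

open MeasureTheory ProbabilityTheory

noncomputable section

namespace UCB

/-! ## The bandit model

Rounds are indexed from `0`, so that the `T` rounds are `t = 0, …, T - 1`; the arms are `Fin K`. -/

/-- The optimal mean `μ_* = max_b μ_b`. -/
def bestMean {K : ℕ} (μ : Fin K → ℝ) : ℝ := ⨆ b, μ b

/-- The sub-optimality gaps `Δ_a = μ_* - μ_a`. -/
def gap {K : ℕ} (μ : Fin K → ℝ) (a : Fin K) : ℝ := bestMean μ - μ a

variable {Ω : Type*} {K : ℕ}

/-- The noises `ξ_0, …, ξ_{T-1}` are i.i.d. standard normal variables. -/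
structure IsGaussianNoise [MeasurableSpace Ω] (P : Measure Ω) (T : ℕ) (ξ : ℕ → Ω → ℝ) : Prop where
  measurable : ∀ t < T, Measurable (ξ t)
  map_eq : ∀ t < T, P.map (ξ t) = gaussianReal 0 1
  indep : iIndepFun (fun t : Fin T => ξ t) P

/-- The reward `R_t = μ_{A_t} + σ ξ_t` received in round `t`. -/
def reward (μ : Fin K → ℝ) (σ : ℝ) (ξ : ℕ → Ω → ℝ) (A : ℕ → Ω → Fin K) (t : ℕ) (ω : Ω) : ℝ :=
  μ (A t ω) + σ * ξ t ω

/-- The number of pulls of arm `a` in the first `t` rounds. -/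
def pulls (A : ℕ → Ω → Fin K) (t : ℕ) (a : Fin K) (ω : Ω) : ℕ :=
  ((Finset.range t).filter (fun s => A s ω = a)).card

/-- The empirical mean reward of arm `a` over the first `t` rounds. -/
def empMean (μ : Fin K → ℝ) (σ : ℝ) (ξ : ℕ → Ω → ℝ) (A : ℕ → Ω → Fin K)
    (t : ℕ) (a : Fin K) (ω : Ω) : ℝ :=
  (∑ s ∈ (Finset.range t).filter (fun s => A s ω = a), reward μ σ ξ A s ω) / (pulls A t a ω : ℝ)

/-- The upper confidence index of arm `a` after `t` rounds. -/
def index (μ : Fin K → ℝ) (σ γ : ℝ) (ξ : ℕ → Ω → ℝ) (A : ℕ → Ω → Fin K)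
    (t : ℕ) (a : Fin K) (ω : Ω) : ℝ :=
  empMean μ σ ξ A t a ω + σ * γ / √(pulls A t a ω : ℝ)

/-- The information available before round `t`: the σ-algebra generated by the past rewards. -/
@[reducible] def past (μ : Fin K → ℝ) (σ : ℝ) (ξ : ℕ → Ω → ℝ) (A : ℕ → Ω → Fin K) (t : ℕ) :
    MeasurableSpace Ω :=
  ⨆ (s : ℕ) (_ : s < t), MeasurableSpace.comap (reward μ σ ξ A s) inferInstance

/-- The arms `A_0, …, A_{T-1}` are selected by `UCB1` with exploration rate `γ`.
The order of the first `K` pulls and the rule for breaking ties are arbitrary. -/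
structure IsUCB1 (T : ℕ) (μ : Fin K → ℝ) (σ γ : ℝ) (ξ : ℕ → Ω → ℝ) (A : ℕ → Ω → Fin K) :
    Prop where
  /-- every arm is chosen on the basis of the past rewards -/
  adapted : ∀ t < T, Measurable[past μ σ ξ A t] (A t)
  /-- every arm is pulled exactly once in the first `K` rounds -/
  init : ∀ ω a, pulls A K a ω = 1
  /-- afterwards, the chosen arm maximizes the index -/
  argmax : ∀ t, K ≤ t → t < T → ∀ ω b, index μ σ γ ξ A t b ω ≤ index μ σ γ ξ A t (A t ω) ω

/-- The expected regret `E ∑_t (μ_* - R_t)`. -/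
def expectedRegret [MeasurableSpace Ω] (P : Measure Ω) (T : ℕ) (μ : Fin K → ℝ) (σ : ℝ)
    (ξ : ℕ → Ω → ℝ) (A : ℕ → Ω → Fin K) : ℝ :=
  ∫ ω, ∑ t ∈ Finset.range T, (bestMean μ - reward μ σ ξ A t ω) ∂P

/-! ## The fixed point equation and the theoretical regret -/

/-- The function `n (1 + n^{1/2} Δ_a / (σ γ))^{-2}` of `n`. -/
def growth (Δ : Fin K → ℝ) (σ γ n : ℝ) (a : Fin K) : ℝ :=
  n * ((1 + √n * Δ a / (σ * γ)) ^ 2)⁻¹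

/-- `n` is a positive solution of the fixed point equation. -/
def IsFixedPoint (T : ℕ) (Δ : Fin K → ℝ) (σ γ n : ℝ) : Prop :=
  0 < n ∧ ∑ a, growth Δ σ γ n a = T

/-- The solution `n_*` of the fixed point equation (it exists and is unique, see
`existsUnique_isFixedPoint`). -/
def nStar (T : ℕ) (Δ : Fin K → ℝ) (σ γ : ℝ) : ℝ := Classical.epsilon (IsFixedPoint T Δ σ γ)

/-- The theoretical number of pulls `n*_{a;T}`. -/
def nStarArm (T : ℕ) (Δ : Fin K → ℝ) (σ γ : ℝ) (a : Fin K) : ℝ :=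
  growth Δ σ γ (nStar T Δ σ γ) a

/-- The theoretical regret `Reg*_T = ∑_a Δ_a n*_{a;T}`. -/
def regStar (T : ℕ) (Δ : Fin K → ℝ) (σ γ : ℝ) : ℝ := ∑ a, Δ a * nStarArm T Δ σ γ a

/-- The error `err(Θ)`; the norm on `Fin K → ℝ` is the sup norm, and `√x = 0` for `x < 0`. -/
def err (T : ℕ) (Δ : Fin K → ℝ) (σ γ : ℝ) : ℝ :=
  (√(Real.log γ) + √(Real.log (Real.log T))) / γ + (K : ℝ) / T + ‖fun a => Δ a / σ‖ ^ 2 / γ ^ 2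

/-- The error `ϑ*_T = γ^{-2} T e^{-γ²/2}`. -/
def thetaStar (T : ℕ) (γ : ℝ) : ℝ := (γ ^ 2)⁻¹ * (T * Real.exp (-γ ^ 2 / 2))

theorem exists_gap_eq_zero (hK : 0 < K) (μ : Fin K → ℝ) : ∃ a, gap μ a = 0 := by
  have : Nonempty (Fin K) := ⟨⟨0, hK⟩⟩
  obtain ⟨a, ha⟩ := exists_eq_ciSup_of_finite (f := μ)
  exact ⟨a, by simp [gap, bestMean, ha]⟩

theorem gap_nonneg (μ : Fin K → ℝ) (a : Fin K) : 0 ≤ gap μ a :=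
  sub_nonneg.2 (le_ciSup (Set.finite_range μ).bddAbove a)

theorem growth_strictMonoOn {Δ : Fin K → ℝ} {σ γ : ℝ} (hσ : 0 < σ) (hγ : 0 < γ)
    {a : Fin K} (ha : 0 ≤ Δ a) : StrictMonoOn (fun n => growth Δ σ γ n a) (Set.Ici 0) := by
  intro x hx y hy hxy
  have hx : 0 ≤ x := hx
  have hy : 0 ≤ y := hy
  have hc : 0 ≤ Δ a / (σ * γ) := by positivity
  have key : ∀ z : ℝ, 0 ≤ z → growth Δ σ γ z a = (√z / (1 + √z * (Δ a / (σ * γ)))) ^ 2 := by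
    intro z hz
    rw [growth, div_pow, Real.sq_sqrt hz, mul_div_assoc, div_eq_mul_inv z]
  simp only [key x hx, key y hy]
  have hs : √x < √y := Real.sqrt_lt_sqrt hx hxy
  have h0 := Real.sqrt_nonneg x
  have h1 := Real.sqrt_nonneg y
  refine pow_lt_pow_left₀ ?_ (by positivity) two_ne_zero
  rw [div_lt_div_iff₀ (by positivity) (by positivity)]
  nlinarith

/-- The fixed point equation has exactly one positive solution. -/
theorem existsUnique_isFixedPoint (hK : 0 < K) {T : ℕ} (hT : 0 < T) (μ : Fin K → ℝ) {σ γ : ℝ}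
    (hσ : 0 < σ) (hγ : 0 < γ) : ∃! n, IsFixedPoint T (gap μ) σ γ n := by
  obtain ⟨a₀, ha₀⟩ := exists_gap_eq_zero hK μ
  have hmono : StrictMonoOn (fun n => ∑ a, growth (gap μ) σ γ n a) (Set.Ici 0) := by
    intro x hx y hy hxy
    exact Finset.sum_lt_sum_of_nonempty ⟨a₀, Finset.mem_univ _⟩
      (fun a _ => growth_strictMonoOn hσ hγ (gap_nonneg μ a) hx hy hxy)
  have hcont : ContinuousOn (fun n => ∑ a, growth (gap μ) σ γ n a) (Set.Icc 0 (T : ℝ)) := by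
    refine continuousOn_finsetSum _ (fun a _ => ?_)
    have hg := gap_nonneg μ a
    unfold growth
    refine Continuous.continuousOn (continuous_id.mul (Continuous.inv₀ (by fun_prop) ?_))
    intro x
    have : 0 ≤ √x * gap μ a / (σ * γ) := by positivity
    positivity
  have h0 : ∑ a, growth (gap μ) σ γ 0 a = 0 := by simp [growth]
  have hTT : (T : ℝ) ≤ ∑ a, growth (gap μ) σ γ T a := by
    calc (T : ℝ) = growth (gap μ) σ γ T a₀ := by simp [growth, ha₀]
      _ ≤ _ := Finset.single_le_sum (f := fun a => growth (gap μ) σ γ T a)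
          (fun a _ => by unfold growth; positivity) (Finset.mem_univ a₀)
  have hTpos : (0 : ℝ) < T := by exact_mod_cast hT
  obtain ⟨n, hn, hnT⟩ := intermediate_value_Icc hTpos.le hcont
    (show (T : ℝ) ∈ Set.Icc _ _ from ⟨by rw [h0]; exact hTpos.le, hTT⟩)
  have hnT' : ∑ a, growth (gap μ) σ γ n a = T := hnT
  refine ⟨n, ⟨lt_of_le_of_ne hn.1 ?_, hnT'⟩, ?_⟩
  · rintro rfl
    rw [h0] at hnT'
    exact hTpos.ne hnT'
  · rintro m ⟨hm, hmT⟩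
    exact hmono.injOn hm.le hn.1 (hmT.trans hnT'.symm)

theorem isFixedPoint_nStar (hK : 0 < K) {T : ℕ} (hT : 0 < T) (μ : Fin K → ℝ) {σ γ : ℝ}
    (hσ : 0 < σ) (hγ : 0 < γ) : IsFixedPoint T (gap μ) σ γ (nStar T (gap μ) σ γ) :=
  Classical.epsilon_spec (existsUnique_isFixedPoint hK hT μ hσ hγ).exists

end UCB

end

/-! Measure gaps in units of σγ, writing `d a` for Δ_a/(σγ). Without noise, an arm whose normalized
index equals u has been pulled `xc d u a` = (u + d a)⁻² times. Write G = `totalPulls d` and F =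
`totalRegret d`. The fixed point equation is G(us) = T with us = n_*^(-1/2), and Reg* = σγ F(us).

A run is governed by its level V, the minimum over the rounds after initialization of the maximal
index. An arm is pulled only while its index is at least V, and at the minimizing round all indices
are at most V. So an arm whose noise sum over n pulls stays below εγ√n has a pull count between
(1-ε)² xc(V) and 1 + (1+ε)² xc(V). Summing over arms compares G(V) with T. Since F/G is
nondecreasing in the level (`totalRegret_mul_le`), this compares regrets without estimating V - us.

The other arms are "bad". Dyadic peeling makes a bad arm have probability at most γ⁻² once ε is of
order (√log γ + √log log T)/γ. On an event D an arm receives on average at most 6 √P(D) xc pulls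
(`IsRun.integral_ind_mul_reachCount_le`), so bad arms cost a relative O(1/γ).

For the upper bound the level may also fall far below us. If it reaches u with G(u) ≥ 4T, then bad
arms carry at least half of G(u). The algorithm makes arms dependent, but only one arm is played per
round, so products of per-arm exponential martingales still have mean one
(`lintegral_prod_stopExp`). The resulting Chernoff bound, exponentially small in u² G(u) γ², beats
the growth F(u) ≤ F(us) G(u)/T and sums geometrically over dyadic levels down to 1/(2√T).

Below that scale, arms of gap at most u are harmless. An arm of gap v > u is pulled too often only
if the best arm's index falls below -v/2, which after n pulls requires a noise sum below -(γ√n +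
γnv/2). This costs e^(-γ²/2) and produces the term ϑ*. -/

noncomputable section

namespace UCB

open scoped ENNReal

variable {Ω : Type*} {K : ℕ}

/-! ### Noise filtration and exponential martingales. -/

/-- The σ-algebra generated by the first `t` noises. -/
@[reducible] def hist (ξ : ℕ → Ω → ℝ) (t : ℕ) : MeasurableSpace Ω :=
  ⨆ (s : ℕ) (_ : s < t), MeasurableSpace.comap (ξ s) inferInstance

theorem hist_mono (ξ : ℕ → Ω → ℝ) {s t : ℕ} (h : s ≤ t) : hist ξ s ≤ hist ξ t :=
  iSup₂_le fun i hi => le_iSup₂_of_le i (hi.trans_le h) le_rfl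

theorem measurable_noise_hist (ξ : ℕ → Ω → ℝ) {s t : ℕ} (h : s < t) :
    Measurable[hist ξ t] (ξ s) :=
  measurable_iff_comap_le.2 (le_iSup₂_of_le (f := fun (s : ℕ) (_ : s < t) =>
    MeasurableSpace.comap (ξ s) inferInstance) s h le_rfl)

theorem hist_le [m : MeasurableSpace Ω] {P : Measure Ω} {T : ℕ} {ξ : ℕ → Ω → ℝ}
    (hξ : IsGaussianNoise P T ξ) {t : ℕ} (ht : t ≤ T) : hist ξ t ≤ m :=
  iSup₂_le fun i hi => measurable_iff_comap_le.1 (hξ.measurable i (hi.trans_le ht))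

/-- Past rewards are functions of past arms and noises, so strong induction replaces the reward
filtration by the noise filtration, which is independent of the next noise. -/
theorem measurable_arm_hist {T : ℕ} {μ : Fin K → ℝ} {σ : ℝ} {ξ : ℕ → Ω → ℝ} {A : ℕ → Ω → Fin K}
    (hA : ∀ t < T, Measurable[past μ σ ξ A t] (A t)) :
    ∀ t < T, Measurable[hist ξ t] (A t) := by
  intro t
  induction t using Nat.strong_induction_on with
  | _ t ih =>
    intro ht
    refine (hA t ht).mono ?_ le_rfl
    refine iSup₂_le fun s hs => measurable_iff_comap_le.1 ?_
    have h1 : Measurable[hist ξ t] (A s) := (ih s hs (hs.trans ht)).mono (hist_mono ξ hs.le) le_rfl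
    have h2 : Measurable[hist ξ t] (ξ s) := measurable_noise_hist ξ hs
    exact ((measurable_of_finite μ).comp h1).add (h2.const_mul σ)

theorem indep_hist [m : MeasurableSpace Ω] {P : Measure Ω} {T : ℕ} {ξ : ℕ → Ω → ℝ}
    (hξ : IsGaussianNoise P T ξ) {t : ℕ} (ht : t < T) :
    Indep (hist ξ t) (MeasurableSpace.comap (ξ t) inferInstance) P := by
  have h := indep_iSup_of_disjoint (m := fun i : Fin T => MeasurableSpace.comap (ξ i) inferInstance)
    (fun i => measurable_iff_comap_le.1 (hξ.measurable i i.2)) hξ.indep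
    (S := {i | i.1 < t}) (T := {⟨t, ht⟩}) (by
      rw [Set.disjoint_singleton_right]; simp)
  refine indep_of_indep_of_le_right (indep_of_indep_of_le_left h ?_) ?_
  · refine iSup₂_le fun s hs => ?_
    exact le_biSup (fun i : Fin T => MeasurableSpace.comap (ξ i) inferInstance)
      (show (⟨s, hs.trans ht⟩ : Fin T) ∈ {i : Fin T | i.1 < t} from hs)
  · exact le_biSup (fun i : Fin T => MeasurableSpace.comap (ξ i) inferInstance)
      (Set.mem_singleton (⟨t, ht⟩ : Fin T))

theorem lintegral_exp_gaussianReal (h : ℝ) :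
    ∫⁻ x, ENNReal.ofReal (Real.exp (h * x - h ^ 2 / 2)) ∂gaussianReal 0 1 = 1 := by
  have hi : Integrable (fun x => Real.exp (h * x)) (gaussianReal 0 1) :=
    integrable_exp_mul_gaussianReal h
  have hm : ∫ x, Real.exp (h * x) ∂gaussianReal 0 1 = Real.exp (h ^ 2 / 2) := by
    have := mgf_gaussianReal (p := gaussianReal 0 1) (X := id) (μ := 0) (v := 1) (by simp) h
    simpa [mgf] using this
  simp_rw [sub_eq_add_neg, Real.exp_add]
  rw [← ofReal_integral_eq_lintegral_ofReal (hi.mul_const _)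
    (Filter.Eventually.of_forall fun x => by positivity), integral_mul_const, hm, ← Real.exp_add]
  simp

/-- The pair `(Y, h)` is independent of the fresh noise, so Fubini freezes it and the Gaussian
moment generating function gives the factor one. Working in `ℝ≥0∞` avoids all integrability
questions for the random load `h`. -/
theorem lintegral_mul_exp_noise [m : MeasurableSpace Ω] {P : Measure Ω} [IsProbabilityMeasure P]
    {T : ℕ} {ξ : ℕ → Ω → ℝ} (hξ : IsGaussianNoise P T ξ) {t : ℕ} (ht : t < T)
    {Y : Ω → ℝ≥0∞} {h : Ω → ℝ} (hY : Measurable[hist ξ t] Y) (hh : Measurable[hist ξ t] h) :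
    ∫⁻ ω, Y ω * ENNReal.ofReal (Real.exp (h ω * ξ t ω - h ω ^ 2 / 2)) ∂P = ∫⁻ ω, Y ω ∂P := by
  have hle := hist_le hξ ht.le
  have hXm : Measurable (fun ω => (Y ω, h ω)) := (hY.mono hle le_rfl).prodMk (hh.mono hle le_rfl)
  have hξm := hξ.measurable t ht
  have hind : IndepFun (fun ω => (Y ω, h ω)) (ξ t) P := by
    refine indep_of_indep_of_le_left (indep_hist hξ ht) ?_
    exact measurable_iff_comap_le.1 (Measurable.prodMk hY hh)
  have hmap := (indepFun_iff_map_prod_eq_prod_map_map hXm.aemeasurable hξm.aemeasurable).1 hind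
  let f : (ℝ≥0∞ × ℝ) × ℝ → ℝ≥0∞ :=
    fun z => z.1.1 * ENNReal.ofReal (Real.exp (z.1.2 * z.2 - z.1.2 ^ 2 / 2))
  have hf : Measurable f := by fun_prop
  have h1 : ∫⁻ ω, Y ω * ENNReal.ofReal (Real.exp (h ω * ξ t ω - h ω ^ 2 / 2)) ∂P =
      ∫⁻ z, f z ∂(P.map (fun ω => ((Y ω, h ω), ξ t ω))) :=
    (lintegral_map hf (hXm.prodMk hξm)).symm
  rw [h1, hmap, hξ.map_eq t ht, lintegral_prod _ hf.aemeasurable]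
  have h2 : ∀ x : ℝ≥0∞ × ℝ, ∫⁻ y, f (x, y) ∂gaussianReal 0 1 = x.1 := by
    intro x
    simp only [f]
    rw [lintegral_const_mul _ (by fun_prop), lintegral_exp_gaussianReal, mul_one]
  simp_rw [h2]
  rw [lintegral_map measurable_fst hXm]

theorem lintegral_exp_martingale [m : MeasurableSpace Ω] {P : Measure Ω} [IsProbabilityMeasure P]
    {T : ℕ} {ξ : ℕ → Ω → ℝ} (hξ : IsGaussianNoise P T ξ) {h : ℕ → Ω → ℝ}
    (hh : ∀ t < T, Measurable[hist ξ t] (h t)) {t : ℕ} (ht : t ≤ T) :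
    ∫⁻ ω, ENNReal.ofReal (Real.exp (∑ s ∈ Finset.range t, (h s ω * ξ s ω - h s ω ^ 2 / 2))) ∂P
      = 1 := by
  induction t with
  | zero => simp
  | succ t ih =>
    rw [← ih (by omega)]
    simp_rw [Finset.sum_range_succ, Real.exp_add]
    simp_rw [ENNReal.ofReal_mul (Real.exp_pos _).le]
    refine lintegral_mul_exp_noise hξ (by omega) ?_ (hh t (by omega))
    refine ENNReal.measurable_ofReal.comp (Real.measurable_exp.comp ?_)
    refine Finset.measurable_fun_sum _ fun s hs => ?_
    have hs' : s < t := Finset.mem_range.1 hs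
    have h1 : Measurable[hist ξ t] (h s) := (hh s (by omega)).mono (hist_mono ξ hs'.le) le_rfl
    exact (h1.mul (measurable_noise_hist ξ hs')).sub ((h1.pow_const 2).div_const 2)

/-! ### Stopped exponential martingales of single arms. -/

/-- The sum of the noises received from arm `a` in the first `t` rounds. -/
def armSum (ξ : ℕ → Ω → ℝ) (A : ℕ → Ω → Fin K) (t : ℕ) (a : Fin K) (ω : Ω) : ℝ :=
  ∑ s ∈ (Finset.range t).filter (fun s => A s ω = a), ξ s ω

theorem measurable_pulls {m : MeasurableSpace Ω} {A : ℕ → Ω → Fin K} {t : ℕ}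
    (h : ∀ s < t, Measurable[m] (A s)) (a : Fin K) : Measurable[m] (pulls A t a) := by
  have : pulls A t a = fun ω => ∑ s ∈ Finset.range t, if A s ω = a then 1 else 0 := by
    ext ω; simp [pulls]
  rw [this]
  refine Finset.measurable_fun_sum _ fun s hs => ?_
  exact Measurable.ite (h s (Finset.mem_range.1 hs) (measurableSet_singleton a))
    measurable_const measurable_const

theorem measurable_armSum {m : MeasurableSpace Ω} {ξ : ℕ → Ω → ℝ} {A : ℕ → Ω → Fin K} {t : ℕ}
    (h : ∀ s < t, Measurable[m] (A s)) (hξ : ∀ s < t, Measurable[m] (ξ s)) (a : Fin K) :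
    Measurable[m] (armSum ξ A t a) := by
  have : armSum ξ A t a = fun ω => ∑ s ∈ Finset.range t, if A s ω = a then ξ s ω else 0 := by
    ext ω; simp [armSum, Finset.sum_filter]
  rw [this]
  refine Finset.measurable_fun_sum _ fun s hs => ?_
  exact Measurable.ite (h s (Finset.mem_range.1 hs) (measurableSet_singleton a))
    (hξ s (Finset.mem_range.1 hs)) measurable_const

open Classical in
/-- The load `lam` put on the pulls of arm `a` until the condition `Cr` is met. -/
def stopLoad (A : ℕ → Ω → Fin K) (a : Fin K) (lam : ℝ) (Cr : ℕ → Ω → Prop) (s : ℕ) (ω : Ω) : ℝ :=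
  -- Time `t = s` is included: `Cr s` depends on the first `s` rounds only, so the load stays
  -- predictable, and round `s` is already unloaded when `Cr s` holds.
  if A s ω = a ∧ ∀ t ≤ s, ¬ Cr t ω then lam else 0

/-- The logarithm of the exponential martingale with loads `stopLoad`. -/
def stopLog (ξ : ℕ → Ω → ℝ) (A : ℕ → Ω → Fin K) (T : ℕ) (a : Fin K) (lam : ℝ)
    (Cr : ℕ → Ω → Prop) (ω : Ω) : ℝ :=
  ∑ s ∈ Finset.range T,
    (stopLoad A a lam Cr s ω * ξ s ω - stopLoad A a lam Cr s ω ^ 2 / 2)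

/-- The exponential martingale with loads `stopLoad`. -/
def stopExp (ξ : ℕ → Ω → ℝ) (A : ℕ → Ω → Fin K) (T : ℕ) (a : Fin K) (lam : ℝ)
    (Cr : ℕ → Ω → Prop) (ω : Ω) : ℝ≥0∞ :=
  ENNReal.ofReal (Real.exp (stopLog ξ A T a lam Cr ω))

theorem measurable_stopLoad {ξ : ℕ → Ω → ℝ} {A : ℕ → Ω → Fin K} {T : ℕ}
    (hA : ∀ t < T, Measurable[hist ξ t] (A t)) (a : Fin K) (lam : ℝ) {Cr : ℕ → Ω → Prop}
    (hCr : ∀ t < T, MeasurableSet[hist ξ t] {ω | Cr t ω}) {s : ℕ} (hs : s < T) :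
    Measurable[hist ξ s] (stopLoad A a lam Cr s) := by
  classical
  unfold stopLoad
  refine Measurable.ite ?_ measurable_const measurable_const
  have : {ω | A s ω = a ∧ ∀ t ≤ s, ¬ Cr t ω} =
      A s ⁻¹' {a} ∩ ⋂ t : ℕ, ⋂ (_ : t ≤ s), {ω | Cr t ω}ᶜ := by
    ext ω; simp
  rw [this]
  refine MeasurableSet.inter (hA s hs (measurableSet_singleton a)) ?_
  exact MeasurableSet.iInter fun t => MeasurableSet.iInter fun ht =>
    (hist_mono ξ ht _ (hCr t (ht.trans_lt hs))).compl

theorem measurable_stopLog [m : MeasurableSpace Ω] {P : Measure Ω} {T : ℕ} {ξ : ℕ → Ω → ℝ}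
    (hξ : IsGaussianNoise P T ξ) {A : ℕ → Ω → Fin K}
    (hA : ∀ t < T, Measurable[hist ξ t] (A t)) (a : Fin K) (lam : ℝ) {Cr : ℕ → Ω → Prop}
    (hCr : ∀ t < T, MeasurableSet[hist ξ t] {ω | Cr t ω}) :
    Measurable (stopLog ξ A T a lam Cr) := by
  unfold stopLog
  refine Finset.measurable_fun_sum _ fun s hs => ?_
  have hs' := Finset.mem_range.1 hs
  have h1 : Measurable (stopLoad A a lam Cr s) :=
    (measurable_stopLoad hA a lam hCr hs').mono (hist_le hξ hs'.le) le_rfl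
  exact (h1.mul (hξ.measurable s hs')).sub ((h1.pow_const 2).div_const 2)

theorem measurable_stopExp [m : MeasurableSpace Ω] {P : Measure Ω} {T : ℕ} {ξ : ℕ → Ω → ℝ}
    (hξ : IsGaussianNoise P T ξ) {A : ℕ → Ω → Fin K}
    (hA : ∀ t < T, Measurable[hist ξ t] (A t)) (a : Fin K) (lam : ℝ) {Cr : ℕ → Ω → Prop}
    (hCr : ∀ t < T, MeasurableSet[hist ξ t] {ω | Cr t ω}) :
    Measurable (stopExp ξ A T a lam Cr) :=
  ENNReal.measurable_ofReal.comp (Real.measurable_exp.comp (measurable_stopLog hξ hA a lam hCr))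

theorem lintegral_stopExp [m : MeasurableSpace Ω] {P : Measure Ω} [IsProbabilityMeasure P]
    {T : ℕ} {ξ : ℕ → Ω → ℝ} (hξ : IsGaussianNoise P T ξ) {A : ℕ → Ω → Fin K}
    (hA : ∀ t < T, Measurable[hist ξ t] (A t)) (a : Fin K) (lam : ℝ) {Cr : ℕ → Ω → Prop}
    (hCr : ∀ t < T, MeasurableSet[hist ξ t] {ω | Cr t ω}) :
    ∫⁻ ω, stopExp ξ A T a lam Cr ω ∂P = 1 :=
  lintegral_exp_martingale hξ (fun _ ht => measurable_stopLoad hA a lam hCr ht) le_rfl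

/-- In every round only the pulled arm carries a load, so the square of the total load is the sum of
the squares and the product is again an exponential martingale. This is the substitute for
independence of the arms. -/
theorem lintegral_prod_stopExp [m : MeasurableSpace Ω] {P : Measure Ω} [IsProbabilityMeasure P]
    {T : ℕ} {ξ : ℕ → Ω → ℝ} (hξ : IsGaussianNoise P T ξ) {A : ℕ → Ω → Fin K}
    (hA : ∀ t < T, Measurable[hist ξ t] (A t)) (lam : Fin K → ℝ) {Cr : Fin K → ℕ → Ω → Prop}
    (hCr : ∀ a, ∀ t < T, MeasurableSet[hist ξ t] {ω | Cr a t ω}) :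
    ∫⁻ ω, ∏ a, stopExp ξ A T a (lam a) (Cr a) ω ∂P = 1 := by
  rw [← lintegral_exp_martingale hξ (h := fun s ω => ∑ a, stopLoad A a (lam a) (Cr a) s ω)
    (fun t ht => Finset.measurable_fun_sum _ fun a _ =>
      measurable_stopLoad hA a (lam a) (hCr a) ht) le_rfl]
  refine lintegral_congr fun ω => ?_
  unfold stopExp
  rw [← ENNReal.ofReal_prod_of_nonneg (fun _ _ => (Real.exp_pos _).le), ← Real.exp_sum]
  congr 2
  unfold stopLog
  rw [Finset.sum_comm]
  refine Finset.sum_congr rfl fun s _ => ?_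
  have h0 : ∀ b, b ≠ A s ω → stopLoad A b (lam b) (Cr b) s ω = 0 := fun b hb => by
    unfold stopLoad; rw [if_neg]; exact fun h => hb h.1.symm
  rw [Finset.sum_eq_single (A s ω) (fun b _ hb => by simp [h0 b hb]) (by simp),
    Finset.sum_eq_single (A s ω) (fun b _ hb => h0 b hb) (by simp)]

/-- From the first time `Cr` holds all loads vanish, so the logarithm is frozen at its value at that
time. -/
theorem le_stopLog {ξ : ℕ → Ω → ℝ} {A : ℕ → Ω → Fin K} {T : ℕ} {a : Fin K} {lam c : ℝ}
    {Cr : ℕ → Ω → Prop} {ω : Ω} (hc : ∀ t ≤ T, Cr t ω →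
      c ≤ lam * armSum ξ A t a ω - lam ^ 2 / 2 * pulls A t a ω)
    (h : ∃ t ≤ T, Cr t ω) : c ≤ stopLog ξ A T a lam Cr ω := by
  classical
  have h' : ∃ t, Cr t ω := by obtain ⟨t, _, ht⟩ := h; exact ⟨t, ht⟩
  set t := Nat.find h' with ht_def
  have htT : t ≤ T := by
    obtain ⟨s, hs, hs'⟩ := h
    exact (Nat.find_min' h' hs').trans hs
  refine (hc t htT (Nat.find_spec h')).trans (le_of_eq ?_)
  unfold stopLog
  rw [← Finset.sum_subset (Finset.range_subset_range.2 htT)]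
  · have : ∀ s ∈ Finset.range t, stopLoad A a lam Cr s ω * ξ s ω - stopLoad A a lam Cr s ω ^ 2 / 2
        = if A s ω = a then lam * ξ s ω - lam ^ 2 / 2 * 1 else 0 := by
      intro s hs
      have hs' := Finset.mem_range.1 hs
      have hn : ∀ r ≤ s, ¬ Cr r ω := fun r hr => Nat.find_min h' (lt_of_le_of_lt hr hs')
      by_cases hA : A s ω = a
      · unfold stopLoad; rw [if_pos ⟨hA, hn⟩, if_pos hA]; ring
      · simp [stopLoad, hA]
    rw [Finset.sum_congr rfl this, ← Finset.sum_filter, Finset.sum_sub_distrib, ← Finset.mul_sum,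
      ← Finset.mul_sum]
    simp [armSum, pulls]
  · intro s _ hs
    have hs' : t ≤ s := by simpa using hs
    have : stopLoad A a lam Cr s ω = 0 := by
      unfold stopLoad
      rw [if_neg]
      exact fun hh => hh.2 t hs' (Nat.find_spec h')
    simp [this]

/-- Stopping makes this a maximal inequality: the stopped exponential has mean one and is at least
e^c wherever `Cr` occurs, so Markov's inequality suffices. -/
theorem measure_exists_le [m : MeasurableSpace Ω] {P : Measure Ω} [IsProbabilityMeasure P]
    {T : ℕ} {ξ : ℕ → Ω → ℝ} (hξ : IsGaussianNoise P T ξ) {A : ℕ → Ω → Fin K}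
    (hA : ∀ t < T, Measurable[hist ξ t] (A t)) (a : Fin K) (lam c : ℝ) {Cr : ℕ → Ω → Prop}
    (hCr : ∀ t < T, MeasurableSet[hist ξ t] {ω | Cr t ω})
    (hc : ∀ ω, ∀ t ≤ T, Cr t ω → c ≤ lam * armSum ξ A t a ω - lam ^ 2 / 2 * pulls A t a ω) :
    P {ω | ∃ t ≤ T, Cr t ω} ≤ ENNReal.ofReal (Real.exp (-c)) := by
  have h1 : {ω | ∃ t ≤ T, Cr t ω} ⊆
      {ω | ENNReal.ofReal (Real.exp c) ≤ stopExp ξ A T a lam Cr ω} := fun ω hω =>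
    ENNReal.ofReal_le_ofReal (Real.exp_le_exp.2 (le_stopLog (hc ω) hω))
  have h2 := mul_meas_ge_le_lintegral (μ := P) (measurable_stopExp hξ hA a lam hCr)
    (ENNReal.ofReal (Real.exp c))
  rw [lintegral_stopExp hξ hA a lam hCr] at h2
  have h3 : ENNReal.ofReal (Real.exp (-c)) * ENNReal.ofReal (Real.exp c) = 1 := by
    rw [← ENNReal.ofReal_mul (Real.exp_pos _).le, ← Real.exp_add]; simp
  calc P {ω | ∃ t ≤ T, Cr t ω}
      ≤ P {ω | ENNReal.ofReal (Real.exp c) ≤ stopExp ξ A T a lam Cr ω} := measure_mono h1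
    _ = ENNReal.ofReal (Real.exp (-c)) * (ENNReal.ofReal (Real.exp c) *
          P {ω | ENNReal.ofReal (Real.exp c) ≤ stopExp ξ A T a lam Cr ω}) := by
        rw [← mul_assoc, h3, one_mul]
    _ ≤ _ := by
        calc _ ≤ ENNReal.ofReal (Real.exp (-c)) * 1 := by gcongr
          _ = _ := mul_one _

/-- Expanding the product gives one term per choice of a load for each arm, and
`lintegral_prod_stopExp` evaluates each term. -/
theorem lintegral_prod_sum_stopExp [m : MeasurableSpace Ω] {P : Measure Ω}
    [IsProbabilityMeasure P] {T : ℕ} {ξ : ℕ → Ω → ℝ} (hξ : IsGaussianNoise P T ξ)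
    {A : ℕ → Ω → Fin K} (hA : ∀ t < T, Measurable[hist ξ t] (A t)) {ι : Type*} (I : Finset ι)
    (w : Fin K → ι → ℝ≥0∞) (lam : Fin K → ι → ℝ) {Cr : Fin K → ι → ℕ → Ω → Prop}
    (hCr : ∀ a i, ∀ t < T, MeasurableSet[hist ξ t] {ω | Cr a i t ω}) :
    ∫⁻ ω, ∏ a, ∑ i ∈ I, w a i * stopExp ξ A T a (lam a i) (Cr a i) ω ∂P
      = ∏ a, ∑ i ∈ I, w a i := by
  classical
  simp_rw [Finset.prod_univ_sum]
  rw [lintegral_finsetSum]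
  · refine Finset.sum_congr rfl fun f _ => ?_
    simp_rw [Finset.prod_mul_distrib]
    rw [lintegral_const_mul, lintegral_prod_stopExp hξ hA (fun a => lam a (f a))
      (Cr := fun a => Cr a (f a)) (fun a => hCr a (f a)), mul_one]
    exact Finset.measurable_fun_prod _ fun a _ => measurable_stopExp hξ hA a _ (hCr a (f a))
  · intro f _
    exact Finset.measurable_fun_prod _ fun a _ =>
      (measurable_stopExp hξ hA a _ (hCr a (f a))).const_mul _

/-! ### Bad arms and dyadic peeling. -/

/-- The event that the normalized noise of arm `a` exceeds `x` at some time. -/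
def bad (ξ : ℕ → Ω → ℝ) (A : ℕ → Ω → Fin K) (T : ℕ) (x : ℝ) (a : Fin K) : Set Ω :=
  {ω | ∃ t ≤ T, 1 ≤ pulls A t a ω ∧ x * √(pulls A t a ω : ℝ) ≤ |armSum ξ A t a ω|}

/-- The bound for the probability of `bad`. -/
def badBound (T : ℕ) (x : ℝ) : ℝ := 2 * (Nat.log 2 T + 1) * Real.exp (-(x ^ 2 / 4))

/-- The event that the noise of sign `i.2` exceeds `x` while the number of pulls lies in the
dyadic block `i.1`. -/
def blockCross (ξ : ℕ → Ω → ℝ) (A : ℕ → Ω → Fin K) (x : ℝ) (a : Fin K) (i : ℕ × Bool)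
    (t : ℕ) (ω : Ω) : Prop :=
  (2 ^ i.1 ≤ pulls A t a ω ∧ pulls A t a ω < 2 ^ (i.1 + 1)) ∧
    x * √(pulls A t a ω : ℝ) ≤ (if i.2 then 1 else -1) * armSum ξ A t a ω

/-- The load adapted to `blockCross`. -/
def blockLoad (x : ℝ) (i : ℕ × Bool) : ℝ := (if i.2 then 1 else -1) * (x / √(2 ^ (i.1 + 1)))

/-- The set of dyadic blocks with a sign. -/
def blocks (T : ℕ) : Finset (ℕ × Bool) := Finset.range (Nat.log 2 T + 1) ×ˢ Finset.univ

theorem measurableSet_blockCross {ξ : ℕ → Ω → ℝ} {A : ℕ → Ω → Fin K} {T : ℕ}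
    (hA : ∀ t < T, Measurable[hist ξ t] (A t)) (x : ℝ) (a : Fin K) (i : ℕ × Bool) {t : ℕ}
    (ht : t < T) : MeasurableSet[hist ξ t] {ω | blockCross ξ A x a i t ω} := by
  have h1 : Measurable[hist ξ t] (pulls A t a) := measurable_pulls
    (fun s hs => (hA s (hs.trans ht)).mono (hist_mono ξ hs.le) le_rfl) a
  have h2 : Measurable[hist ξ t] (armSum ξ A t a) := measurable_armSum
    (fun s hs => (hA s (hs.trans ht)).mono (hist_mono ξ hs.le) le_rfl)
    (fun s hs => measurable_noise_hist ξ hs) a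
  refine MeasurableSet.inter (MeasurableSet.inter ?_ ?_) ?_
  · exact measurableSet_le measurable_const h1
  · exact measurableSet_lt h1 measurable_const
  · refine measurableSet_le (Measurable.const_mul ?_ x) (h2.const_mul _)
    exact Real.continuous_sqrt.measurable.comp ((measurable_of_countable _).comp h1)

/-- With N = 2^(i+1) and N/2 ≤ n ≤ N, the load x/√N yields a linear term at least x²√(n/N) ≥ x² n/N
and a quadratic loss of x² n/(2N). The difference is at least x² n/(2N) ≥ x²/4. -/
theorem blockCross_le {ξ : ℕ → Ω → ℝ} {A : ℕ → Ω → Fin K} {x : ℝ} (hx : 0 ≤ x) {a : Fin K}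
    {i : ℕ × Bool} {t : ℕ} {ω : Ω} (h : blockCross ξ A x a i t ω) :
    x ^ 2 / 4 ≤ blockLoad x i * armSum ξ A t a ω - blockLoad x i ^ 2 / 2 * pulls A t a ω := by
  obtain ⟨⟨h1, h2⟩, h3⟩ := h
  have h1' : (2 : ℝ) ^ i.1 ≤ pulls A t a ω := by exact_mod_cast h1
  have h2' : (pulls A t a ω : ℝ) ≤ 2 ^ (i.1 + 1) := by exact_mod_cast h2.le
  set n : ℝ := (pulls A t a ω : ℝ)
  set N : ℝ := 2 ^ (i.1 + 1) with hN
  have hN0 : 0 < N := by positivity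
  have hn : N / 2 ≤ n := by rw [hN, pow_succ]; linarith
  have hsN : 0 < √N := Real.sqrt_pos.2 hN0
  have hn0 : 0 ≤ n := by linarith
  have hle : √n ≤ √N := Real.sqrt_le_sqrt h2'
  have e1 : √N ^ 2 = N := Real.sq_sqrt hN0.le
  have e2 : √n ^ 2 = n := Real.sq_sqrt hn0
  have hs : (if i.2 then (1 : ℝ) else -1) ^ 2 = 1 := by split_ifs <;> norm_num
  have : blockLoad x i * armSum ξ A t a ω - blockLoad x i ^ 2 / 2 * n =
      x / √N * ((if i.2 then 1 else -1) * armSum ξ A t a ω) - x ^ 2 * n / (2 * N) := by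
    unfold blockLoad
    rw [mul_pow, hs, div_pow, ← hN, e1]
    field_simp
  rw [this]
  have h4 : x / √N * (x * √n) ≤ x / √N * ((if i.2 then 1 else -1) * armSum ξ A t a ω) := by
    gcongr
  have h5 : x ^ 2 * (n / N) ≤ x / √N * (x * √n) := by
    have : x / √N * (x * √n) = x ^ 2 * (√n / √N) := by ring
    rw [this]
    refine mul_le_mul_of_nonneg_left ?_ (sq_nonneg x)
    rw [div_le_div_iff₀ hN0 hsN]
    nlinarith [Real.sqrt_nonneg n, mul_nonneg (Real.sqrt_nonneg n) (sub_nonneg.2 hle),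
      mul_nonneg hsN.le (mul_nonneg (Real.sqrt_nonneg n) (sub_nonneg.2 hle))]
  have h6 : x ^ 2 * n / (2 * N) = x ^ 2 * (n / N) / 2 := by field_simp
  have h7 : 1 / 2 ≤ n / N := by rw [le_div_iff₀ hN0]; linarith
  have h8 : x ^ 2 * (1 / 2) ≤ x ^ 2 * (n / N) := by gcongr
  linarith

theorem exists_blockCross {ξ : ℕ → Ω → ℝ} {A : ℕ → Ω → Fin K} {T : ℕ} {x : ℝ} {a : Fin K} {ω : Ω}
    (h : ω ∈ bad ξ A T x a) : ∃ i ∈ blocks T, ∃ t ≤ T, blockCross ξ A x a i t ω := by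
  obtain ⟨t, ht, h1, h2⟩ := h
  have hle : pulls A t a ω ≤ T := by
    refine le_trans ?_ ht
    unfold pulls
    exact (Finset.card_filter_le _ _).trans (by simp)
  have hb : 2 ^ Nat.log 2 (pulls A t a ω) ≤ pulls A t a ω ∧
      pulls A t a ω < 2 ^ (Nat.log 2 (pulls A t a ω) + 1) :=
    ⟨Nat.pow_log_le_self 2 (by omega), Nat.lt_pow_succ_log_self (by norm_num) _⟩
  have hm : ∀ s : Bool, (Nat.log 2 (pulls A t a ω), s) ∈ blocks T := by
    intro s
    simp only [blocks, Finset.mem_product, Finset.mem_range, Finset.mem_univ, and_true]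
    exact Nat.lt_succ_of_le (Nat.log_mono_right hle)
  rcases le_abs.1 h2 with h3 | h3
  · exact ⟨_, hm true, t, ht, hb, by simpa using h3⟩
  · exact ⟨_, hm false, t, ht, hb, by simpa using h3⟩

theorem card_blocks (T : ℕ) : ((blocks T).card : ℝ) = 2 * (Nat.log 2 T + 1) := by
  simp [blocks, mul_comm]

/-- The union bound over blocks and signs is kept as a pointwise domination by martingales, because
such bounds can be multiplied over the arms before integrating. -/
theorem indicator_bad_le {ξ : ℕ → Ω → ℝ} {A : ℕ → Ω → Fin K} {T : ℕ} {x : ℝ} (hx : 0 ≤ x)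
    (a : Fin K) (ω : Ω) : (bad ξ A T x a).indicator (fun _ => (1 : ℝ≥0∞)) ω ≤
      ∑ i ∈ blocks T, ENNReal.ofReal (Real.exp (-(x ^ 2 / 4))) *
        stopExp ξ A T a (blockLoad x i) (blockCross ξ A x a i) ω := by
  by_cases h : ω ∈ bad ξ A T x a
  · rw [Set.indicator_of_mem h]
    obtain ⟨i, hi, hc⟩ := exists_blockCross h
    have h1 := le_stopLog (ξ := ξ) (lam := blockLoad x i) (c := x ^ 2 / 4)
      (fun t _ ht => blockCross_le hx ht) hc
    refine le_trans ?_ (Finset.single_le_sum (f := fun i =>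
      ENNReal.ofReal (Real.exp (-(x ^ 2 / 4))) *
        stopExp ξ A T a (blockLoad x i) (blockCross ξ A x a i) ω) (fun _ _ => zero_le) hi)
    simp only [stopExp]
    rw [← ENNReal.ofReal_mul (Real.exp_pos _).le, ← Real.exp_add, ENNReal.one_le_ofReal]
    exact Real.one_le_exp (by linarith)
  · rw [Set.indicator_of_notMem h]; exact zero_le

theorem sum_blocks_weight (T : ℕ) (x : ℝ) :
    ∑ _i ∈ blocks T, ENNReal.ofReal (Real.exp (-(x ^ 2 / 4))) = ENNReal.ofReal (badBound T x) := by
  rw [Finset.sum_const, nsmul_eq_mul, badBound, ← card_blocks,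
    ENNReal.ofReal_mul (by positivity), ENNReal.ofReal_natCast]

/-- The generating function of the bad arms is bounded as if these events were independent. -/
theorem lintegral_prod_bad_le [m : MeasurableSpace Ω] {P : Measure Ω}
    [IsProbabilityMeasure P] {T : ℕ} {ξ : ℕ → Ω → ℝ} (hξ : IsGaussianNoise P T ξ)
    {A : ℕ → Ω → Fin K} (hA : ∀ t < T, Measurable[hist ξ t] (A t)) {x : ℝ} (hx : 0 ≤ x)
    (c : Fin K → ℝ≥0∞) :
    ∫⁻ ω, ∏ a, (1 + c a * (bad ξ A T x a).indicator (fun _ => (1 : ℝ≥0∞)) ω) ∂P ≤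
      ∏ a, (1 + c a * ENNReal.ofReal (badBound T x)) := by
  -- The extra element `none`, with weight 1 and load 0, produces the summand 1 of each factor.
  have h := lintegral_prod_sum_stopExp hξ hA (Finset.insertNone (blocks T))
    (fun a i => i.elim 1 (fun _ => c a * ENNReal.ofReal (Real.exp (-(x ^ 2 / 4)))))
    (fun _ i => i.elim 0 (blockLoad x))
    (Cr := fun a i => i.elim (fun _ _ => False) (blockCross ξ A x a)) (by
      rintro a (_ | i) t ht
      · simp
      · exact measurableSet_blockCross hA x a i ht)
  simp only [Finset.sum_insertNone, Option.elim, ← Finset.mul_sum, sum_blocks_weight] at h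
  rw [← h]
  refine lintegral_mono fun ω => ?_
  refine Finset.prod_le_prod' fun a _ => ?_
  have h1 : stopExp ξ A T a 0 (fun _ _ => False) ω = 1 := by
    simp [stopExp, stopLog, stopLoad]
  rw [h1, mul_one]
  rw [mul_assoc, Finset.mul_sum]
  refine add_le_add le_rfl (mul_le_mul' le_rfl ?_)
  exact indicator_bad_le hx a ω

theorem measurableSet_bad [m : MeasurableSpace Ω] {P : Measure Ω} {T : ℕ} {ξ : ℕ → Ω → ℝ}
    (hξ : IsGaussianNoise P T ξ) {A : ℕ → Ω → Fin K}
    (hA : ∀ t < T, Measurable[hist ξ t] (A t)) (x : ℝ) (a : Fin K) :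
    MeasurableSet (bad ξ A T x a) := by
  have : bad ξ A T x a = ⋃ t : ℕ, ⋃ (_ : t ≤ T), {ω | 1 ≤ pulls A t a ω ∧
      x * √(pulls A t a ω : ℝ) ≤ |armSum ξ A t a ω|} := by
    ext ω; simp only [bad, Set.mem_ofPred_eq, Set.mem_iUnion, exists_prop]
  rw [this]
  refine MeasurableSet.iUnion fun t => MeasurableSet.iUnion fun ht => ?_
  have hA' : ∀ s < t, Measurable (A s) := fun s hs =>
    (hA s (hs.trans_le ht)).mono (hist_le hξ (hs.le.trans ht)) le_rfl
  have h1 : Measurable (pulls A t a) := measurable_pulls hA' a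
  have h2 : Measurable (armSum ξ A t a) :=
    measurable_armSum hA' (fun s hs => hξ.measurable s (hs.trans_le ht)) a
  have h3 : Measurable fun ω => x * √(pulls A t a ω : ℝ) :=
    (Real.continuous_sqrt.measurable.comp ((measurable_of_countable _).comp h1)).const_mul x
  exact (measurableSet_le measurable_const h1).inter (measurableSet_le h3 h2.abs)

theorem measure_bad_le [m : MeasurableSpace Ω] {P : Measure Ω}
    [IsProbabilityMeasure P] {T : ℕ} {ξ : ℕ → Ω → ℝ} (hξ : IsGaussianNoise P T ξ)
    {A : ℕ → Ω → Fin K} (hA : ∀ t < T, Measurable[hist ξ t] (A t)) {x : ℝ} (hx : 0 ≤ x)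
    (a : Fin K) : P.real (bad ξ A T x a) ≤ badBound T x := by
  refine ENNReal.toReal_le_of_le_ofReal (by unfold badBound; positivity) ?_
  rw [← lintegral_indicator_one (measurableSet_bad hξ hA x a)]
  refine (lintegral_mono (indicator_bad_le hx a)).trans ?_
  rw [lintegral_finsetSum _ fun i _ => (measurable_stopExp hξ hA a _
    (fun t ht => measurableSet_blockCross hA x a i ht)).const_mul _, ← sum_blocks_weight]
  refine (Finset.sum_congr rfl fun i _ => ?_).le
  rw [lintegral_const_mul _ (measurable_stopExp hξ hA a _
    (fun t ht => measurableSet_blockCross hA x a i ht)), lintegral_stopExp hξ hA a _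
    (fun t ht => measurableSet_blockCross hA x a i ht), mul_one]

/-! ### Chernoff bound for the weighted number of bad arms. -/

/-- Convexity of exp on the chord from 0 to s. It lets arms of fractional weight enter the Chernoff
bound with a cost linear in the weight. -/
theorem exp_mul_sub_one_le {s y : ℝ} (hy : 0 ≤ y) (hy1 : y ≤ 1) :
    Real.exp (s * y) - 1 ≤ y * Real.exp s := by
  have h := convexOn_exp.2 (Set.mem_univ s) (Set.mem_univ (0 : ℝ)) hy (sub_nonneg.2 hy1)
    (by ring)
  simp only [smul_eq_mul, mul_zero, add_zero, Real.exp_zero, mul_one] at h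
  rw [mul_comm s y]
  linarith

/-- A Chernoff bound for the weighted number of bad arms. -/
theorem measure_half_le_sum_bad [m : MeasurableSpace Ω] {P : Measure Ω}
    [IsProbabilityMeasure P] {T : ℕ} {ξ : ℕ → Ω → ℝ} (hξ : IsGaussianNoise P T ξ)
    {A : ℕ → Ω → Fin K} (hA : ∀ t < T, Measurable[hist ξ t] (A t)) {x s r : ℝ} (hx : 0 ≤ x)
    (hs : 0 ≤ s) (hb : badBound T x ≤ Real.exp (-s)) (hr : 0 < r) (q : Fin K → ℝ)
    (hq0 : ∀ a, 0 ≤ q a) (hqr : ∀ a, r * q a ≤ 1) (hq1 : ∑ a, q a ≤ 1) :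
    P.real {ω | 1 / 2 ≤ ∑ a, q a * (bad ξ A T x a).indicator (fun _ => (1 : ℝ)) ω} ≤
      Real.exp (r * (1 - s / 2)) := by
  refine ENNReal.toReal_le_of_le_ofReal (Real.exp_pos _).le ?_
  -- Chosen so that 1 + c · 1_bad = exp(s r q · 1_bad); the product is then the exponential moment
  -- of the weighted sum.
  let c : Fin K → ℝ := fun a => Real.exp (s * (r * q a)) - 1
  have hc0 : ∀ a, 0 ≤ c a := fun a => by
    have := Real.one_le_exp (mul_nonneg hs (mul_nonneg hr.le (hq0 a)))
    simp only [c]; linarith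
  have hp0 : 0 ≤ badBound T x := by unfold badBound; positivity
  let f : Ω → ℝ≥0∞ := fun ω =>
    ∏ a, (1 + ENNReal.ofReal (c a) * (bad ξ A T x a).indicator (fun _ => (1 : ℝ≥0∞)) ω)
  have hf : Measurable f := Finset.measurable_fun_prod _ fun a _ =>
    (((measurable_const.indicator (measurableSet_bad hξ hA x a))).const_mul _).const_add _
  have hf' : ∀ ω, f ω = ENNReal.ofReal (Real.exp (s * r *
      ∑ a, q a * (bad ξ A T x a).indicator (fun _ => (1 : ℝ)) ω)) := by
    intro ω
    rw [Finset.mul_sum, Real.exp_sum, ENNReal.ofReal_prod_of_nonneg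
      (fun _ _ => (Real.exp_pos _).le)]
    refine Finset.prod_congr rfl fun a _ => ?_
    by_cases h : ω ∈ bad ξ A T x a
    · simp only [Set.indicator_of_mem h, mul_one, c]
      rw [← ENNReal.ofReal_one, ← ENNReal.ofReal_add zero_le_one (hc0 a)]
      congr 1
      simp only [c]; ring_nf
    · simp [Set.indicator_of_notMem h]
  have h1 := mul_meas_ge_le_lintegral (μ := P) hf (ENNReal.ofReal (Real.exp (s * r / 2)))
  have h2 : ∫⁻ ω, f ω ∂P ≤ ENNReal.ofReal (Real.exp r) := by
    refine (lintegral_prod_bad_le hξ hA hx _).trans ?_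
    have e : ∀ a, 1 + ENNReal.ofReal (c a) * ENNReal.ofReal (badBound T x) =
        ENNReal.ofReal (1 + c a * badBound T x) := fun a => by
      rw [← ENNReal.ofReal_mul (hc0 a), ← ENNReal.ofReal_one,
        ← ENNReal.ofReal_add zero_le_one (mul_nonneg (hc0 a) hp0)]
    simp_rw [e]
    rw [← ENNReal.ofReal_prod_of_nonneg fun a _ => by have := mul_nonneg (hc0 a) hp0; linarith]
    refine ENNReal.ofReal_le_ofReal ?_
    calc ∏ a, (1 + c a * badBound T x) ≤ ∏ a, Real.exp (r * q a) := by
          refine Finset.prod_le_prod (fun a _ => by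
            have := mul_nonneg (hc0 a) hp0; linarith) fun a _ => ?_
          have h3 : c a ≤ r * q a * Real.exp s :=
            exp_mul_sub_one_le (mul_nonneg hr.le (hq0 a)) (hqr a)
          have h4 : c a * badBound T x ≤ r * q a * Real.exp s * Real.exp (-s) :=
            mul_le_mul h3 hb hp0 (mul_nonneg (mul_nonneg hr.le (hq0 a)) (Real.exp_pos _).le)
          rw [mul_assoc, ← Real.exp_add, add_neg_cancel, Real.exp_zero, mul_one] at h4
          have := Real.add_one_le_exp (r * q a)
          linarith
      _ = Real.exp (r * ∑ a, q a) := by rw [← Real.exp_sum, Finset.mul_sum]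
      _ ≤ Real.exp r := Real.exp_le_exp.2 (by nlinarith)
  have hset : {ω | 1 / 2 ≤ ∑ a, q a * (bad ξ A T x a).indicator (fun _ => (1 : ℝ)) ω} ⊆
      {ω | ENNReal.ofReal (Real.exp (s * r / 2)) ≤ f ω} := by
    intro ω hω
    have hω' : 1 / 2 ≤ ∑ a, q a * (bad ξ A T x a).indicator (fun _ => (1 : ℝ)) ω := hω
    simp only [Set.mem_ofPred_eq, hf']
    refine ENNReal.ofReal_le_ofReal (Real.exp_le_exp.2 ?_)
    nlinarith [mul_nonneg hs hr.le]
  have h3 : ENNReal.ofReal (Real.exp (-(s * r / 2))) * ENNReal.ofReal (Real.exp (s * r / 2))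
      = 1 := by
    rw [← ENNReal.ofReal_mul (Real.exp_pos _).le, ← Real.exp_add]; simp
  calc P {ω | 1 / 2 ≤ ∑ a, q a * (bad ξ A T x a).indicator (fun _ => (1 : ℝ)) ω}
      ≤ P {ω | ENNReal.ofReal (Real.exp (s * r / 2)) ≤ f ω} := measure_mono hset
    _ = ENNReal.ofReal (Real.exp (-(s * r / 2))) * (ENNReal.ofReal (Real.exp (s * r / 2)) *
          P {ω | ENNReal.ofReal (Real.exp (s * r / 2)) ≤ f ω}) := by
        rw [← mul_assoc, h3, one_mul]
    _ ≤ ENNReal.ofReal (Real.exp (-(s * r / 2))) * ENNReal.ofReal (Real.exp r) := by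
        gcongr; exact h1.trans h2
    _ = _ := by
        rw [← ENNReal.ofReal_mul (Real.exp_pos _).le, ← Real.exp_add]; congr 2; ring

/-- The load y/n is optimal for n pulls, and stopping at the crossing gives the Gaussian tail of a
sum of n noises although the pull times are random. -/
theorem measure_armSum_ge_le [m : MeasurableSpace Ω] {P : Measure Ω}
    [IsProbabilityMeasure P] {T : ℕ} {ξ : ℕ → Ω → ℝ} (hξ : IsGaussianNoise P T ξ)
    {A : ℕ → Ω → Fin K} (hA : ∀ t < T, Measurable[hist ξ t] (A t)) {n : ℕ} (hn : 1 ≤ n) {y : ℝ}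
    (hy : 0 ≤ y) (a : Fin K) :
    P.real {ω | ∃ t ≤ T, pulls A t a ω = n ∧ y ≤ armSum ξ A t a ω} ≤
      Real.exp (-(y ^ 2 / (2 * n))) := by
  refine ENNReal.toReal_le_of_le_ofReal (Real.exp_pos _).le ?_
  refine measure_exists_le hξ hA a (y / n) _ (Cr := fun t ω => pulls A t a ω = n ∧
    y ≤ armSum ξ A t a ω) ?_ ?_
  · intro t ht
    have h1 : Measurable[hist ξ t] (pulls A t a) := measurable_pulls
      (fun s hs => (hA s (hs.trans ht)).mono (hist_mono ξ hs.le) le_rfl) a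
    have h2 : Measurable[hist ξ t] (armSum ξ A t a) := measurable_armSum
      (fun s hs => (hA s (hs.trans ht)).mono (hist_mono ξ hs.le) le_rfl)
      (fun s hs => measurable_noise_hist ξ hs) a
    exact MeasurableSet.inter (h1 (measurableSet_singleton n))
      (measurableSet_le measurable_const h2)
  · rintro ω t _ ⟨h1, h2⟩
    rw [h1]
    have hn' : (0 : ℝ) < n := by exact_mod_cast hn
    have h3 : y / n * y ≤ y / n * armSum ξ A t a ω := by gcongr
    have h4 : y ^ 2 / (2 * n) = y / n * y - (y / n) ^ 2 / 2 * n := by field_simp; ring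
    linarith

/-! ### Normalized runs and the noiseless allocation. -/

/-- The upper confidence index, centred at the best mean and measured in units of `σ γ`; here
`d` is the vector of gaps in these units. -/
def nlev (d : Fin K → ℝ) (γ : ℝ) (ξ : ℕ → Ω → ℝ) (A : ℕ → Ω → Fin K) (t : ℕ) (a : Fin K) (ω : Ω) :
    ℝ :=
  (1 + armSum ξ A t a ω / (γ * √(pulls A t a ω : ℝ))) / √(pulls A t a ω : ℝ) - d a

/-- The noiseless number of pulls of arm `a` when the normalized index is `u`. -/
def xc (d : Fin K → ℝ) (u : ℝ) (a : Fin K) : ℝ := ((u + d a) ^ 2)⁻¹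

/-- The noiseless time at which the normalized index is `u`. -/
def totalPulls (d : Fin K → ℝ) (u : ℝ) : ℝ := ∑ a, xc d u a

/-- The noiseless normalized regret at which the normalized index is `u`. -/
def totalRegret (d : Fin K → ℝ) (u : ℝ) : ℝ := ∑ a, d a * xc d u a

/-- A run of `UCB1` in normalized units. -/
structure IsRun [MeasurableSpace Ω] (P : Measure Ω) (T : ℕ) (d : Fin K → ℝ) (γ : ℝ)
    (ξ : ℕ → Ω → ℝ) (A : ℕ → Ω → Fin K) : Prop where
  noise : IsGaussianNoise P T ξ
  adapted : ∀ t < T, Measurable[hist ξ t] (A t)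
  init : ∀ ω a, pulls A K a ω = 1
  argmax : ∀ t, K ≤ t → t < T → ∀ ω b, nlev d γ ξ A t b ω ≤ nlev d γ ξ A t (A t ω) ω
  nonneg : ∀ a, 0 ≤ d a
  lt : K < T
  pos : 0 < γ

theorem pulls_succ (A : ℕ → Ω → Fin K) (t : ℕ) (a : Fin K) (ω : Ω) :
    pulls A (t + 1) a ω = pulls A t a ω + if A t ω = a then 1 else 0 := by
  unfold pulls
  rw [Finset.range_add_one, Finset.filter_insert]
  split_ifs with h
  · rw [Finset.card_insert_of_notMem (by simp)]
  · simp

theorem pulls_mono (A : ℕ → Ω → Fin K) (a : Fin K) (ω : Ω) : Monotone fun t => pulls A t a ω :=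
  monotone_nat_of_le_succ fun t => by simp [pulls_succ]

theorem pulls_le (A : ℕ → Ω → Fin K) (t : ℕ) (a : Fin K) (ω : Ω) : pulls A t a ω ≤ t :=
  (Finset.card_filter_le _ _).trans (by simp)

theorem sum_pulls (A : ℕ → Ω → Fin K) (t : ℕ) (ω : Ω) : ∑ a, pulls A t a ω = t := by
  induction t with
  | zero => simp [pulls]
  | succ t ih => simp [pulls_succ, Finset.sum_add_distrib, ih]

theorem xc_nonneg (d : Fin K → ℝ) (u : ℝ) (a : Fin K) : 0 ≤ xc d u a := by
  unfold xc; positivity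

theorem xc_anti {d : Fin K → ℝ} {u w : ℝ} {a : Fin K} (hu : 0 < u + d a) (huw : u ≤ w) :
    xc d w a ≤ xc d u a := by
  unfold xc; gcongr

theorem totalPulls_nonneg (d : Fin K → ℝ) (u : ℝ) : 0 ≤ totalPulls d u :=
  Finset.sum_nonneg fun a _ => xc_nonneg d u a

theorem totalRegret_nonneg {d : Fin K → ℝ} (hd : ∀ a, 0 ≤ d a) (u : ℝ) : 0 ≤ totalRegret d u :=
  Finset.sum_nonneg fun a _ => mul_nonneg (hd a) (xc_nonneg d u a)

/-- The average gap under the noiseless allocation increases with the index. -/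
theorem totalRegret_mul_le {d : Fin K → ℝ} (hd : ∀ a, 0 ≤ d a) {u w : ℝ} (hu : 0 < u)
    (huw : u ≤ w) : totalRegret d u * totalPulls d w ≤ totalRegret d w * totalPulls d u := by
  -- Chebyshev's sum inequality: the ratio xc(w)/xc(u) = ((u + d)/(w + d))² is nondecreasing in d
  -- when u ≤ w, so each symmetrized term is nonnegative. The double sum is twice the difference
  -- sought.
  have key : ∀ a b, 0 ≤ (d a - d b) * (xc d w a * xc d u b - xc d u a * xc d w b) := by
    intro a b
    have ha := hd a
    have hb := hd b
    have e : (d a - d b) * (xc d w a * xc d u b - xc d u a * xc d w b) =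
        (d a - d b) * (((u + d a) * (w + d b)) ^ 2 - ((w + d a) * (u + d b)) ^ 2) *
          (((w + d a) * (u + d b) * (u + d a) * (w + d b)) ^ 2)⁻¹ := by
      have h1 : u + d a ≠ 0 := by positivity
      have h2 : u + d b ≠ 0 := by positivity
      have hw : 0 < w := hu.trans_le huw
      have h3 : w + d a ≠ 0 := by positivity
      have h4 : w + d b ≠ 0 := by positivity
      unfold xc
      field_simp
    rw [e]
    refine mul_nonneg ?_ (by positivity)
    have hw : 0 < w := hu.trans_le huw
    have e2 : (d a - d b) * (((u + d a) * (w + d b)) ^ 2 - ((w + d a) * (u + d b)) ^ 2) =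
        (d a - d b) ^ 2 * (w - u) * ((u + d a) * (w + d b) + (w + d a) * (u + d b)) := by ring
    rw [e2]
    have : 0 ≤ w - u := by linarith
    positivity
  have hsum : 0 ≤ ∑ a, ∑ b, (d a - d b) * (xc d w a * xc d u b - xc d u a * xc d w b) :=
    Finset.sum_nonneg fun a _ => Finset.sum_nonneg fun b _ => key a b
  have e3 : ∑ a, ∑ b, (d a - d b) * (xc d w a * xc d u b - xc d u a * xc d w b) =
      2 * (totalRegret d w * totalPulls d u - totalRegret d u * totalPulls d w) := by
    have s1 : ∀ f g : Fin K → ℝ, ∑ a, ∑ b, f a * g b = (∑ a, f a) * ∑ b, g b := fun f g =>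
      (Finset.sum_mul_sum _ _ _ _).symm
    have e4 : ∀ a b, (d a - d b) * (xc d w a * xc d u b - xc d u a * xc d w b) =
        (d a * xc d w a) * xc d u b - (d a * xc d u a) * xc d w b
          - xc d w a * (d b * xc d u b) + xc d u a * (d b * xc d w b) := fun a b => by ring
    simp_rw [e4, Finset.sum_add_distrib, Finset.sum_sub_distrib, s1]
    unfold totalRegret totalPulls
    ring
  linarith

/-! ### Pathwise comparison with the noiseless allocation. -/

section Pathwise

variable (T : ℕ) (d : Fin K → ℝ) (γ : ℝ) (ξ : ℕ → Ω → ℝ) (A : ℕ → Ω → Fin K)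

/-- The event that arm `a` has normalized index at least `u` after `n` pulls. -/
def reach (u : ℝ) (a : Fin K) (n : ℕ) : Set Ω :=
  {ω | ∃ t < T, pulls A t a ω = n ∧ u ≤ nlev d γ ξ A t a ω}

/-- The event that all normalized indices are at most `u` at some time. -/
def drop (u : ℝ) : Set Ω := {ω | ∃ t, K ≤ t ∧ t < T ∧ ∀ b, nlev d γ ξ A t b ω ≤ u}

/-- One plus the number of values of the pull count at which arm `a` has normalized index at
least `u`. -/
def reachCount (u : ℝ) (a : Fin K) (ω : Ω) : ℝ :=
  1 + ∑ n ∈ Finset.Icc 1 T, (reach T d γ ξ A u a n).indicator (fun _ => (1 : ℝ)) ω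

theorem reachCount_nonneg (u : ℝ) (a : Fin K) (ω : Ω) : 0 ≤ reachCount T d γ ξ A u a ω :=
  add_nonneg zero_le_one (Finset.sum_nonneg fun _ _ => Set.indicator_nonneg (by simp) _)

end Pathwise

variable {T : ℕ} {d : Fin K → ℝ} {γ : ℝ} {ξ : ℕ → Ω → ℝ} {A : ℕ → Ω → Fin K}

theorem IsRun.one_le_pulls [MeasurableSpace Ω] {P : Measure Ω} (h : IsRun P T d γ ξ A) {t : ℕ}
    (ht : K ≤ t) (a : Fin K) (ω : Ω) : 1 ≤ pulls A t a ω :=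
  (h.init ω a).symm.le.trans (pulls_mono A a ω ht)

theorem IsRun.level_le_of_notMem_drop [MeasurableSpace Ω] {P : Measure Ω}
    (h : IsRun P T d γ ξ A) {u : ℝ} {ω : Ω} (hω : ω ∉ drop T d γ ξ A u) {t : ℕ} (h1 : K ≤ t)
    (h2 : t < T) : u ≤ nlev d γ ξ A t (A t ω) ω := by
  by_contra hc
  exact hω ⟨t, h1, h2, fun b => (h.argmax t h1 h2 ω b).trans (not_le.1 hc).le⟩

/-- V is the minimum of the maximal index over K ≤ t < T. Its first property will bound pull counts
from below, its second from above. -/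
theorem IsRun.exists_level [MeasurableSpace Ω] {P : Measure Ω} (h : IsRun P T d γ ξ A) (ω : Ω) :
    ∃ V, (∃ t, K ≤ t ∧ t < T ∧ ∀ b, nlev d γ ξ A t b ω ≤ V) ∧
      ∀ t, K ≤ t → t < T → V ≤ nlev d γ ξ A t (A t ω) ω := by
  obtain ⟨t, ht, hmin⟩ := Finset.exists_min_image (Finset.Ico K T)
    (fun t => nlev d γ ξ A t (A t ω) ω) ⟨K, by simp [h.lt]⟩
  rw [Finset.mem_Ico] at ht
  exact ⟨_, ⟨t, ht.1, ht.2, h.argmax t ht.1 ht.2 ω⟩,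
    fun s h1 h2 => hmin s (Finset.mem_Ico.2 ⟨h1, h2⟩)⟩

/-- Different pulls of `a` see different current counts, so pulls after initialization inject into
the counts at which the index is at least `u`. The leading 1 in `reachCount` is the initial pull. -/
theorem IsRun.pulls_le_reachCount [MeasurableSpace Ω] {P : Measure Ω} (h : IsRun P T d γ ξ A)
    {u : ℝ} {ω : Ω} (hu : ∀ t, K ≤ t → t < T → u ≤ nlev d γ ξ A t (A t ω) ω) (a : Fin K) :
    (pulls A T a ω : ℝ) ≤ reachCount T d γ ξ A u a ω := by
  classical
  set S := (Finset.Ico K T).filter (fun t => A t ω = a) with hS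
  set R := (Finset.Icc 1 T).filter (fun n => ω ∈ reach T d γ ξ A u a n) with hR
  have h1 : pulls A T a ω = 1 + S.card := by
    rw [← h.init ω a, hS]
    unfold pulls
    rw [Finset.card_filter, Finset.card_filter, Finset.card_filter,
      Finset.sum_range_add_sum_Ico _ h.lt.le]
  have h2 : S.card ≤ R.card := by
    refine Finset.card_le_card_of_injOn (fun t => pulls A t a ω) ?_ ?_
    · intro t ht
      have ht' : t ∈ S := ht
      rw [hS, Finset.mem_filter, Finset.mem_Ico] at ht'
      obtain ⟨⟨h3, h4⟩, h5⟩ := ht'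
      show pulls A t a ω ∈ R
      rw [hR, Finset.mem_filter, Finset.mem_Icc]
      refine ⟨⟨h.one_le_pulls h3 a ω, (pulls_le A t a ω).trans h4.le⟩, t, h4, rfl, ?_⟩
      have := hu t h3 h4
      rwa [h5] at this
    · have key : ∀ s ∈ S, ∀ t ∈ S, s < t → pulls A s a ω ≠ pulls A t a ω := by
        intro s hs t _ hst
        rw [hS, Finset.mem_filter] at hs
        have h3 : pulls A (s + 1) a ω ≤ pulls A t a ω := pulls_mono A a ω hst
        rw [pulls_succ, if_pos hs.2] at h3
        omega
      intro s hs t ht hst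
      rcases lt_trichotomy s t with h3 | h3 | h3
      · exact absurd hst (key s hs t ht h3)
      · exact h3
      · exact absurd hst.symm (key t ht s hs h3)
  have h3 : reachCount T d γ ξ A u a ω = 1 + R.card := by
    unfold reachCount
    rw [hR, Finset.card_filter]
    push_cast
    simp [Set.indicator_apply]
  rw [h1, h3]
  push_cast
  exact_mod_cast Nat.add_le_add_left h2 1

/-- The product equals 1 + S/(γ√n), with S the noise sum after n pulls, and goodness says that the
second term is smaller than ε in absolute value. -/
theorem nlev_le_of_notMem_bad {ε : ℝ} (hγ : 0 < γ) {a : Fin K} {ω : Ω}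
    (hg : ω ∉ bad ξ A T (ε * γ) a) {t : ℕ} (ht : t ≤ T) (hn : 1 ≤ pulls A t a ω) :
    (nlev d γ ξ A t a ω + d a) * √(pulls A t a ω : ℝ) ≤ 1 + ε ∧
      1 - ε ≤ (nlev d γ ξ A t a ω + d a) * √(pulls A t a ω : ℝ) := by
  have hn' : (0 : ℝ) < pulls A t a ω := by exact_mod_cast hn
  have hs : 0 < √(pulls A t a ω : ℝ) := Real.sqrt_pos.2 hn'
  have h1 : |armSum ξ A t a ω| < ε * γ * √(pulls A t a ω : ℝ) := by
    by_contra hc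
    exact hg ⟨t, ht, hn, not_lt.1 hc⟩
  have e : (nlev d γ ξ A t a ω + d a) * √(pulls A t a ω : ℝ) =
      1 + armSum ξ A t a ω / (γ * √(pulls A t a ω : ℝ)) := by
    unfold nlev; field_simp; ring
  have hgs : 0 < γ * √(pulls A t a ω : ℝ) := mul_pos hγ hs
  have h2 : |armSum ξ A t a ω / (γ * √(pulls A t a ω : ℝ))| < ε := by
    rw [abs_div, abs_of_pos hgs, div_lt_iff₀ hgs]
    linarith
  rw [e]
  constructor <;> linarith [(abs_lt.1 h2).1, (abs_lt.1 h2).2]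

theorem IsRun.pulls_le_of_notMem_bad [MeasurableSpace Ω] {P : Measure Ω}
    (h : IsRun P T d γ ξ A) {ε : ℝ} (_hε : 0 ≤ ε) {a : Fin K} {ω : Ω}
    (hg : ω ∉ bad ξ A T (ε * γ) a) {u : ℝ}
    (hu : ∀ t, K ≤ t → t < T → u ≤ nlev d γ ξ A t (A t ω) ω) (hd : 0 < u + d a) :
    (pulls A T a ω : ℝ) ≤ 1 + (1 + ε) ^ 2 * xc d u a := by
  classical
  refine (h.pulls_le_reachCount hu a).trans ?_
  unfold reachCount
  refine add_le_add le_rfl ?_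
  set M := (1 + ε) ^ 2 * xc d u a with hM
  have hM0 : 0 ≤ M := mul_nonneg (sq_nonneg _) (xc_nonneg d u a)
  have hle : ∀ n ∈ Finset.Icc 1 T, (reach T d γ ξ A u a n).indicator (fun _ => (1 : ℝ)) ω ≤
      if n ∈ Finset.Icc 1 ⌊M⌋₊ then 1 else 0 := by
    intro n hn
    by_cases hr : ω ∈ reach T d γ ξ A u a n
    · rw [Set.indicator_of_mem hr, if_pos]
      obtain ⟨t, ht, rfl, h2⟩ := hr
      have h1 := (Finset.mem_Icc.1 hn).1
      rw [Finset.mem_Icc]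
      refine ⟨h1, Nat.le_floor ?_⟩
      have h3 := (nlev_le_of_notMem_bad (d := d) h.pos hg ht.le h1).1
      have h4 : (u + d a) * √(pulls A t a ω : ℝ) ≤ 1 + ε :=
        le_trans (by gcongr) h3
      have h5 : ((u + d a) * √(pulls A t a ω : ℝ)) ^ 2 ≤ (1 + ε) ^ 2 := by gcongr
      rw [mul_pow, Real.sq_sqrt (Nat.cast_nonneg _)] at h5
      rw [hM, xc, ← div_eq_mul_inv, le_div_iff₀ (by positivity)]
      linarith
    · rw [Set.indicator_of_notMem hr]; split_ifs <;> norm_num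
  refine (Finset.sum_le_sum hle).trans ?_
  rw [← Finset.sum_filter, Finset.sum_const, nsmul_eq_mul, mul_one]
  refine le_trans ?_ (Nat.floor_le hM0)
  have : ((Finset.Icc 1 T).filter (fun n => n ∈ Finset.Icc 1 ⌊M⌋₊)).card ≤
      (Finset.Icc 1 ⌊M⌋₊).card :=
    Finset.card_le_card fun n hn => (Finset.mem_filter.1 hn).2
  simpa using this

theorem IsRun.le_pulls_of_notMem_bad [MeasurableSpace Ω] {P : Measure Ω}
    (h : IsRun P T d γ ξ A) {ε : ℝ} (hε : ε ≤ 1) {a : Fin K} {ω : Ω}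
    (hg : ω ∉ bad ξ A T (ε * γ) a) {u : ℝ} {t : ℕ} (h1 : K ≤ t) (h2 : t ≤ T)
    (hu : nlev d γ ξ A t a ω ≤ u) (hd : 0 < u + d a) :
    (1 - ε) ^ 2 * xc d u a ≤ pulls A t a ω := by
  have h3 := (nlev_le_of_notMem_bad (d := d) h.pos hg h2 (h.one_le_pulls h1 a ω)).2
  have h4 : 1 - ε ≤ (u + d a) * √(pulls A t a ω : ℝ) := h3.trans (by gcongr)
  have h5 : (1 - ε) ^ 2 ≤ ((u + d a) * √(pulls A t a ω : ℝ)) ^ 2 := by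
    have : 0 ≤ 1 - ε := by linarith
    gcongr
  rw [mul_pow, Real.sq_sqrt (Nat.cast_nonneg _)] at h5
  rw [xc, ← div_eq_mul_inv, div_le_iff₀ (by positivity)]
  linarith

theorem sum_pulls_real (A : ℕ → Ω → Fin K) (T : ℕ) (ω : Ω) :
    ∑ a, (pulls A T a ω : ℝ) = T := by
  exact_mod_cast sum_pulls A T ω

/-- The indicator of the event `bad`. -/
def badInd (ξ : ℕ → Ω → ℝ) (A : ℕ → Ω → Fin K) (T : ℕ) (x : ℝ) (a : Fin K) (ω : Ω) : ℝ :=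
  (bad ξ A T x a).indicator (fun _ => (1 : ℝ)) ω

theorem badInd_nonneg (x : ℝ) (a : Fin K) (ω : Ω) : 0 ≤ badInd ξ A T x a ω :=
  Set.indicator_nonneg (by simp) _

theorem badInd_of_mem {x : ℝ} {a : Fin K} {ω : Ω} (h : ω ∈ bad ξ A T x a) :
    badInd ξ A T x a ω = 1 := Set.indicator_of_mem h _

theorem badInd_of_notMem {x : ℝ} {a : Fin K} {ω : Ω} (h : ω ∉ bad ξ A T x a) :
    badInd ξ A T x a ω = 0 := Set.indicator_of_notMem h _

/-- Good arms are compared with xc at the level min(V, us). Bad arms are paid for by `reachCount` at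
`w`, a lower bound for the level that is not random. -/
theorem IsRun.regret_le_of_notMem_drop [MeasurableSpace Ω] {P : Measure Ω}
    (h : IsRun P T d γ ξ A) {ε : ℝ} (hε : 0 ≤ ε) (hε1 : ε < 1) {us w : ℝ} (hus : 0 < us)
    (hw : 0 < w) (hG : totalPulls d us = T) {ω : Ω} (hω : ω ∉ drop T d γ ξ A w) :
    ∑ a, d a * pulls A T a ω ≤
      (1 + ε) ^ 2 * (totalRegret d us * (((1 - ε) ^ 2)⁻¹ +
        (∑ b, badInd ξ A T (ε * γ) b ω * xc d w b) / T)) + ∑ a, d a +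
        ∑ a, d a * (badInd ξ A T (ε * γ) a ω * reachCount T d γ ξ A w a ω) := by
  have hT : (0 : ℝ) < T := by exact_mod_cast lt_of_le_of_lt (Nat.zero_le _) h.lt
  obtain ⟨V, ⟨t0, ht1, ht2, hV⟩, hV2⟩ := h.exists_level ω
  have hwV : w ≤ V := by
    by_contra hc
    exact hω ⟨t0, ht1, ht2, fun b => (hV b).trans (not_le.1 hc).le⟩
  have hV0 : 0 < V := hw.trans_le hwV
  have hm0 : 0 < min V us := lt_min hV0 hus
  have hlev : ∀ t, K ≤ t → t < T → min V us ≤ nlev d γ ξ A t (A t ω) ω := fun t h1 h2 =>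
    (min_le_left _ _).trans (hV2 t h1 h2)
  have hlev2 : ∀ t, K ≤ t → t < T → w ≤ nlev d γ ξ A t (A t ω) ω := fun t h1 h2 =>
    hwV.trans (hV2 t h1 h2)
  have h1 : ∑ a, d a * pulls A T a ω ≤ (1 + ε) ^ 2 * totalRegret d (min V us) + ∑ a, d a +
      ∑ a, d a * (badInd ξ A T (ε * γ) a ω * reachCount T d γ ξ A w a ω) := by
    unfold totalRegret
    rw [Finset.mul_sum, ← Finset.sum_add_distrib, ← Finset.sum_add_distrib]
    refine Finset.sum_le_sum fun a _ => ?_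
    have hda := h.nonneg a
    have hx := xc_nonneg d (min V us) a
    by_cases hb : ω ∈ bad ξ A T (ε * γ) a
    · rw [badInd_of_mem hb, one_mul]
      have := mul_le_mul_of_nonneg_left (h.pulls_le_reachCount hlev2 a) hda
      have : 0 ≤ (1 + ε) ^ 2 * (d a * xc d (min V us) a) := by positivity
      linarith
    · rw [badInd_of_notMem hb]
      have := mul_le_mul_of_nonneg_left (h.pulls_le_of_notMem_bad hε hb hlev (by positivity)) hda
      nlinarith
  have h2 : totalRegret d (min V us) ≤ totalRegret d us * (((1 - ε) ^ 2)⁻¹ +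
        (∑ b, badInd ξ A T (ε * γ) b ω * xc d w b) / T) := by
    have hF := totalRegret_nonneg h.nonneg us
    have hB : 0 ≤ (∑ b, badInd ξ A T (ε * γ) b ω * xc d w b) / T :=
      div_nonneg (Finset.sum_nonneg fun b _ => mul_nonneg (badInd_nonneg _ _ _) (xc_nonneg _ _ _))
        hT.le
    have h1ε : 0 < (1 - ε) ^ 2 := by have : 0 < 1 - ε := by linarith
                                     positivity
    rcases le_total us V with hc | hc
    · rw [min_eq_right hc]
      have : 1 ≤ ((1 - ε) ^ 2)⁻¹ := (one_le_inv₀ h1ε).2 (by nlinarith)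
      nlinarith
    · rw [min_eq_left hc]
      have h3 := totalRegret_mul_le h.nonneg hV0 hc
      rw [hG] at h3
      have h4 : totalPulls d V ≤ ((1 - ε) ^ 2)⁻¹ * T +
          ∑ b, badInd ξ A T (ε * γ) b ω * xc d w b := by
        rw [← sum_pulls_real A T ω, Finset.mul_sum, ← Finset.sum_add_distrib]
        refine Finset.sum_le_sum fun b _ => ?_
        have hdb := h.nonneg b
        by_cases hb : ω ∈ bad ξ A T (ε * γ) b
        · rw [badInd_of_mem hb, one_mul]
          have : xc d V b ≤ xc d w b := xc_anti (by positivity) hwV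
          have : 0 ≤ ((1 - ε) ^ 2)⁻¹ * (pulls A T b ω : ℝ) := by positivity
          linarith
        · rw [badInd_of_notMem hb, zero_mul, add_zero, inv_mul_eq_div, le_div_iff₀ h1ε]
          have h5 := h.le_pulls_of_notMem_bad hε1.le hb ht1 ht2.le (hV b) (by positivity)
          have h6 : (pulls A t0 b ω : ℝ) ≤ pulls A T b ω := by
            exact_mod_cast pulls_mono A b ω ht2.le
          linarith
      have h5 : totalRegret d V ≤ totalRegret d us * totalPulls d V / T := by
        rw [le_div_iff₀ hT]; exact h3
      refine h5.trans ?_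
      rw [mul_div_assoc]
      refine mul_le_mul_of_nonneg_left ?_ hF
      rw [div_le_iff₀ hT, add_mul, div_mul_cancel₀ _ hT.ne']
      exact h4
  have h3 : 0 ≤ (1 + ε) ^ 2 := sq_nonneg _
  have := mul_le_mul_of_nonneg_left h2 h3
  linarith

/-- The mirror argument at the level max(V, us). If V ≥ us then F(V) ≥ F(us) G(V)/T, and the upper
bounds on pull counts bound G(V) from below, the initial pulls costing K. -/
theorem IsRun.le_regret [MeasurableSpace Ω] {P : Measure Ω}
    (h : IsRun P T d γ ξ A) {ε : ℝ} (hε : 0 ≤ ε) (hε1 : ε < 1) {us : ℝ} (hus : 0 < us)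
    (hG : totalPulls d us = T) (ω : Ω) :
    (1 - ε) ^ 2 * (totalRegret d us * (((1 + ε) ^ 2)⁻¹ *
        (1 - K / T - (∑ b, badInd ξ A T (ε * γ) b ω * reachCount T d γ ξ A us b ω) / T)) -
        ∑ a, d a * (badInd ξ A T (ε * γ) a ω * xc d us a)) ≤ ∑ a, d a * pulls A T a ω := by
  have hT : (0 : ℝ) < T := by exact_mod_cast lt_of_le_of_lt (Nat.zero_le _) h.lt
  obtain ⟨V, ⟨t0, ht1, ht2, hV⟩, hV2⟩ := h.exists_level ω
  have hF := totalRegret_nonneg h.nonneg us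
  set B := (∑ b, badInd ξ A T (ε * γ) b ω * reachCount T d γ ξ A us b ω) / T with hBdef
  have hB : 0 ≤ B := div_nonneg (Finset.sum_nonneg fun b _ =>
    mul_nonneg (badInd_nonneg _ _ _) (reachCount_nonneg _ _ _ _ _ _ _ _)) hT.le
  have hM0 : 0 < max V us := lt_max_of_lt_right hus
  have h1ε : 0 < (1 + ε) ^ 2 := by positivity
  have h1 : (1 - ε) ^ 2 * (totalRegret d (max V us) -
      ∑ a, d a * (badInd ξ A T (ε * γ) a ω * xc d us a)) ≤ ∑ a, d a * pulls A T a ω := by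
    unfold totalRegret
    rw [← Finset.sum_sub_distrib, Finset.mul_sum]
    refine Finset.sum_le_sum fun a _ => ?_
    have hda := h.nonneg a
    by_cases hb : ω ∈ bad ξ A T (ε * γ) a
    · rw [badInd_of_mem hb, one_mul, ← mul_sub]
      have h2 : xc d (max V us) a ≤ xc d us a := xc_anti (by positivity) (le_max_right _ _)
      have h3 : 0 ≤ (1 - ε) ^ 2 * (d a * (xc d us a - xc d (max V us) a)) := by
        have : 0 ≤ xc d us a - xc d (max V us) a := by linarith
        positivity
      have h4 : 0 ≤ d a * (pulls A T a ω : ℝ) := by positivity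
      nlinarith
    · rw [badInd_of_notMem hb]
      have h5 := h.le_pulls_of_notMem_bad hε1.le hb ht1 ht2.le
        ((hV a).trans (le_max_left V us)) (by positivity)
      have h6 : (pulls A t0 a ω : ℝ) ≤ pulls A T a ω := by
        exact_mod_cast pulls_mono A a ω ht2.le
      have := mul_le_mul_of_nonneg_left (h5.trans h6) hda
      nlinarith
  have h2 : totalRegret d us * (((1 + ε) ^ 2)⁻¹ * (1 - K / T - B)) ≤
      totalRegret d (max V us) := by
    have hKT : 0 ≤ (K : ℝ) / T := by positivity
    have hinv : ((1 + ε) ^ 2)⁻¹ ≤ 1 := inv_le_one_of_one_le₀ (by nlinarith)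
    have hinv0 : 0 ≤ ((1 + ε) ^ 2)⁻¹ := by positivity
    rcases le_total V us with hc | hc
    · rw [max_eq_right hc]
      have : ((1 + ε) ^ 2)⁻¹ * (1 - K / T - B) ≤ 1 := by nlinarith
      nlinarith
    · rw [max_eq_left hc]
      have hV0 : 0 < V := hus.trans_le hc
      have h3 := totalRegret_mul_le h.nonneg hus hc
      rw [hG] at h3
      have hlev2 : ∀ t, K ≤ t → t < T → us ≤ nlev d γ ξ A t (A t ω) ω := fun t h1 h2 =>
        hc.trans (hV2 t h1 h2)
      have h4 : (T : ℝ) ≤ (1 + ε) ^ 2 * totalPulls d V + K +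
          ∑ b, badInd ξ A T (ε * γ) b ω * reachCount T d γ ξ A us b ω := by
        have hK : (K : ℝ) = ∑ _b : Fin K, (1 : ℝ) := by simp
        unfold totalPulls
        rw [← sum_pulls_real A T ω, Finset.mul_sum, hK, ← Finset.sum_add_distrib,
          ← Finset.sum_add_distrib]
        refine Finset.sum_le_sum fun b _ => ?_
        have hdb := h.nonneg b
        by_cases hb : ω ∈ bad ξ A T (ε * γ) b
        · rw [badInd_of_mem hb, one_mul]
          have := h.pulls_le_reachCount hlev2 b
          have : 0 ≤ (1 + ε) ^ 2 * xc d V b := mul_nonneg h1ε.le (xc_nonneg _ _ _)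
          linarith
        · rw [badInd_of_notMem hb]
          have := h.pulls_le_of_notMem_bad hε hb hV2 (by positivity)
          linarith
      have h5 : ((1 + ε) ^ 2)⁻¹ * (1 - K / T - B) ≤ totalPulls d V / T := by
        rw [inv_mul_eq_div, div_le_div_iff₀ h1ε hT]
        have : (1 - K / T - B) * T = T - K -
            ∑ b, badInd ξ A T (ε * γ) b ω * reachCount T d γ ξ A us b ω := by
          rw [hBdef]; field_simp
        rw [this]
        linarith
      calc _ ≤ totalRegret d us * (totalPulls d V / T) := mul_le_mul_of_nonneg_left h5 hF
        _ = totalRegret d us * totalPulls d V / T := by ring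
        _ ≤ totalRegret d V := by rw [div_le_iff₀ hT]; exact h3
  have h3 : 0 ≤ (1 - ε) ^ 2 := sq_nonneg _
  have := mul_le_mul_of_nonneg_left h2 h3
  nlinarith

/-! ### Consequences of a low level. -/

/-- When the level drops to `u`, at least half of the noiseless pulls are those of bad arms. -/
theorem IsRun.half_le_of_mem_drop [MeasurableSpace Ω] {P : Measure Ω}
    (h : IsRun P T d γ ξ A) {u : ℝ} (hu : 0 < u) (hG : 4 * (T : ℝ) ≤ totalPulls d u) {ω : Ω}
    (hω : ω ∈ drop T d γ ξ A u) :
    1 / 2 ≤ ∑ a, xc d u a / totalPulls d u * badInd ξ A T (1 / 4 * γ) a ω := by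
  have hT : (0 : ℝ) < T := by exact_mod_cast lt_of_le_of_lt (Nat.zero_le _) h.lt
  have hG0 : 0 < totalPulls d u := by linarith
  obtain ⟨t, h1, h2, h3⟩ := hω
  -- With ε = 1/4 a good arm has at least (9/16) xc pulls, hence xc ≤ 2 · pulls. Good arms therefore
  -- carry at most 2T ≤ G(u)/2.
  have h4 : totalPulls d u ≤ 2 * T + ∑ a, xc d u a * badInd ξ A T (1 / 4 * γ) a ω := by
    unfold totalPulls
    rw [← sum_pulls_real A T ω, Finset.mul_sum, ← Finset.sum_add_distrib]
    refine Finset.sum_le_sum fun a _ => ?_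
    have hda := h.nonneg a
    by_cases hb : ω ∈ bad ξ A T (1 / 4 * γ) a
    · rw [badInd_of_mem hb, mul_one]
      have : (0 : ℝ) ≤ pulls A T a ω := by positivity
      linarith
    · rw [badInd_of_notMem hb, mul_zero, add_zero]
      have h5 := h.le_pulls_of_notMem_bad (by norm_num) hb h1 h2.le (h3 a) (by positivity)
      have h6 : (pulls A t a ω : ℝ) ≤ pulls A T a ω := by
        exact_mod_cast pulls_mono A a ω h2.le
      have := xc_nonneg d u a
      linarith
  have h5 : ∑ a, xc d u a / totalPulls d u * badInd ξ A T (1 / 4 * γ) a ω =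
      (∑ a, xc d u a * badInd ξ A T (1 / 4 * γ) a ω) / totalPulls d u := by
    rw [Finset.sum_div]; exact Finset.sum_congr rfl fun a _ => by ring
  rw [h5, le_div_iff₀ hG0]
  linarith

/-- Only the best arm matters: its gap is zero, so a negative index must come entirely from its
noise. -/
theorem IsRun.exists_of_mem_drop_neg [MeasurableSpace Ω] {P : Measure Ω}
    (h : IsRun P T d γ ξ A) {a₀ : Fin K} (h0 : d a₀ = 0) {v : ℝ} {ω : Ω}
    (hω : ω ∈ drop T d γ ξ A (-v)) : ∃ n ∈ Finset.Icc 1 T, ∃ t ≤ T, pulls A t a₀ ω = n ∧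
      γ * √n + γ * n * v ≤ -armSum ξ A t a₀ ω := by
  obtain ⟨t, h1, h2, h3⟩ := hω
  have hn := h.one_le_pulls h1 a₀ ω
  refine ⟨pulls A t a₀ ω, Finset.mem_Icc.2 ⟨hn, (pulls_le A t a₀ ω).trans h2.le⟩, t, h2.le, rfl, ?_⟩
  have h4 := h3 a₀
  have hn' : (0 : ℝ) < pulls A t a₀ ω := by exact_mod_cast hn
  have hs : 0 < √(pulls A t a₀ ω : ℝ) := Real.sqrt_pos.2 hn'
  have hγ := h.pos
  unfold nlev at h4
  rw [h0, sub_zero, div_le_iff₀ hs] at h4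
  have e : γ * √(pulls A t a₀ ω : ℝ) *
      (1 + armSum ξ A t a₀ ω / (γ * √(pulls A t a₀ ω : ℝ))) =
      γ * √(pulls A t a₀ ω : ℝ) + armSum ξ A t a₀ ω := by field_simp
  have h5 := mul_le_mul_of_nonneg_left h4 (mul_pos hγ hs).le
  rw [e] at h5
  have h6 := Real.mul_self_sqrt hn'.le
  have : γ * √(pulls A t a₀ ω : ℝ) * (-v * √(pulls A t a₀ ω : ℝ)) =
      -(γ * (√(pulls A t a₀ ω : ℝ) * √(pulls A t a₀ ω : ℝ)) * v) := by ring
  rw [this, h6] at h5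
  linarith

/-! ### Exponential sums and expected pull counts on rare events. -/

theorem sum_exp_neg_mul_le {c : ℝ} (hc : 0 < c) (T : ℕ) :
    ∑ n ∈ Finset.Icc 1 T, Real.exp (-(c * n)) ≤ 1 / c := by
  have h : ∑ n ∈ Finset.Icc 1 T, Real.exp (-(c * n)) ≤ (1 - Real.exp (-(c * T))) / c := by
    induction T with
    | zero => simp
    | succ T ih =>
      rw [Finset.sum_Icc_succ_top (by omega)]
      have h1 : Real.exp (-(c * T)) = Real.exp c * Real.exp (-(c * (T + 1 : ℕ))) := by
        rw [← Real.exp_add]; push_cast; ring_nf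
      have h2 := Real.add_one_le_exp c
      have h3 := Real.exp_pos (-(c * (T + 1 : ℕ)))
      rw [le_div_iff₀ hc] at ih ⊢
      nlinarith
  refine h.trans ?_
  gcongr
  linarith [Real.exp_pos (-(c * T))]

theorem sum_inv_sqrt_mul_exp_le {c : ℝ} (hc : 0 < c) (T : ℕ) :
    ∑ n ∈ Finset.Icc 1 T, (√(n : ℝ))⁻¹ * Real.exp (-(c * √(n : ℝ))) ≤ 2 / c := by
  -- The right side is the integral of x^(-1/2) exp(-c√x) over [0, T]; keeping it exact makes the
  -- induction close.
  have h : ∑ n ∈ Finset.Icc 1 T, (√(n : ℝ))⁻¹ * Real.exp (-(c * √(n : ℝ))) ≤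
      2 * (1 - Real.exp (-(c * √(T : ℝ)))) / c := by
    induction T with
    | zero => simp
    | succ T ih =>
      rw [Finset.sum_Icc_succ_top (by omega)]
      set x := √(T : ℝ) with hx
      set y := √((T + 1 : ℕ) : ℝ) with hy
      have hx0 : 0 ≤ x := Real.sqrt_nonneg _
      have hy0 : 0 < y := Real.sqrt_pos.2 (by positivity)
      have hxy : y ^ 2 = x ^ 2 + 1 := by
        rw [hx, hy, Real.sq_sqrt (by positivity), Real.sq_sqrt (by positivity)]; push_cast; ring
      have hle : x ≤ y := by nlinarith
      have h0 : y⁻¹ ≤ 2 * (y - x) := by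
        rw [inv_le_iff_one_le_mul₀ hy0]; nlinarith
      have h1 : Real.exp (-(c * x)) = Real.exp (c * (y - x)) * Real.exp (-(c * y)) := by
        rw [← Real.exp_add]; ring_nf
      have h2 := Real.add_one_le_exp (c * (y - x))
      have h3 := Real.exp_pos (-(c * y))
      rw [le_div_iff₀ hc] at ih ⊢
      have h4 : y⁻¹ * Real.exp (-(c * y)) * c ≤ 2 * (c * (y - x)) * Real.exp (-(c * y)) := by
        have : y⁻¹ * c ≤ 2 * (y - x) * c := by gcongr
        nlinarith
      nlinarith
  refine h.trans ?_
  gcongr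
  linarith [Real.exp_pos (-(c * √(T : ℝ)))]

theorem IsRun.measurable_arm [m : MeasurableSpace Ω] {P : Measure Ω} (h : IsRun P T d γ ξ A)
    {t : ℕ} (ht : t < T) : Measurable (A t) :=
  (h.adapted t ht).mono (hist_le h.noise ht.le) le_rfl

theorem IsRun.measurable_pulls [m : MeasurableSpace Ω] {P : Measure Ω} (h : IsRun P T d γ ξ A)
    {t : ℕ} (ht : t ≤ T) (a : Fin K) : Measurable (pulls A t a) :=
  UCB.measurable_pulls (fun _ hs => h.measurable_arm (hs.trans_le ht)) a

theorem IsRun.measurable_nlev [m : MeasurableSpace Ω] {P : Measure Ω} (h : IsRun P T d γ ξ A)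
    {t : ℕ} (ht : t ≤ T) (a : Fin K) : Measurable (nlev d γ ξ A t a) := by
  have h1 : Measurable (armSum ξ A t a) := measurable_armSum
    (fun _ hs => h.measurable_arm (hs.trans_le ht))
    (fun s hs => h.noise.measurable s (hs.trans_le ht)) a
  have h2 : Measurable fun ω => √(pulls A t a ω : ℝ) :=
    Real.continuous_sqrt.measurable.comp
      ((measurable_of_countable (fun n : ℕ => (n : ℝ))).comp (h.measurable_pulls ht a))
  exact ((measurable_const.add (h1.div (h2.const_mul γ))).div h2).sub_const _

theorem IsRun.measurableSet_reach [m : MeasurableSpace Ω] {P : Measure Ω}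
    (h : IsRun P T d γ ξ A) (u : ℝ) (a : Fin K) (n : ℕ) :
    MeasurableSet (reach T d γ ξ A u a n) := by
  have : reach T d γ ξ A u a n = ⋃ t : ℕ, ⋃ (_ : t < T),
      {ω | pulls A t a ω = n ∧ u ≤ nlev d γ ξ A t a ω} := by
    ext ω; simp only [reach, Set.mem_ofPred_eq, Set.mem_iUnion, exists_prop]
  rw [this]
  refine MeasurableSet.iUnion fun t => MeasurableSet.iUnion fun ht => ?_
  exact ((h.measurable_pulls ht.le a) (measurableSet_singleton n)).inter
    (measurableSet_le measurable_const (h.measurable_nlev ht.le a))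

theorem IsRun.measurableSet_drop [m : MeasurableSpace Ω] {P : Measure Ω}
    (h : IsRun P T d γ ξ A) (u : ℝ) : MeasurableSet (drop T d γ ξ A u) := by
  have : drop T d γ ξ A u = ⋃ t : ℕ, ⋃ (_ : K ≤ t ∧ t < T), ⋂ b,
      {ω | nlev d γ ξ A t b ω ≤ u} := by
    ext ω; simp only [drop, Set.mem_ofPred_eq, Set.mem_iUnion, exists_prop, Set.mem_iInter,
      and_assoc]
  rw [this]
  exact MeasurableSet.iUnion fun t => MeasurableSet.iUnion fun ht => MeasurableSet.iInter fun b =>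
    measurableSet_le (h.measurable_nlev ht.2.le b) measurable_const

/-- Index `u` after n pulls needs noise γ√n((u + d)√n - 1). The hypothesis `hun` says (u + d)√n ≥ 2,
so subtracting 1 loses at most half. -/
theorem IsRun.measure_reach_le [MeasurableSpace Ω] {P : Measure Ω} [IsProbabilityMeasure P]
    (h : IsRun P T d γ ξ A) {u : ℝ} {a : Fin K} {n : ℕ} (hn : 1 ≤ n) (hu : 0 < u + d a)
    (hun : 4 ≤ (u + d a) ^ 2 * n) :
    P.real (reach T d γ ξ A u a n) ≤ Real.exp (-(γ ^ 2 * (u + d a) ^ 2 / 8 * n)) := by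
  have hn' : (0 : ℝ) < n := by exact_mod_cast hn
  have hs : 0 < √(n : ℝ) := Real.sqrt_pos.2 hn'
  have hsq : √(n : ℝ) ^ 2 = n := Real.sq_sqrt hn'.le
  have hγ := h.pos
  have h2 : 2 ≤ (u + d a) * √(n : ℝ) := by
    have : 2 ^ 2 ≤ ((u + d a) * √(n : ℝ)) ^ 2 := by rw [mul_pow, hsq]; linarith
    exact le_of_sq_le_sq this (by positivity)
  set y := γ * √(n : ℝ) * ((u + d a) * √(n : ℝ) - 1) with hy
  have hy0 : 0 ≤ y := by
    have : 0 ≤ (u + d a) * √(n : ℝ) - 1 := by linarith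
    positivity
  have hsub : reach T d γ ξ A u a n ⊆ {ω | ∃ t ≤ T, pulls A t a ω = n ∧ y ≤ armSum ξ A t a ω} := by
    rintro ω ⟨t, ht, h3, h4⟩
    refine ⟨t, ht.le, h3, ?_⟩
    unfold nlev at h4
    rw [h3, le_sub_iff_add_le, le_div_iff₀ hs] at h4
    have h5 : (u + d a) * √(n : ℝ) - 1 ≤ armSum ξ A t a ω / (γ * √(n : ℝ)) := by linarith
    rw [le_div_iff₀ (mul_pos hγ hs)] at h5
    rw [hy]; linarith
  refine (measureReal_mono hsub).trans ((measure_armSum_ge_le h.noise h.adapted hn hy0 a).trans ?_)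
  refine Real.exp_le_exp.2 (neg_le_neg ?_)
  have e : y ^ 2 / (2 * n) = γ ^ 2 * ((u + d a) * √(n : ℝ) - 1) ^ 2 / 2 := by
    rw [hy, mul_pow, mul_pow, hsq]; field_simp
  rw [e]
  have h6 : ((u + d a) * √(n : ℝ) / 2) ^ 2 ≤ ((u + d a) * √(n : ℝ) - 1) ^ 2 := by
    gcongr; linarith
  have h7 : ((u + d a) * √(n : ℝ) / 2) ^ 2 = (u + d a) ^ 2 * n / 4 := by
    rw [div_pow, mul_pow, hsq]; norm_num
  rw [h7] at h6
  nlinarith [mul_le_mul_of_nonneg_left h6 (sq_nonneg γ)]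

/-- Counts n ≤ 4 xc contribute at most 1 each and the rest decay exponentially, with total at most
xc since γ ≥ 4. Square roots appear because these events will be intersected with another rare
event. -/
theorem IsRun.sum_sqrt_measure_reach_le [MeasurableSpace Ω] {P : Measure Ω}
    [IsProbabilityMeasure P] (h : IsRun P T d γ ξ A) (hγ4 : 4 ≤ γ) {u : ℝ} {a : Fin K}
    (hu : 0 < u + d a) :
    ∑ n ∈ Finset.Icc 1 T, √(P.real (reach T d γ ξ A u a n)) ≤ 5 * xc d u a := by
  classical
  set b := (u + d a) ^ 2 with hb
  have hb0 : 0 < b := by positivity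
  have hγ := h.pos
  set c := γ ^ 2 * b / 16 with hc
  have hc0 : 0 < c := by positivity
  have h1 : ∀ n ∈ Finset.Icc 1 T, √(P.real (reach T d γ ξ A u a n)) ≤
      (if n ∈ Finset.Icc 1 ⌊4 * b⁻¹⌋₊ then 1 else 0) + Real.exp (-(c * n)) := by
    intro n hn
    have hn1 := (Finset.mem_Icc.1 hn).1
    by_cases hc4 : n ∈ Finset.Icc 1 ⌊4 * b⁻¹⌋₊
    · rw [if_pos hc4]
      have : √(P.real (reach T d γ ξ A u a n)) ≤ 1 := by
        rw [Real.sqrt_le_one]; exact measureReal_le_one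
      linarith [Real.exp_pos (-(c * n))]
    · rw [if_neg hc4, zero_add]
      have h2 : 4 * b⁻¹ < n := by
        by_contra hcon
        exact hc4 (Finset.mem_Icc.2 ⟨hn1, Nat.le_floor (not_lt.1 hcon)⟩)
      rw [← div_eq_mul_inv, div_lt_iff₀ hb0] at h2
      have h3 := h.measure_reach_le (P := P) hn1 hu (by rw [← hb]; linarith)
      rw [Real.sqrt_le_left (Real.exp_pos _).le, ← Real.exp_nat_mul]
      refine h3.trans (Real.exp_le_exp.2 (le_of_eq ?_))
      rw [hc, hb]; push_cast; ring
  refine (Finset.sum_le_sum h1).trans ?_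
  rw [Finset.sum_add_distrib]
  have h2 := sum_exp_neg_mul_le hc0 T
  have h3 : 1 / c ≤ b⁻¹ := by
    rw [hc, div_le_iff₀ (by positivity), inv_mul_eq_div, le_div_iff₀ hb0]
    have : 16 ≤ γ ^ 2 := by nlinarith
    nlinarith
  have h4 : ∑ n ∈ Finset.Icc 1 T, (if n ∈ Finset.Icc 1 ⌊4 * b⁻¹⌋₊ then (1 : ℝ) else 0) ≤
      4 * b⁻¹ := by
    rw [← Finset.sum_filter, Finset.sum_const, nsmul_eq_mul, mul_one]
    refine le_trans ?_ (Nat.floor_le (by positivity))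
    have : ((Finset.Icc 1 T).filter (fun n => n ∈ Finset.Icc 1 ⌊4 * b⁻¹⌋₊)).card ≤
        (Finset.Icc 1 ⌊4 * b⁻¹⌋₊).card :=
      Finset.card_le_card fun n hn => (Finset.mem_filter.1 hn).2
    simpa using this
  have h5 : xc d u a = b⁻¹ := rfl
  rw [h5]
  linarith

theorem integrable_ind [MeasurableSpace Ω] {P : Measure Ω} [IsProbabilityMeasure P] {D : Set Ω}
    (hD : MeasurableSet D) : Integrable (fun ω => D.indicator (fun _ => (1 : ℝ)) ω) P :=
  (integrable_const 1).indicator hD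

theorem integral_ind [MeasurableSpace Ω] {P : Measure Ω} {D : Set Ω}
    (hD : MeasurableSet D) : ∫ ω, D.indicator (fun _ => (1 : ℝ)) ω ∂P = P.real D := by
  rw [integral_indicator hD]; simp

theorem ind_mul_reachCount (D : Set Ω) (u : ℝ) (a : Fin K) (ω : Ω) :
    D.indicator (fun _ => (1 : ℝ)) ω * reachCount T d γ ξ A u a ω =
      D.indicator (fun _ => (1 : ℝ)) ω + ∑ n ∈ Finset.Icc 1 T,
        (reach T d γ ξ A u a n ∩ D).indicator (fun _ => (1 : ℝ)) ω := by
  unfold reachCount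
  rw [mul_add, mul_one, Finset.mul_sum]
  congr 1
  refine Finset.sum_congr rfl fun n _ => ?_
  by_cases h1 : ω ∈ D <;> by_cases h2 : ω ∈ reach T d γ ξ A u a n <;> simp [h1, h2]

theorem IsRun.integrable_ind_mul_reachCount [MeasurableSpace Ω] {P : Measure Ω}
    [IsProbabilityMeasure P] (h : IsRun P T d γ ξ A) {D : Set Ω} (hD : MeasurableSet D) (u : ℝ)
    (a : Fin K) : Integrable
      (fun ω => D.indicator (fun _ => (1 : ℝ)) ω * reachCount T d γ ξ A u a ω) P := by
  simp_rw [ind_mul_reachCount]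
  exact (integrable_ind hD).add (integrable_finsetSum _ fun n _ =>
    integrable_ind ((h.measurableSet_reach u a n).inter hD))

/-- No independence is needed: P(R ∩ D) ≤ √(P(R) P(D)) extracts √P(D) from each term. The condition
u + d ≤ 1 makes xc ≥ 1, which absorbs the initial pull. -/
theorem IsRun.integral_ind_mul_reachCount_le [MeasurableSpace Ω] {P : Measure Ω}
    [IsProbabilityMeasure P] (h : IsRun P T d γ ξ A) (hγ4 : 4 ≤ γ) {D : Set Ω}
    (hD : MeasurableSet D) {u : ℝ} {a : Fin K} (hu : 0 < u + d a) (hu1 : u + d a ≤ 1) :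
    ∫ ω, D.indicator (fun _ => (1 : ℝ)) ω * reachCount T d γ ξ A u a ω ∂P ≤
      6 * √(P.real D) * xc d u a := by
  simp_rw [ind_mul_reachCount]
  have hi : ∀ n ∈ Finset.Icc 1 T, Integrable (fun ω => (reach T d γ ξ A u a n ∩ D).indicator
      (fun _ => (1 : ℝ)) ω) P := fun n _ =>
    integrable_ind ((h.measurableSet_reach u a n).inter hD)
  rw [integral_add (integrable_ind hD) (integrable_finsetSum _ hi), integral_ind hD,
    integral_finsetSum _ hi]
  have hx1 : 1 ≤ xc d u a := by
    unfold xc; rw [one_le_inv₀ (by positivity)]; nlinarith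
  have hP1 : P.real D ≤ 1 := measureReal_le_one
  have hP0 : 0 ≤ P.real D := measureReal_nonneg
  have hs0 := Real.sqrt_nonneg (P.real D)
  have hsP : P.real D ≤ √(P.real D) := by
    refine Real.le_sqrt_of_sq_le ?_; nlinarith
  have h1 : ∑ n ∈ Finset.Icc 1 T, ∫ ω, (reach T d γ ξ A u a n ∩ D).indicator
      (fun _ => (1 : ℝ)) ω ∂P ≤ √(P.real D) * (5 * xc d u a) := by
    refine le_trans ?_ (mul_le_mul_of_nonneg_left
      (h.sum_sqrt_measure_reach_le (P := P) hγ4 hu) hs0)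
    rw [Finset.mul_sum]
    refine Finset.sum_le_sum fun n _ => ?_
    rw [integral_ind ((h.measurableSet_reach u a n).inter hD), ← Real.sqrt_mul hP0]
    refine Real.le_sqrt_of_sq_le ?_
    have h2 : P.real (reach T d γ ξ A u a n ∩ D) ≤ P.real D := measureReal_mono Set.inter_subset_right
    have h3 : P.real (reach T d γ ξ A u a n ∩ D) ≤ P.real (reach T d γ ξ A u a n) :=
      measureReal_mono Set.inter_subset_left
    have h4 : 0 ≤ P.real (reach T d γ ξ A u a n ∩ D) := measureReal_nonneg
    rw [sq]
    exact mul_le_mul h2 h3 h4 hP0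
  nlinarith

/-! ### Probability of a low level and deep drops of the best arm. -/

/-- The Chernoff bound is used with weights xc/G(u) and r = u² G(u); r times a weight is u² xc ≤ 1
because gaps are nonnegative. -/
theorem IsRun.measure_drop_le [MeasurableSpace Ω] {P : Measure Ω} [IsProbabilityMeasure P]
    (h : IsRun P T d γ ξ A) {s : ℝ} (hs : 0 ≤ s) (hb : badBound T (1 / 4 * γ) ≤ Real.exp (-s))
    {u : ℝ} (hu : 0 < u) (hG : 4 * (T : ℝ) ≤ totalPulls d u) :
    P.real (drop T d γ ξ A u) ≤ Real.exp (u ^ 2 * totalPulls d u * (1 - s / 2)) := by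
  have hT : (0 : ℝ) < T := by exact_mod_cast lt_of_le_of_lt (Nat.zero_le _) h.lt
  have hG0 : 0 < totalPulls d u := by linarith
  have hγ := h.pos
  refine le_trans (measureReal_mono fun ω hω => h.half_le_of_mem_drop hu hG hω)
    (measure_half_le_sum_bad h.noise h.adapted (by positivity) hs hb (by positivity)
      (fun a => xc d u a / totalPulls d u) (fun a => div_nonneg (xc_nonneg d u a) hG0.le) ?_ ?_)
  · intro a
    have hda := h.nonneg a
    have e : u ^ 2 * totalPulls d u * (xc d u a / totalPulls d u) = u ^ 2 * xc d u a := by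
      field_simp
    rw [e, xc, ← div_eq_mul_inv, div_le_one (by positivity)]
    gcongr; linarith
  · rw [← Finset.sum_div, ← totalPulls, div_self hG0.ne']

theorem armSum_eq_of_pulls_eq {a : Fin K} {ω : Ω} {s t : ℕ} (hst : s ≤ t)
    (hp : pulls A s a ω = pulls A t a ω) : armSum ξ A s a ω = armSum ξ A t a ω := by
  unfold armSum
  have hsub : (Finset.range s).filter (fun r => A r ω = a) ⊆
      (Finset.range t).filter (fun r => A r ω = a) :=
    Finset.filter_subset_filter _ (Finset.range_subset_range.2 hst)
  rw [Finset.eq_of_subset_of_card_le hsub hp.symm.le]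

/-- The exponential martingale of the noise of arm `a` stopped after `n` pulls, with the load
`- (1 + 1 / γ ^ 2) γ / √n`. -/
def tailExp (ξ : ℕ → Ω → ℝ) (A : ℕ → Ω → Fin K) (T : ℕ) (γ : ℝ) (a : Fin K) (n : ℕ) (ω : Ω) : ℝ :=
  Real.exp (stopLog ξ A T a (-((1 + 1 / γ ^ 2) * (γ / √(n : ℝ)))) (fun t ω => pulls A t a ω = n) ω)

theorem IsRun.measurableSet_pulls_eq [MeasurableSpace Ω] {P : Measure Ω} (h : IsRun P T d γ ξ A)
    (a : Fin K) (n : ℕ) : ∀ t < T, MeasurableSet[hist ξ t] {ω | pulls A t a ω = n} := fun _ ht =>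
  UCB.measurable_pulls
    (fun s hs => (h.adapted s (hs.trans ht)).mono (hist_mono ξ hs.le) le_rfl) a
    (measurableSet_singleton n)

theorem IsRun.integral_tailExp [MeasurableSpace Ω] {P : Measure Ω} [IsProbabilityMeasure P]
    (h : IsRun P T d γ ξ A) (a : Fin K) (n : ℕ) :
    Integrable (tailExp ξ A T γ a n) P ∧ ∫ ω, tailExp ξ A T γ a n ω ∂P = 1 := by
  have hm : Measurable (tailExp ξ A T γ a n) := Real.measurable_exp.comp
    (measurable_stopLog h.noise h.adapted a _ (h.measurableSet_pulls_eq a n))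
  have hl : ∫⁻ ω, ENNReal.ofReal (tailExp ξ A T γ a n ω) ∂P = 1 :=
    lintegral_stopExp h.noise h.adapted a _ (h.measurableSet_pulls_eq a n)
  have h0 : 0 ≤ᵐ[P] tailExp ξ A T γ a n := Filter.Eventually.of_forall fun ω => (Real.exp_pos _).le
  refine ⟨⟨hm.aestronglyMeasurable, ?_⟩, ?_⟩
  · rw [hasFiniteIntegral_iff_ofReal h0, hl]; exact ENNReal.one_lt_top
  · rw [integral_eq_lintegral_of_nonneg_ae h0 hm.aestronglyMeasurable, hl]; simp

/-- The largest gap `v` for which the index of the best arm drops below `-v / 2` is controlled by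
the exponential martingales `tailExp`. -/
theorem IsRun.gap_le_of_mem_drop_neg [MeasurableSpace Ω] {P : Measure Ω}
    (h : IsRun P T d γ ξ A) (hγ1 : 1 ≤ γ) {a₀ : Fin K} (h0 : d a₀ = 0) {v D : ℝ} (hD : 0 < D)
    (hv : D ≤ v) (η : ℝ) {ω : Ω} (hω : ω ∈ drop T d γ ξ A (-(v / 2))) :
    v ≤ ∑ n ∈ Finset.Icc 1 T, 4 / γ ^ 2 * ((√(n : ℝ))⁻¹ * Real.exp (-(γ ^ 2 * D / 4 * √(n : ℝ)))) *
      Real.exp (-γ ^ 2 / 2) * (3 * Real.exp (-η) * tailExp ξ A T γ a₀ n ω +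
        Real.exp (η * γ ^ 2)) := by
  obtain ⟨n, hn, t, ht, hp, hS⟩ := h.exists_of_mem_drop_neg h0 hω
  have hpos : ∀ m : ℕ, 0 ≤ 4 / γ ^ 2 * ((√(m : ℝ))⁻¹ * Real.exp (-(γ ^ 2 * D / 4 * √(m : ℝ)))) *
      Real.exp (-γ ^ 2 / 2) * (3 * Real.exp (-η) * tailExp ξ A T γ a₀ m ω +
        Real.exp (η * γ ^ 2)) := fun m => by
    have : 0 < tailExp ξ A T γ a₀ m ω := Real.exp_pos _
    positivity
  refine le_trans ?_ (Finset.single_le_sum (f := fun m : ℕ => 4 / γ ^ 2 * ((√(m : ℝ))⁻¹ *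
    Real.exp (-(γ ^ 2 * D / 4 * √(m : ℝ)))) * Real.exp (-γ ^ 2 / 2) *
      (3 * Real.exp (-η) * tailExp ξ A T γ a₀ m ω + Real.exp (η * γ ^ 2)))
    (fun m _ => hpos m) hn)
  have hn1 := (Finset.mem_Icc.1 hn).1
  have hn' : (0 : ℝ) < n := by exact_mod_cast hn1
  have hs : 0 < √(n : ℝ) := Real.sqrt_pos.2 hn'
  have hsq : √(n : ℝ) ^ 2 = n := Real.sq_sqrt hn'.le
  have hγ := h.pos
  have hγ2 : 0 < γ ^ 2 := by positivity
  have hv0 : 0 < v := hD.trans_le hv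
  set S := armSum ξ A t a₀ ω with hSdef
  -- The log-likelihood ratio for the load -γ/√n, which is tuned to a noise sum -γ√n.
  set m := γ / √(n : ℝ) * (-S) - γ ^ 2 / 2 with hm
  -- the exponential martingale dominates
  have hE : Real.exp ((1 + 1 / γ ^ 2) * m - 1) ≤ tailExp ξ A T γ a₀ n ω := by
    refine Real.exp_le_exp.2 (le_stopLog (Cr := fun t ω => pulls A t a₀ ω = n) ?_ ⟨t, ht, hp⟩)
    intro s _ hps
    have hps' : pulls A s a₀ ω = n := hps
    have hSs : armSum ξ A s a₀ ω = S := by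
      rcases le_total s t with hst | hst
      · exact armSum_eq_of_pulls_eq hst (hps'.trans hp.symm)
      · exact (armSum_eq_of_pulls_eq hst (hp.trans hps'.symm)).symm
    rw [hSs, hps']
    -- The load is raised by the factor 1 + γ⁻². This costs only a bounded constant but adds m/γ² to
    -- the exponent.
    have e : -((1 + 1 / γ ^ 2) * (γ / √(n : ℝ))) * S -
        (-((1 + 1 / γ ^ 2) * (γ / √(n : ℝ)))) ^ 2 / 2 * n =
        (1 + 1 / γ ^ 2) * m - (1 + 1 / γ ^ 2) / 2 := by
      have e1 : (-((1 + 1 / γ ^ 2) * (γ / √(n : ℝ)))) ^ 2 / 2 * n =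
          (1 + 1 / γ ^ 2) ^ 2 * γ ^ 2 / 2 := by
        rw [neg_sq, mul_pow, div_pow, hsq]; field_simp
      have e2 : (1 + 1 / γ ^ 2) ^ 2 * γ ^ 2 = (1 + 1 / γ ^ 2) * (γ ^ 2 + 1) := by field_simp
      rw [e1, e2, hm]; ring
    rw [e]
    have : 1 / γ ^ 2 ≤ 1 := by rw [div_le_one hγ2]; nlinarith
    linarith
  -- For m ≥ ηγ² the surplus m/γ² ≥ η gives the factor e^(-η). For smaller m the trivial bound is
  -- kept, to be paired later with the small probability of a drop.
  have hM : Real.exp m ≤ 3 * Real.exp (-η) * tailExp ξ A T γ a₀ n ω + Real.exp (η * γ ^ 2) := by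
    rcases le_total m (η * γ ^ 2) with hc | hc
    · have h1 := Real.exp_le_exp.2 hc
      have : 0 ≤ 3 * Real.exp (-η) * tailExp ξ A T γ a₀ n ω := by
        have : 0 < tailExp ξ A T γ a₀ n ω := Real.exp_pos _
        positivity
      linarith
    · have h1 : η ≤ m / γ ^ 2 := by rw [le_div_iff₀ hγ2]; exact hc
      have h2 : Real.exp m ≤ Real.exp 1 * Real.exp (-η) * Real.exp ((1 + 1 / γ ^ 2) * m - 1) := by
        rw [← Real.exp_add, ← Real.exp_add]
        refine Real.exp_le_exp.2 ?_
        have : (1 + 1 / γ ^ 2) * m = m + m / γ ^ 2 := by ring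
        rw [this]; linarith
      have h3 : Real.exp 1 ≤ 3 := by linarith [Real.exp_one_lt_d9]
      have h4 : Real.exp 1 * Real.exp (-η) * Real.exp ((1 + 1 / γ ^ 2) * m - 1) ≤
          3 * Real.exp (-η) * tailExp ξ A T γ a₀ n ω := by gcongr
      linarith [Real.exp_pos (η * γ ^ 2)]
  have hmge : γ ^ 2 / 2 + γ ^ 2 * √(n : ℝ) * v / 2 ≤ m := by
    have h1 := mul_le_mul_of_nonneg_left hS (div_pos hγ hs).le
    have e : γ / √(n : ℝ) * (γ * √(n : ℝ) + γ * n * (v / 2)) =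
        γ ^ 2 + γ ^ 2 * √(n : ℝ) * v / 2 := by
      rw [← hsq, Real.sqrt_sq hs.le]; field_simp
    rw [e] at h1
    rw [hm]; linarith
  -- The bound x ≤ e^x trades the gap for half of the excess γ²√n v/2 in m. The other half, with v ≥
  -- D, will make the sum over n converge.
  have hv1 : v ≤ 4 / γ ^ 2 * (√(n : ℝ))⁻¹ * Real.exp (γ ^ 2 * √(n : ℝ) * v / 4) := by
    have h1 := Real.add_one_le_exp (γ ^ 2 * √(n : ℝ) * v / 4)
    have e : v = 4 / γ ^ 2 * (√(n : ℝ))⁻¹ * (γ ^ 2 * √(n : ℝ) * v / 4) := by field_simp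
    calc v = 4 / γ ^ 2 * (√(n : ℝ))⁻¹ * (γ ^ 2 * √(n : ℝ) * v / 4) := e
      _ ≤ _ := by gcongr; linarith
  calc v ≤ 4 / γ ^ 2 * (√(n : ℝ))⁻¹ * Real.exp (γ ^ 2 * √(n : ℝ) * v / 4) := hv1
    _ ≤ 4 / γ ^ 2 * (√(n : ℝ))⁻¹ * (Real.exp (-(γ ^ 2 * D / 4 * √(n : ℝ))) *
        Real.exp (-γ ^ 2 / 2) * Real.exp m) := by
        rw [← Real.exp_add, ← Real.exp_add]
        gcongr
        have : γ ^ 2 * √(n : ℝ) * D ≤ γ ^ 2 * √(n : ℝ) * v := by gcongr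
        linarith
    _ ≤ 4 / γ ^ 2 * (√(n : ℝ))⁻¹ * (Real.exp (-(γ ^ 2 * D / 4 * √(n : ℝ))) *
        Real.exp (-γ ^ 2 / 2) *
          (3 * Real.exp (-η) * tailExp ξ A T γ a₀ n ω + Real.exp (η * γ ^ 2))) := by gcongr
    _ = _ := by ring

/-! ### Expectation estimates and the lower bound. -/

theorem totalPulls_anti {d : Fin K → ℝ} (hd : ∀ a, 0 ≤ d a) {u w : ℝ} (hu : 0 < u) (huw : u ≤ w) :
    totalPulls d w ≤ totalPulls d u :=
  Finset.sum_le_sum fun a _ => xc_anti (by have := hd a; positivity) huw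

theorem xc_half_le {d : Fin K → ℝ} (hd : ∀ a, 0 ≤ d a) {u : ℝ} (hu : 0 < u) (a : Fin K) :
    xc d (u / 2) a ≤ 4 * xc d u a := by
  have hda := hd a
  unfold xc
  rw [← div_eq_mul_inv, inv_eq_one_div, div_le_div_iff₀ (by positivity) (by positivity)]
  nlinarith

theorem IsRun.T_pos [MeasurableSpace Ω] {P : Measure Ω} (h : IsRun P T d γ ξ A) : (0 : ℝ) < T := by
  exact_mod_cast lt_of_le_of_lt (Nat.zero_le _) h.lt

theorem IsRun.totalRegret_le [MeasurableSpace Ω] {P : Measure Ω} (h : IsRun P T d γ ξ A)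
    {u us : ℝ} (hu : 0 < u) (hus : u ≤ us) (hG : totalPulls d us = T) :
    totalRegret d u ≤ totalRegret d us * totalPulls d u / T := by
  rw [le_div_iff₀ h.T_pos, ← hG]
  exact totalRegret_mul_le h.nonneg hu hus

theorem IsRun.measure_drop_le_exp [MeasurableSpace Ω] {P : Measure Ω} [IsProbabilityMeasure P]
    (h : IsRun P T d γ ξ A) (hγ20 : 20 ≤ γ)
    (hb : badBound T (1 / 4 * γ) ≤ Real.exp (-(γ ^ 2 / 100))) {u : ℝ} (hu : 0 < u)
    (hG : 4 * (T : ℝ) ≤ totalPulls d u) :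
    P.real (drop T d γ ξ A u) ≤ Real.exp (-(u ^ 2 * totalPulls d u * γ ^ 2 / 400)) := by
  refine (h.measure_drop_le (by positivity) hb hu hG).trans (Real.exp_le_exp.2 ?_)
  have h1 : 0 ≤ u ^ 2 * totalPulls d u := mul_nonneg (sq_nonneg _) (totalPulls_nonneg d u)
  have h2 : 0 ≤ γ ^ 2 - 400 := by nlinarith
  nlinarith [mul_nonneg h1 h2]

/-- With x = u² G(u) γ²/800, the estimate e^(-x) ≤ 1/x cancels the factor G(u) in F(u) ≤ F(us)
G(u)/T, leaving a bound that decays like u⁻². -/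
theorem IsRun.sqrt_measure_drop_mul_le [MeasurableSpace Ω] {P : Measure Ω}
    [IsProbabilityMeasure P] (h : IsRun P T d γ ξ A) (hγ20 : 20 ≤ γ)
    (hb : badBound T (1 / 4 * γ) ≤ Real.exp (-(γ ^ 2 / 100))) {u us : ℝ} (hu : 0 < u)
    (hG : 4 * (T : ℝ) ≤ totalPulls d u) (hus : u ≤ us) (hGs : totalPulls d us = T) :
    √(P.real (drop T d γ ξ A u)) * totalRegret d u ≤
      800 / (γ ^ 2 * (u ^ 2 * T)) * totalRegret d us := by
  have hT := h.T_pos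
  have hγ := h.pos
  have hG0 : 0 < totalPulls d u := by linarith
  have hF := totalRegret_nonneg h.nonneg us
  set x := u ^ 2 * totalPulls d u * γ ^ 2 / 800 with hx
  have hx0 : 0 < x := by positivity
  have h1 : √(P.real (drop T d γ ξ A u)) ≤ 1 / x := by
    have h2 : √(P.real (drop T d γ ξ A u)) ≤ Real.exp (-x) := by
      rw [Real.sqrt_le_left (Real.exp_pos _).le, ← Real.exp_nat_mul]
      refine (h.measure_drop_le_exp hγ20 hb hu hG).trans (Real.exp_le_exp.2 (le_of_eq ?_))
      rw [hx]; push_cast; ring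
    refine h2.trans ?_
    rw [Real.exp_neg, ← one_div]
    exact one_div_le_one_div_of_le hx0 (by linarith [Real.add_one_le_exp x])
  calc √(P.real (drop T d γ ξ A u)) * totalRegret d u
      ≤ 1 / x * (totalRegret d us * totalPulls d u / T) :=
        mul_le_mul h1 (h.totalRegret_le hu hus hGs) (totalRegret_nonneg h.nonneg u) (by positivity)
    _ = _ := by rw [hx]; field_simp

theorem integrable_badInd [MeasurableSpace Ω] {P : Measure Ω} [IsProbabilityMeasure P]
    (h : IsRun P T d γ ξ A) (x : ℝ) (a : Fin K) :
    Integrable (fun ω => badInd ξ A T x a ω) P :=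
  integrable_ind (measurableSet_bad h.noise h.adapted x a)

theorem IsRun.integral_badInd_mul_reachCount_le [MeasurableSpace Ω] {P : Measure Ω}
    [IsProbabilityMeasure P] (h : IsRun P T d γ ξ A) (hγ4 : 4 ≤ γ) {x : ℝ} (hx : 0 ≤ x)
    (hp : badBound T x ≤ 1 / γ ^ 2) {u : ℝ} {a : Fin K} (hu : 0 < u + d a)
    (hu1 : u + d a ≤ 1) :
    ∫ ω, badInd ξ A T x a ω * reachCount T d γ ξ A u a ω ∂P ≤ 6 / γ * xc d u a := by
  have hm := measurableSet_bad h.noise h.adapted x a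
  have hγ := h.pos
  refine (h.integral_ind_mul_reachCount_le hγ4 hm hu hu1).trans ?_
  refine mul_le_mul_of_nonneg_right ?_ (xc_nonneg d u a)
  have : √(P.real (bad ξ A T x a)) ≤ 1 / γ := by
    rw [Real.sqrt_le_left (by positivity), div_pow, one_pow]
    exact (measure_bad_le h.noise h.adapted hx a).trans hp
  calc 6 * √(P.real (bad ξ A T x a)) ≤ 6 * (1 / γ) := by gcongr
    _ = _ := by ring

theorem IsRun.integral_badInd_le [MeasurableSpace Ω] {P : Measure Ω}
    [IsProbabilityMeasure P] (h : IsRun P T d γ ξ A) {x : ℝ} (hx : 0 ≤ x)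
    (hp : badBound T x ≤ 1 / γ ^ 2) (a : Fin K) :
    ∫ ω, badInd ξ A T x a ω ∂P ≤ 1 / γ ^ 2 := by
  have hm := measurableSet_bad h.noise h.adapted x a
  refine (integral_ind (P := P) hm).le.trans ?_
  exact (measure_bad_le h.noise h.adapted hx a).trans hp

theorem IsRun.integrable_pulls [MeasurableSpace Ω] {P : Measure Ω} [IsProbabilityMeasure P]
    (h : IsRun P T d γ ξ A) (a : Fin K) : Integrable (fun ω => (pulls A T a ω : ℝ)) P := by
  refine Integrable.of_bound (C := T) ?_ ?_
  · exact ((measurable_of_countable (fun n : ℕ => (n : ℝ))).comp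
      (h.measurable_pulls le_rfl a)).aestronglyMeasurable
  · refine Filter.Eventually.of_forall fun ω => ?_
    rw [Real.norm_of_nonneg (Nat.cast_nonneg _)]
    exact_mod_cast pulls_le A T a ω

theorem IsRun.integrable_regret [MeasurableSpace Ω] {P : Measure Ω} [IsProbabilityMeasure P]
    (h : IsRun P T d γ ξ A) : Integrable (fun ω => ∑ a, d a * (pulls A T a ω : ℝ)) P :=
  integrable_finsetSum _ fun a _ => (h.integrable_pulls a).const_mul (d a)

/-- The lower bound for the expected normalized regret. -/
theorem IsRun.le_integral_regret [MeasurableSpace Ω] {P : Measure Ω} [IsProbabilityMeasure P]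
    (h : IsRun P T d γ ξ A) (hγ4 : 4 ≤ γ) {ε : ℝ} (hε : 0 ≤ ε) (hε1 : ε < 1)
    (hp : badBound T (ε * γ) ≤ 1 / γ ^ 2) {us : ℝ} (hus : 0 < us)
    (hG : totalPulls d us = T) (hd1 : ∀ a, us + d a ≤ 1) :
    totalRegret d us * ((1 - ε) ^ 2 * (((1 + ε) ^ 2)⁻¹ * (1 - K / T - 6 / γ) - 1 / γ ^ 2)) ≤
      ∫ ω, ∑ a, d a * (pulls A T a ω : ℝ) ∂P := by
  have hT := h.T_pos
  have hγ := h.pos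
  have hF := totalRegret_nonneg h.nonneg us
  have hx : 0 ≤ ε * γ := by positivity
  have hi1 : ∀ b ∈ Finset.univ, Integrable
      (fun ω => badInd ξ A T (ε * γ) b ω * reachCount T d γ ξ A us b ω) P := fun b _ =>
    h.integrable_ind_mul_reachCount (measurableSet_bad h.noise h.adapted _ b) us b
  have hi2 : ∀ a ∈ Finset.univ, Integrable
      (fun ω => d a * (badInd ξ A T (ε * γ) a ω * xc d us a)) P := fun a _ =>
    ((integrable_badInd h _ a).mul_const _).const_mul _
  have hi3 : Integrable (fun ω => 1 - (K : ℝ) / T -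
      (∑ b, badInd ξ A T (ε * γ) b ω * reachCount T d γ ξ A us b ω) / T) P :=
    (integrable_const _).sub ((integrable_finsetSum _ hi1).div_const _)
  have hmono := integral_mono (μ := P) (f := fun ω => (1 - ε) ^ 2 * (totalRegret d us *
      (((1 + ε) ^ 2)⁻¹ * (1 - K / T -
        (∑ b, badInd ξ A T (ε * γ) b ω * reachCount T d γ ξ A us b ω) / T)) -
        ∑ a, d a * (badInd ξ A T (ε * γ) a ω * xc d us a))) (by
      exact (((hi3.const_mul _).const_mul _).sub (integrable_finsetSum _ hi2)).const_mul _)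
    h.integrable_regret
    (h.le_regret hε hε1 hus hG)
  refine le_trans ?_ hmono
  rw [integral_const_mul, integral_sub ((hi3.const_mul _).const_mul _)
    (integrable_finsetSum _ hi2), integral_const_mul, integral_const_mul,
    integral_sub (integrable_const _) ((integrable_finsetSum _ hi1).div_const _),
    integral_div, integral_finsetSum _ hi1, integral_finsetSum _ hi2]
  simp only [integral_const, probReal_univ, smul_eq_mul, one_mul]
  have h1 : (∑ b, ∫ ω, badInd ξ A T (ε * γ) b ω * reachCount T d γ ξ A us b ω ∂P) / T ≤ 6 / γ := by
    rw [div_le_iff₀ hT, ← hG, totalPulls, Finset.mul_sum]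
    refine Finset.sum_le_sum fun b _ => ?_
    have hdb := h.nonneg b
    exact h.integral_badInd_mul_reachCount_le hγ4 hx hp (by positivity) (hd1 b)
  have h2 : ∑ a, ∫ ω, d a * (badInd ξ A T (ε * γ) a ω * xc d us a) ∂P ≤
      1 / γ ^ 2 * totalRegret d us := by
    unfold totalRegret
    rw [Finset.mul_sum]
    refine Finset.sum_le_sum fun a _ => ?_
    rw [integral_const_mul, integral_mul_const]
    have h3 := h.integral_badInd_le hx hp a
    have h4 : 0 ≤ d a * xc d us a := mul_nonneg (h.nonneg a) (xc_nonneg d us a)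
    nlinarith
  have h3 : 0 ≤ (1 - ε) ^ 2 := sq_nonneg _
  have h4 : 0 ≤ ((1 + ε) ^ 2)⁻¹ := by positivity
  set X := (∑ b, ∫ ω, badInd ξ A T (ε * γ) b ω * reachCount T d γ ξ A us b ω ∂P) / T
  set Y := ∑ a, ∫ ω, d a * (badInd ξ A T (ε * γ) a ω * xc d us a) ∂P
  have h5 : ((1 + ε) ^ 2)⁻¹ * (1 - K / T - 6 / γ) ≤ ((1 + ε) ^ 2)⁻¹ * (1 - K / T - X) := by
    gcongr
  calc _ = (1 - ε) ^ 2 * (totalRegret d us * (((1 + ε) ^ 2)⁻¹ * (1 - K / T - 6 / γ)) -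
        1 / γ ^ 2 * totalRegret d us) := by ring
    _ ≤ _ := by gcongr

/-! ### Upper bounds by range of the level. -/

/-- The contribution to the regret of the event that the level stays above `w`. -/
theorem IsRun.integral_main_le [MeasurableSpace Ω] {P : Measure Ω} [IsProbabilityMeasure P]
    (h : IsRun P T d γ ξ A) (hγ4 : 4 ≤ γ) {ε : ℝ} (hε : 0 ≤ ε)
    (hp : badBound T (ε * γ) ≤ 1 / γ ^ 2) {us w : ℝ} (hw : 0 < w) (hwus : w ≤ us)
    (hG : totalPulls d us = T) (hGw : totalPulls d w ≤ 16 * T) (hd1 : ∀ a, us + d a ≤ 1)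
    {κ : ℝ} (hκ : ∀ a, (us + d a) ^ 2 ≤ κ) :
    Integrable (fun ω => (1 + ε) ^ 2 * (totalRegret d us * (((1 - ε) ^ 2)⁻¹ +
        (∑ b, badInd ξ A T (ε * γ) b ω * xc d w b) / T)) + ∑ a, d a +
        ∑ a, d a * (badInd ξ A T (ε * γ) a ω * reachCount T d γ ξ A w a ω)) P ∧
    ∫ ω, ((1 + ε) ^ 2 * (totalRegret d us * (((1 - ε) ^ 2)⁻¹ +
        (∑ b, badInd ξ A T (ε * γ) b ω * xc d w b) / T)) + ∑ a, d a +
        ∑ a, d a * (badInd ξ A T (ε * γ) a ω * reachCount T d γ ξ A w a ω)) ∂P ≤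
      totalRegret d us * ((1 + ε) ^ 2 * (((1 - ε) ^ 2)⁻¹ + 16 / γ ^ 2) + κ + 96 / γ) := by
  have hT := h.T_pos
  have hγ := h.pos
  have hF := totalRegret_nonneg h.nonneg us
  have hx : 0 ≤ ε * γ := by positivity
  have hi1 : ∀ b ∈ Finset.univ, Integrable (fun ω => badInd ξ A T (ε * γ) b ω * xc d w b) P :=
    fun b _ => (integrable_badInd h _ b).mul_const _
  have hi2 : ∀ a ∈ Finset.univ, Integrable
      (fun ω => d a * (badInd ξ A T (ε * γ) a ω * reachCount T d γ ξ A w a ω)) P := fun a _ =>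
    (h.integrable_ind_mul_reachCount (measurableSet_bad h.noise h.adapted _ a) w a).const_mul _
  have hi3 : Integrable (fun ω => (((1 - ε) ^ 2)⁻¹ +
        (∑ b, badInd ξ A T (ε * γ) b ω * xc d w b) / T)) P :=
    (integrable_const _).add ((integrable_finsetSum _ hi1).div_const _)
  have hi4 : Integrable (fun ω => (1 + ε) ^ 2 * (totalRegret d us * (((1 - ε) ^ 2)⁻¹ +
        (∑ b, badInd ξ A T (ε * γ) b ω * xc d w b) / T)) + ∑ a, d a) P :=
    ((hi3.const_mul _).const_mul _).add (integrable_const _)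
  refine ⟨hi4.add (integrable_finsetSum _ hi2), ?_⟩
  rw [integral_add hi4 (integrable_finsetSum _ hi2), integral_add ((hi3.const_mul _).const_mul _)
    (integrable_const _), integral_const_mul, integral_const_mul, integral_add (integrable_const _)
    ((integrable_finsetSum _ hi1).div_const _), integral_div, integral_finsetSum _ hi1,
    integral_finsetSum _ hi2]
  simp only [integral_const, probReal_univ, smul_eq_mul, one_mul]
  have h1 : (∑ b, ∫ ω, badInd ξ A T (ε * γ) b ω * xc d w b ∂P) / T ≤ 16 / γ ^ 2 := by
    rw [div_le_iff₀ hT]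
    have h2 : ∑ b, ∫ ω, badInd ξ A T (ε * γ) b ω * xc d w b ∂P ≤ 1 / γ ^ 2 * totalPulls d w := by
      rw [totalPulls, Finset.mul_sum]
      refine Finset.sum_le_sum fun b _ => ?_
      rw [integral_mul_const]
      exact mul_le_mul_of_nonneg_right (h.integral_badInd_le hx hp b) (xc_nonneg d w b)
    calc _ ≤ 1 / γ ^ 2 * totalPulls d w := h2
      _ ≤ 1 / γ ^ 2 * (16 * T) := by gcongr
      _ = _ := by ring
  have h2 : ∑ a, ∫ ω, d a * (badInd ξ A T (ε * γ) a ω * reachCount T d γ ξ A w a ω) ∂P ≤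
      96 / γ * totalRegret d us := by
    have h3 : ∑ a, ∫ ω, d a * (badInd ξ A T (ε * γ) a ω * reachCount T d γ ξ A w a ω) ∂P ≤
        6 / γ * totalRegret d w := by
      unfold totalRegret
      rw [Finset.mul_sum]
      refine Finset.sum_le_sum fun a _ => ?_
      have hda := h.nonneg a
      rw [integral_const_mul]
      have := h.integral_badInd_mul_reachCount_le (P := P) hγ4 hx hp (u := w) (a := a)
        (by positivity) (by linarith [hd1 a])
      nlinarith [mul_le_mul_of_nonneg_left this hda]
    have h4 : totalRegret d w ≤ 16 * totalRegret d us := by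
      refine (h.totalRegret_le hw hwus hG).trans ?_
      rw [div_le_iff₀ hT]
      nlinarith
    calc _ ≤ 6 / γ * totalRegret d w := h3
      _ ≤ 6 / γ * (16 * totalRegret d us) := by gcongr
      _ = _ := by ring
  -- The initial pulls are a fraction κ of the noiseless regret, since κ xc ≥ 1 for every arm.
  have h3 : ∑ a, d a ≤ κ * totalRegret d us := by
    unfold totalRegret
    rw [Finset.mul_sum]
    refine Finset.sum_le_sum fun a _ => ?_
    have hda := h.nonneg a
    have hus : 0 < us := hw.trans_le hwus
    have : 1 ≤ κ * xc d us a := by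
      rw [xc, ← div_eq_mul_inv, one_le_div (by positivity)]; exact hκ a
    nlinarith
  have h5 : (1 + ε) ^ 2 * (totalRegret d us * (((1 - ε) ^ 2)⁻¹ +
      (∑ b, ∫ ω, badInd ξ A T (ε * γ) b ω * xc d w b ∂P) / T)) ≤
      (1 + ε) ^ 2 * (totalRegret d us * (((1 - ε) ^ 2)⁻¹ + 16 / γ ^ 2)) := by gcongr
  nlinarith

/-- The contribution to the regret of the event that the level drops to `u`, but stays above
`u / 2`. -/
theorem IsRun.integral_mid_le [MeasurableSpace Ω] {P : Measure Ω} [IsProbabilityMeasure P]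
    (h : IsRun P T d γ ξ A) (hγ20 : 20 ≤ γ)
    (hb : badBound T (1 / 4 * γ) ≤ Real.exp (-(γ ^ 2 / 100))) {u us : ℝ} (hu : 0 < u)
    (hG : 4 * (T : ℝ) ≤ totalPulls d u) (hus : u ≤ us) (hGs : totalPulls d us = T)
    (hd1 : ∀ a, us + d a ≤ 1) :
    Integrable (fun ω => ∑ a, d a * ((drop T d γ ξ A u).indicator (fun _ => (1 : ℝ)) ω *
      reachCount T d γ ξ A (u / 2) a ω)) P ∧
    ∫ ω, ∑ a, d a * ((drop T d γ ξ A u).indicator (fun _ => (1 : ℝ)) ω *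
      reachCount T d γ ξ A (u / 2) a ω) ∂P ≤
      totalRegret d us * (19200 / (γ ^ 2 * (u ^ 2 * T))) := by
  have hm := h.measurableSet_drop u
  have hi : ∀ a ∈ Finset.univ, Integrable (fun ω => d a *
      ((drop T d γ ξ A u).indicator (fun _ => (1 : ℝ)) ω *
      reachCount T d γ ξ A (u / 2) a ω)) P := fun a _ =>
    (h.integrable_ind_mul_reachCount hm _ a).const_mul _
  refine ⟨integrable_finsetSum _ hi, ?_⟩
  rw [integral_finsetSum _ hi]
  have hs0 := Real.sqrt_nonneg (P.real (drop T d γ ξ A u))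
  have h1 : ∑ a, ∫ ω, d a * ((drop T d γ ξ A u).indicator (fun _ => (1 : ℝ)) ω *
      reachCount T d γ ξ A (u / 2) a ω) ∂P ≤
      24 * (√(P.real (drop T d γ ξ A u)) * totalRegret d u) := by
    unfold totalRegret
    rw [Finset.mul_sum, Finset.mul_sum]
    refine Finset.sum_le_sum fun a _ => ?_
    have hda := h.nonneg a
    rw [integral_const_mul]
    have h2 := h.integral_ind_mul_reachCount_le (P := P) (by linarith) hm (u := u / 2) (a := a)
      (by positivity) (by linarith [hd1 a])
    have h3 : 6 * √(P.real (drop T d γ ξ A u)) * xc d (u / 2) a ≤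
        6 * √(P.real (drop T d γ ξ A u)) * (4 * xc d u a) := by
      have := xc_half_le h.nonneg hu a
      gcongr
    have := mul_le_mul_of_nonneg_left (h2.trans h3) hda
    nlinarith
  have h2 := h.sqrt_measure_drop_mul_le (P := P) hγ20 hb hu hG hus hGs
  calc _ ≤ 24 * (800 / (γ ^ 2 * (u ^ 2 * T)) * totalRegret d us) := h1.trans (by gcongr)
    _ = _ := by ring

open Classical in
/-- A bound for the number of pulls of arm `a` when the level is at least `- d a / 2`. -/
def farCount (T : ℕ) (d : Fin K → ℝ) (γ : ℝ) (ξ : ℕ → Ω → ℝ) (A : ℕ → Ω → Fin K) (u : ℝ)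
    (a : Fin K) (ω : Ω) : ℝ :=
  if d a ≤ u then xc d u a else reachCount T d γ ξ A (-(d a / 2)) a ω

theorem IsRun.integral_far_le [MeasurableSpace Ω] {P : Measure Ω} [IsProbabilityMeasure P]
    (h : IsRun P T d γ ξ A) (hγ20 : 20 ≤ γ)
    (hb : badBound T (1 / 4 * γ) ≤ Real.exp (-(γ ^ 2 / 100))) {u us : ℝ} (hu : 0 < u)
    (hG : 4 * (T : ℝ) ≤ totalPulls d u) (hus : u ≤ us) (hGs : totalPulls d us = T)
    (hd1 : ∀ a, us + d a ≤ 1) :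
    Integrable (fun ω => ∑ a, d a * ((drop T d γ ξ A u).indicator (fun _ => (1 : ℝ)) ω *
      farCount T d γ ξ A u a ω)) P ∧
    ∫ ω, ∑ a, d a * ((drop T d γ ξ A u).indicator (fun _ => (1 : ℝ)) ω *
      farCount T d γ ξ A u a ω) ∂P ≤ totalRegret d us * (76800 / (γ ^ 2 * (u ^ 2 * T))) := by
  have hm := h.measurableSet_drop u
  have hP0 : 0 ≤ P.real (drop T d γ ξ A u) := measureReal_nonneg
  have hP1 : P.real (drop T d γ ξ A u) ≤ 1 := measureReal_le_one
  have hs0 := Real.sqrt_nonneg (P.real (drop T d γ ξ A u))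
  have key : ∀ a, Integrable (fun ω => (drop T d γ ξ A u).indicator (fun _ => (1 : ℝ)) ω *
      farCount T d γ ξ A u a ω) P ∧ ∫ ω, (drop T d γ ξ A u).indicator (fun _ => (1 : ℝ)) ω *
      farCount T d γ ξ A u a ω ∂P ≤ 96 * √(P.real (drop T d γ ξ A u)) * xc d u a := by
    intro a
    have hx := xc_nonneg d u a
    by_cases hda : d a ≤ u
    · simp only [farCount, if_pos hda]
      refine ⟨(integrable_ind hm).mul_const _, ?_⟩
      rw [integral_mul_const, integral_ind hm]
      refine mul_le_mul_of_nonneg_right ?_ hx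
      have : P.real (drop T d γ ξ A u) ≤ √(P.real (drop T d γ ξ A u)) :=
        Real.le_sqrt_of_sq_le (by nlinarith)
      linarith
    · simp only [farCount, if_neg hda]
      refine ⟨h.integrable_ind_mul_reachCount hm _ a, ?_⟩
      have hda' : u < d a := not_le.1 hda
      have hd0 : 0 < d a := hu.trans hda'
      have h2 := h.integral_ind_mul_reachCount_le (P := P) (by linarith) hm (u := -(d a / 2))
        (a := a) (by linarith) (by linarith [hd1 a])
      refine h2.trans ?_
      -- Since u < d a, the sum u + d a is at most 2 d a, four times the remaining margin d a/2.
      have h3 : xc d (-(d a / 2)) a ≤ 16 * xc d u a := by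
        unfold xc
        rw [← div_eq_mul_inv, inv_eq_one_div, div_le_div_iff₀ (by
          have : 0 < -(d a / 2) + d a := by linarith
          positivity) (by positivity)]
        nlinarith
      calc _ ≤ 6 * √(P.real (drop T d γ ξ A u)) * (16 * xc d u a) := by gcongr
        _ = _ := by ring
  have hi : ∀ a ∈ Finset.univ, Integrable (fun ω => d a *
      ((drop T d γ ξ A u).indicator (fun _ => (1 : ℝ)) ω * farCount T d γ ξ A u a ω)) P :=
    fun a _ => (key a).1.const_mul _
  refine ⟨integrable_finsetSum _ hi, ?_⟩
  rw [integral_finsetSum _ hi]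
  have h1 : ∑ a, ∫ ω, d a * ((drop T d γ ξ A u).indicator (fun _ => (1 : ℝ)) ω *
      farCount T d γ ξ A u a ω) ∂P ≤
      96 * (√(P.real (drop T d γ ξ A u)) * totalRegret d u) := by
    unfold totalRegret
    rw [Finset.mul_sum, Finset.mul_sum]
    refine Finset.sum_le_sum fun a _ => ?_
    rw [integral_const_mul]
    have := mul_le_mul_of_nonneg_left (key a).2 (h.nonneg a)
    nlinarith
  have h2 := h.sqrt_measure_drop_mul_le (P := P) hγ20 hb hu hG hus hGs
  calc _ ≤ 96 * (800 / (γ ^ 2 * (u ^ 2 * T)) * totalRegret d us) := h1.trans (by gcongr)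
    _ = _ := by ring

/-- The bound of `IsRun.gap_le_of_mem_drop_neg`, restricted to an event. -/
def tailSum (T : ℕ) (γ : ℝ) (ξ : ℕ → Ω → ℝ) (A : ℕ → Ω → Fin K) (a₀ : Fin K) (D η : ℝ) (E : Set Ω)
    (ω : Ω) : ℝ :=
  ∑ n ∈ Finset.Icc 1 T, 4 / γ ^ 2 * ((√(n : ℝ))⁻¹ * Real.exp (-(γ ^ 2 * D / 4 * √(n : ℝ)))) *
      Real.exp (-γ ^ 2 / 2) * (3 * Real.exp (-η) * tailExp ξ A T γ a₀ n ω +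
        Real.exp (η * γ ^ 2) * E.indicator (fun _ => (1 : ℝ)) ω)

theorem tailSum_nonneg (a₀ : Fin K) (D η : ℝ) (E : Set Ω) (ω : Ω) :
    0 ≤ tailSum T γ ξ A a₀ D η E ω := by
  refine Finset.sum_nonneg fun n _ => ?_
  have h1 : 0 < tailExp ξ A T γ a₀ n ω := Real.exp_pos _
  have h2 : 0 ≤ E.indicator (fun _ => (1 : ℝ)) ω := Set.indicator_nonneg (by simp) _
  positivity

/-- `tailExp` has mean one and `hPE` controls the indicator term, so each summand has a factor
e^(-η). The sum over n contributes 8/(γ² D). -/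
theorem IsRun.integral_tailSum_le [MeasurableSpace Ω] {P : Measure Ω} [IsProbabilityMeasure P]
    (h : IsRun P T d γ ξ A) (a₀ : Fin K) {D η : ℝ} (hD : 0 < D) {E : Set Ω}
    (hE : MeasurableSet E) (hPE : Real.exp (η * γ ^ 2) * P.real E ≤ Real.exp (-η)) :
    Integrable (fun ω => tailSum T γ ξ A a₀ D η E ω) P ∧
    ∫ ω, tailSum T γ ξ A a₀ D η E ω ∂P ≤
      128 / (γ ^ 4 * D) * Real.exp (-γ ^ 2 / 2) * Real.exp (-η) := by
  have hγ := h.pos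
  have hi0 : ∀ n, Integrable (fun ω => 3 * Real.exp (-η) * tailExp ξ A T γ a₀ n ω +
        Real.exp (η * γ ^ 2) * E.indicator (fun _ => (1 : ℝ)) ω) P := fun n =>
    ((h.integral_tailExp a₀ n).1.const_mul _).add ((integrable_ind hE).const_mul _)
  unfold tailSum
  have hi : ∀ n ∈ Finset.Icc 1 T, Integrable (fun ω => 4 / γ ^ 2 * ((√(n : ℝ))⁻¹ *
      Real.exp (-(γ ^ 2 * D / 4 * √(n : ℝ)))) *
      Real.exp (-γ ^ 2 / 2) * (3 * Real.exp (-η) * tailExp ξ A T γ a₀ n ω +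
        Real.exp (η * γ ^ 2) * E.indicator (fun _ => (1 : ℝ)) ω)) P := fun n _ =>
    (hi0 n).const_mul _
  refine ⟨integrable_finsetSum _ hi, ?_⟩
  rw [integral_finsetSum _ hi]
  have h1 : ∀ n ∈ Finset.Icc 1 T, ∫ ω, 4 / γ ^ 2 * ((√(n : ℝ))⁻¹ *
      Real.exp (-(γ ^ 2 * D / 4 * √(n : ℝ)))) *
      Real.exp (-γ ^ 2 / 2) * (3 * Real.exp (-η) * tailExp ξ A T γ a₀ n ω +
        Real.exp (η * γ ^ 2) * E.indicator (fun _ => (1 : ℝ)) ω) ∂P ≤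
      16 / γ ^ 2 * Real.exp (-γ ^ 2 / 2) * Real.exp (-η) *
        ((√(n : ℝ))⁻¹ * Real.exp (-(γ ^ 2 * D / 4 * √(n : ℝ)))) := by
    intro n _
    rw [integral_const_mul, integral_add ((h.integral_tailExp a₀ n).1.const_mul _)
      ((integrable_ind hE).const_mul _), integral_const_mul, integral_const_mul,
      (h.integral_tailExp a₀ n).2, integral_ind hE]
    calc _ ≤ 4 / γ ^ 2 * ((√(n : ℝ))⁻¹ * Real.exp (-(γ ^ 2 * D / 4 * √(n : ℝ)))) *
        Real.exp (-γ ^ 2 / 2) * (3 * Real.exp (-η) * 1 + Real.exp (-η)) := by gcongr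
      _ = _ := by ring
  refine (Finset.sum_le_sum h1).trans ?_
  rw [← Finset.mul_sum]
  have h2 := sum_inv_sqrt_mul_exp_le (c := γ ^ 2 * D / 4) (by positivity) T
  calc _ ≤ 16 / γ ^ 2 * Real.exp (-γ ^ 2 / 2) * Real.exp (-η) * (2 / (γ ^ 2 * D / 4)) := by gcongr
    _ = _ := by field_simp; ring

/-- The regret when the level drops below the smallest level considered. -/
theorem IsRun.regret_le_of_mem_drop [MeasurableSpace Ω] {P : Measure Ω}
    (h : IsRun P T d γ ξ A) (hγ1 : 1 ≤ γ) {a₀ : Fin K} (h0 : d a₀ = 0) {u D : ℝ}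
    (hu : 0 < u) (huT : u ^ 2 * T ≤ 1 / 4) (hD : 0 < D) (hDd : ∀ a, u < d a → D ≤ d a) (η : ℝ)
    {ω : Ω} (hω : ω ∈ drop T d γ ξ A u) :
    ∑ a, d a * pulls A T a ω ≤ ∑ a, d a * ((drop T d γ ξ A u).indicator (fun _ => (1 : ℝ)) ω *
      farCount T d γ ξ A u a ω) + T * tailSum T γ ξ A a₀ D η (drop T d γ ξ A u) ω := by
  have hB := tailSum_nonneg (T := T) (γ := γ) (ξ := ξ) (A := A) a₀ D η (drop T d γ ξ A u) ω
  rw [Set.indicator_of_mem hω, ← sum_pulls_real A T ω, Finset.sum_mul, ← Finset.sum_add_distrib]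
  refine Finset.sum_le_sum fun a _ => ?_
  rw [one_mul]
  have hda := h.nonneg a
  have hp : (0 : ℝ) ≤ pulls A T a ω := Nat.cast_nonneg _
  by_cases hau : d a ≤ u
  · have h1 : (pulls A T a ω : ℝ) ≤ farCount T d γ ξ A u a ω := by
      rw [farCount, if_pos hau]
      have h2 : (pulls A T a ω : ℝ) ≤ T := by exact_mod_cast pulls_le A T a ω
      refine h2.trans ?_
      rw [xc, inv_eq_one_div, le_div_iff₀ (by positivity)]
      -- Hence (u + d a)² T ≤ 1: for so small a gap the trivial count T is already below xc.
      have : (u + d a) ^ 2 ≤ 4 * u ^ 2 := by nlinarith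
      have hT := h.T_pos
      nlinarith
    have := mul_le_mul_of_nonneg_left h1 hda
    have := mul_nonneg hp hB
    linarith
  · by_cases hdr : ω ∈ drop T d γ ξ A (-(d a / 2))
    · have h1 := h.gap_le_of_mem_drop_neg hγ1 h0 hD (hDd a (not_le.1 hau)) η hdr
      -- Here the gap, not the pull count, is bounded. The bound is the same for all such arms, so
      -- the total of all pulls produces just one factor T.
      have h2 : d a ≤ tailSum T γ ξ A a₀ D η (drop T d γ ξ A u) ω := by
        unfold tailSum
        simpa [Set.indicator_of_mem hω] using h1
      have h3 : 0 ≤ d a * farCount T d γ ξ A u a ω := by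
        rw [farCount, if_neg hau]
        exact mul_nonneg hda (reachCount_nonneg _ _ _ _ _ _ _ _)
      nlinarith
    · have h1 : (pulls A T a ω : ℝ) ≤ farCount T d γ ξ A u a ω := by
        rw [farCount, if_neg hau]
        exact h.pulls_le_reachCount (fun t ht1 ht2 => h.level_le_of_notMem_drop hdr ht1 ht2) a
      have := mul_le_mul_of_nonneg_left h1 hda
      have := mul_nonneg hp hB
      linarith

/-! ### Dyadic levels and assembly of the upper bound. -/

/-- The dyadic levels `2 ^ j / (2 √T)`. -/
def dyadicLevel (T : ℕ) (j : ℕ) : ℝ := 2 ^ j / (2 * √(T : ℝ))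

theorem dyadicLevel_pos {T : ℕ} (hT : (0 : ℝ) < T) (j : ℕ) : 0 < dyadicLevel T j := by
  have := Real.sqrt_pos.2 hT
  unfold dyadicLevel; positivity

theorem dyadicLevel_sq_mul {T : ℕ} (hT : (0 : ℝ) < T) (j : ℕ) :
    dyadicLevel T j ^ 2 * T = 4 ^ j / 4 := by
  have h := Real.sqrt_pos.2 hT
  have h2 : √(T : ℝ) ^ 2 = T := Real.sq_sqrt hT.le
  unfold dyadicLevel
  rw [div_pow, mul_pow, h2, ← pow_mul, mul_comm j 2, pow_mul]
  field_simp; ring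

theorem dyadicLevel_succ_div_two (T j : ℕ) : dyadicLevel T (j + 1) / 2 = dyadicLevel T j := by
  unfold dyadicLevel; rw [pow_succ]; ring

/-- J is the last level before G first falls below 4T. Halving a level multiplies G by at most 4,
hence G ≤ 16T at J. -/
theorem IsRun.exists_dyadicLevel [MeasurableSpace Ω] {P : Measure Ω} (h : IsRun P T d γ ξ A)
    {a₀ : Fin K} (h0 : d a₀ = 0) : ∃ J, (∀ j ≤ J, 4 * (T : ℝ) ≤ totalPulls d (dyadicLevel T j)) ∧
      totalPulls d (dyadicLevel T J) ≤ 16 * T := by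
  classical
  have hT := h.T_pos
  have hex : ∃ j, totalPulls d (dyadicLevel T j) < 4 * T := by
    -- Each xc is at most 4T/4^K at level K, and K < 4^K.
    refine ⟨K, ?_⟩
    have hu := dyadicLevel_pos hT K
    have h1 : ∀ a, xc d (dyadicLevel T K) a ≤ 4 * T / 4 ^ K := by
      intro a
      have hda := h.nonneg a
      have h2 := dyadicLevel_sq_mul hT K
      rw [xc, inv_eq_one_div, div_le_div_iff₀ (by positivity) (by positivity)]
      have h3 : dyadicLevel T K ^ 2 ≤ (dyadicLevel T K + d a) ^ 2 := by gcongr; linarith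
      nlinarith
    have h2 : totalPulls d (dyadicLevel T K) ≤ K * (4 * T / 4 ^ K) := by
      refine (Finset.sum_le_sum fun a _ => h1 a).trans ?_
      simp
    refine h2.trans_lt ?_
    have h3 : (K : ℝ) < 4 ^ K := by exact_mod_cast Nat.lt_pow_self (by norm_num)
    rw [← mul_div_assoc, div_lt_iff₀ (by positivity)]
    nlinarith
  -- The best arm alone contributes the inverse square of 1/(2√T), which is 4T.
  have h00 : 4 * (T : ℝ) ≤ totalPulls d (dyadicLevel T 0) := by
    refine le_trans ?_ (Finset.single_le_sum (f := fun a => xc d (dyadicLevel T 0) a)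
      (fun a _ => xc_nonneg d _ a) (Finset.mem_univ a₀))
    have h2 := dyadicLevel_sq_mul hT 0
    have hu := dyadicLevel_pos hT 0
    simp only [xc, h0, add_zero]
    rw [inv_eq_one_div, le_div_iff₀ (by positivity)]
    nlinarith
  set N := Nat.find hex with hN
  have hN0 : N ≠ 0 := by
    intro hc
    have := Nat.find_spec hex
    rw [← hN, hc] at this
    linarith
  obtain ⟨J, hJ⟩ := Nat.exists_eq_succ_of_ne_zero hN0
  refine ⟨J, fun j hj => not_lt.1 (Nat.find_min hex (by omega)), ?_⟩
  have h1 : totalPulls d (dyadicLevel T (J + 1)) < 4 * T := by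
    have := Nat.find_spec hex
    rwa [← hN, hJ] at this
  have h2 : totalPulls d (dyadicLevel T J) ≤ 4 * totalPulls d (dyadicLevel T (J + 1)) := by
    unfold totalPulls
    rw [Finset.mul_sum, ← dyadicLevel_succ_div_two]
    exact Finset.sum_le_sum fun a _ => xc_half_le h.nonneg (dyadicLevel_pos hT _) a
  linarith

theorem exists_min_gap {d : Fin K → ℝ} (hd : ∀ a, 0 ≤ d a) (hpos : ∃ a, 0 < d a) {u : ℝ}
    (hu : 0 < u) : ∃ D, 0 < D ∧ (∀ a, u < d a → D ≤ d a) ∧ 1 / D ≤ 4 * totalRegret d u := by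
  classical
  rcases (Finset.univ.filter fun a => u < d a).eq_empty_or_nonempty with he | hne
  · obtain ⟨a, ha⟩ := hpos
    have hF : 0 < totalRegret d u := by
      refine lt_of_lt_of_le ?_ (Finset.single_le_sum (f := fun a => d a * xc d u a)
        (fun b _ => mul_nonneg (hd b) (xc_nonneg d u b)) (Finset.mem_univ a))
      simp only [xc]
      positivity
    -- With no gap above `u` the constraint on D is vacuous, so D may be chosen to make the last
    -- inequality an equality.
    refine ⟨1 / (4 * totalRegret d u), by positivity, fun b hb => ?_, by rw [one_div_one_div]⟩
    have : b ∈ Finset.univ.filter fun a => u < d a := by simp [hb]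
    rw [he] at this
    simp at this
  · obtain ⟨a, ha, hmin⟩ := Finset.exists_min_image _ d hne
    have hua : u < d a := (Finset.mem_filter.1 ha).2
    have hda : 0 < d a := hu.trans hua
    refine ⟨d a, hda, fun b hb => hmin b (by simp [hb]), ?_⟩
    have h1 : d a * xc d u a ≤ totalRegret d u := Finset.single_le_sum
      (f := fun a => d a * xc d u a) (fun b _ => mul_nonneg (hd b) (xc_nonneg d u b))
      (Finset.mem_univ a)
    have h2 : 1 / (4 * d a) ≤ d a * xc d u a := by
      rw [xc, ← div_eq_mul_inv, div_le_div_iff₀ (by positivity) (by positivity)]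
      nlinarith
    have h3 : 1 / d a = 4 * (1 / (4 * d a)) := by field_simp
    rw [h3]
    linarith

theorem sum_inv_four_pow_le (J : ℕ) :
    ∑ j ∈ Finset.range J, (1 : ℝ) / 4 ^ (j + 1) ≤ 1 := by
  have h : ∑ j ∈ Finset.range J, (1 : ℝ) / 4 ^ (j + 1) ≤ 1 - 1 / 4 ^ J := by
    induction J with
    | zero => simp
    | succ J ih =>
      rw [Finset.sum_range_succ]
      have : (1 : ℝ) / 4 ^ J = 4 * (1 / 4 ^ (J + 1)) := by rw [pow_succ]; field_simp
      have h2 : (0 : ℝ) ≤ 1 / 4 ^ (J + 1) := by positivity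
      linarith
  have : (0 : ℝ) ≤ 1 / 4 ^ J := by positivity
  linarith

/-- The upper bound for the expected normalized regret. -/
theorem IsRun.integral_regret_le [MeasurableSpace Ω] {P : Measure Ω} [IsProbabilityMeasure P]
    (h : IsRun P T d γ ξ A) (hγ20 : 20 ≤ γ)
    (hb : badBound T (1 / 4 * γ) ≤ Real.exp (-(γ ^ 2 / 100)))
    {a₀ : Fin K} (h0 : d a₀ = 0) (hpos : ∃ a, 0 < d a) {ε : ℝ} (hε : 0 ≤ ε) (hε1 : ε < 1)
    (hp : badBound T (ε * γ) ≤ 1 / γ ^ 2) {us : ℝ} (hus : 0 < us)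
    (hG : totalPulls d us = T) (hd1 : ∀ a, us + d a ≤ 1) {κ : ℝ}
    (hκ : ∀ a, (us + d a) ^ 2 ≤ κ) :
    ∫ ω, ∑ a, d a * (pulls A T a ω : ℝ) ∂P ≤
      totalRegret d us * ((1 + ε) ^ 2 * (((1 - ε) ^ 2)⁻¹ + 16 / γ ^ 2) + κ + 96 / γ +
        400000 / γ ^ 2 + 1638400 / γ ^ 2 * ((γ ^ 2)⁻¹ * (T * Real.exp (-γ ^ 2 / 2)))) := by
  classical
  have hT := h.T_pos
  have hγ := h.pos
  have hF := totalRegret_nonneg h.nonneg us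
  obtain ⟨J, hJ1, hJ2⟩ := h.exists_dyadicLevel h0
  have hu := fun j => dyadicLevel_pos hT j
  have hle : ∀ j ≤ J, dyadicLevel T j ≤ us := fun j hj => by
    by_contra hc
    have h1 := totalPulls_anti h.nonneg hus (not_le.1 hc).le
    have := hJ1 j hj
    linarith
  set u₀ := dyadicLevel T 0 with hu₀
  have hu₀T : u₀ ^ 2 * T = 1 / 4 := by simpa using dyadicLevel_sq_mul hT 0
  obtain ⟨D, hD, hDd, hDF⟩ := exists_min_gap h.nonneg hpos (hu 0)
  set r := u₀ ^ 2 * totalPulls d u₀ with hr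
  have hG0 : 0 < totalPulls d u₀ := by linarith [hJ1 0 (Nat.zero_le _)]
  have hr0 : 0 < r := mul_pos (pow_pos (hu 0) 2) hG0
  -- The drop probability at the lowest level is at most exp(-2ηγ²), so it still leaves exp(-ηγ²)
  -- after multiplication by exp(ηγ²).
  set η := r / 800 with hη
  have hη0 : 0 < η := by positivity
  have hPE : Real.exp (η * γ ^ 2) * P.real (drop T d γ ξ A u₀) ≤ Real.exp (-η) := by
    have h1 := h.measure_drop_le_exp (P := P) hγ20 hb (hu 0) (hJ1 0 (Nat.zero_le _))
    calc _ ≤ Real.exp (η * γ ^ 2) * Real.exp (-(r * γ ^ 2 / 400)) := by gcongr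
      _ ≤ Real.exp (-η) := by
        rw [← Real.exp_add]
        refine Real.exp_le_exp.2 ?_
        have : r = 800 * η := by rw [hη]; ring
        rw [this]
        have h2 : 0 ≤ γ ^ 2 - 1 := by nlinarith
        nlinarith [mul_nonneg hη0.le h2]
  obtain ⟨i1, b1⟩ := h.integral_main_le (P := P) (by linarith) hε hp (hu J) (hle J le_rfl) hG hJ2
    hd1 hκ
  have i2 := fun j (hj : j ∈ Finset.range J) => h.integral_mid_le (P := P) hγ20 hb (hu (j + 1))
    (hJ1 _ (Finset.mem_range.1 hj)) (hle _ (Finset.mem_range.1 hj)) hG hd1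
  obtain ⟨i3, b3⟩ := h.integral_far_le (P := P) hγ20 hb (hu 0) (hJ1 0 (Nat.zero_le _))
    (hle 0 (Nat.zero_le _)) hG hd1
  obtain ⟨i4, b4⟩ := h.integral_tailSum_le (P := P) a₀ hD (h.measurableSet_drop u₀) hPE
  set U1 : Ω → ℝ := fun ω => (1 + ε) ^ 2 * (totalRegret d us * (((1 - ε) ^ 2)⁻¹ +
        (∑ b, badInd ξ A T (ε * γ) b ω * xc d (dyadicLevel T J) b) / T)) + ∑ a, d a +
        ∑ a, d a * (badInd ξ A T (ε * γ) a ω * reachCount T d γ ξ A (dyadicLevel T J) a ω)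
    with hU1
  set U2 : ℕ → Ω → ℝ := fun j ω =>
    ∑ a, d a * ((drop T d γ ξ A (dyadicLevel T (j + 1))).indicator (fun _ => (1 : ℝ)) ω *
      reachCount T d γ ξ A (dyadicLevel T (j + 1) / 2) a ω) with hU2
  set U3 : Ω → ℝ := fun ω => ∑ a, d a * ((drop T d γ ξ A u₀).indicator (fun _ => (1 : ℝ)) ω *
      farCount T d γ ξ A u₀ a ω) with hU3
  set U4 : Ω → ℝ := fun ω => tailSum T γ ξ A a₀ D η (drop T d γ ξ A u₀) ω with hU4
  have n1 : ∀ ω, 0 ≤ U1 ω := fun ω => by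
    have e1 : 0 ≤ ∑ b, badInd ξ A T (ε * γ) b ω * xc d (dyadicLevel T J) b :=
      Finset.sum_nonneg fun b _ => mul_nonneg (badInd_nonneg _ _ _) (xc_nonneg _ _ _)
    have e2 : 0 ≤ ∑ a, d a := Finset.sum_nonneg fun a _ => h.nonneg a
    have e3 : 0 ≤ ∑ a, d a * (badInd ξ A T (ε * γ) a ω *
        reachCount T d γ ξ A (dyadicLevel T J) a ω) :=
      Finset.sum_nonneg fun a _ => mul_nonneg (h.nonneg a)
        (mul_nonneg (badInd_nonneg _ _ _) (reachCount_nonneg _ _ _ _ _ _ _ _))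
    simp only [hU1]
    positivity
  have n2 : ∀ j ω, 0 ≤ U2 j ω := fun j ω => Finset.sum_nonneg fun a _ =>
    mul_nonneg (h.nonneg a) (mul_nonneg (Set.indicator_nonneg (by simp) _)
      (reachCount_nonneg _ _ _ _ _ _ _ _))
  have n3 : ∀ ω, 0 ≤ U3 ω := fun ω => Finset.sum_nonneg fun a _ =>
    mul_nonneg (h.nonneg a) (mul_nonneg (Set.indicator_nonneg (by simp) _) (by
      unfold farCount
      split_ifs
      · exact xc_nonneg _ _ _
      · exact reachCount_nonneg _ _ _ _ _ _ _ _))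
  have n4 : ∀ ω, 0 ≤ T * U4 ω := fun ω => mul_nonneg hT.le (tailSum_nonneg _ _ _ _ _)
  have n2s : ∀ ω, 0 ≤ ∑ j ∈ Finset.range J, U2 j ω := fun ω =>
    Finset.sum_nonneg fun j _ => n2 j ω
  -- The case is decided by the lowest dyadic level reached: none up to J gives `U1`, level i + 1
  -- but not i gives `U2 i`, and level 0 gives `U3` and `U4`.
  have hpath : ∀ ω, ∑ a, d a * (pulls A T a ω : ℝ) ≤
      U1 ω + ∑ j ∈ Finset.range J, U2 j ω + U3 ω + T * U4 ω := by
    intro ω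
    have m1 := n1 ω
    have m2 := n2s ω
    have m3 := n3 ω
    have m4 := n4 ω
    by_cases hJd : ω ∈ drop T d γ ξ A (dyadicLevel T J)
    · have hex : ∃ j, ω ∈ drop T d γ ξ A (dyadicLevel T j) := ⟨J, hJd⟩
      have hspec := Nat.find_spec hex
      have hfJ : Nat.find hex ≤ J := Nat.find_min' hex hJd
      rcases hj : Nat.find hex with _ | i
      · rw [hj] at hspec
        have := h.regret_le_of_mem_drop (by linarith) h0 (hu 0) hu₀T.le hD hDd η hspec
        linarith
      · rw [hj] at hspec hfJ
        have hnot : ω ∉ drop T d γ ξ A (dyadicLevel T i) := Nat.find_min hex (by omega)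
        have h1 : ∑ a, d a * (pulls A T a ω : ℝ) ≤ U2 i ω := by
          simp only [hU2]
          rw [Set.indicator_of_mem hspec]
          refine Finset.sum_le_sum fun a _ => ?_
          rw [one_mul, dyadicLevel_succ_div_two]
          exact mul_le_mul_of_nonneg_left (h.pulls_le_reachCount
            (fun t ht1 ht2 => h.level_le_of_notMem_drop hnot ht1 ht2) a) (h.nonneg a)
        have h2 : U2 i ω ≤ ∑ j ∈ Finset.range J, U2 j ω :=
          Finset.single_le_sum (f := fun j => U2 j ω) (fun j _ => n2 j ω)
            (Finset.mem_range.2 (by omega))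
        linarith
    · have := h.regret_le_of_notMem_drop hε hε1 hus (hu J) hG hJd
      linarith
  have iU2 : Integrable (fun ω => ∑ j ∈ Finset.range J, U2 j ω) P :=
    integrable_finsetSum _ fun j hj => (i2 j hj).1
  have i12 : Integrable (fun ω => U1 ω + ∑ j ∈ Finset.range J, U2 j ω) P := i1.add iU2
  have i123 : Integrable (fun ω => U1 ω + ∑ j ∈ Finset.range J, U2 j ω + U3 ω) P := i12.add i3
  refine (integral_mono h.integrable_regret (i123.add (i4.const_mul _)) hpath).trans ?_
  have e : ∫ ω, (U1 ω + ∑ j ∈ Finset.range J, U2 j ω + U3 ω + T * U4 ω) ∂P =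
      ∫ ω, U1 ω ∂P + ∑ j ∈ Finset.range J, ∫ ω, U2 j ω ∂P + ∫ ω, U3 ω ∂P + T * ∫ ω, U4 ω ∂P := by
    rw [integral_add i123 (i4.const_mul _), integral_add i12 i3, integral_add i1 iU2,
      integral_finsetSum _ fun j hj => (i2 j hj).1, integral_const_mul]
  refine (show _ = _ from e).le.trans ?_
  have b2 : ∑ j ∈ Finset.range J, ∫ ω, U2 j ω ∂P ≤ totalRegret d us * (76800 / γ ^ 2) := by
    have h1 : ∀ j ∈ Finset.range J, ∫ ω, U2 j ω ∂P ≤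
        totalRegret d us * (76800 / γ ^ 2) * (1 / 4 ^ (j + 1)) := fun j hj => by
      refine (i2 j hj).2.trans (le_of_eq ?_)
      rw [dyadicLevel_sq_mul hT]
      field_simp; ring
    refine (Finset.sum_le_sum h1).trans ?_
    rw [← Finset.mul_sum]
    exact mul_le_of_le_one_right (by positivity) (sum_inv_four_pow_le J)
  have b3' : ∫ ω, U3 ω ∂P ≤ totalRegret d us * (307200 / γ ^ 2) := by
    refine b3.trans (le_of_eq ?_)
    rw [hu₀T]; field_simp; ring
  have b4' : T * ∫ ω, U4 ω ∂P ≤ totalRegret d us *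
      (1638400 / γ ^ 2 * ((γ ^ 2)⁻¹ * (T * Real.exp (-γ ^ 2 / 2)))) := by
    -- This cancels the factor r lost in 1/D ≤ 16 r F(us), which is why the final constant does not
    -- depend on how small the least gap is.
    have h1 : Real.exp (-η) ≤ 800 / r := by
      rw [Real.exp_neg, inv_eq_one_div, div_le_div_iff₀ (Real.exp_pos _) hr0]
      have := Real.add_one_le_exp η
      have e2 : r = 800 * η := by rw [hη]; ring
      rw [e2]; nlinarith
    have h2 : 1 / D ≤ 16 * r * totalRegret d us := by
      have h3 := h.totalRegret_le (hu 0) (hle 0 (Nat.zero_le _)) hG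
      have h4 : totalPulls d u₀ / T = 4 * r := by
        rw [div_eq_iff hT.ne', hr]
        calc totalPulls d u₀ = 4 * (1 / 4) * totalPulls d u₀ := by ring
          _ = 4 * (u₀ ^ 2 * T) * totalPulls d u₀ := by rw [hu₀T]
          _ = _ := by ring
      rw [mul_div_assoc] at h3
      rw [h4] at h3
      linarith
    have h5 : (128 : ℝ) / (γ ^ 4 * D) = 128 / γ ^ 4 * (1 / D) := by field_simp
    rw [h5] at b4
    calc T * ∫ ω, U4 ω ∂P ≤ T * (128 / γ ^ 4 * (1 / D) * Real.exp (-γ ^ 2 / 2) *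
          Real.exp (-η)) := by gcongr
      _ ≤ T * (128 / γ ^ 4 * (16 * r * totalRegret d us) * Real.exp (-γ ^ 2 / 2) *
          (800 / r)) := by gcongr
      _ = _ := by field_simp; ring
  calc _ ≤ totalRegret d us * ((1 + ε) ^ 2 * (((1 - ε) ^ 2)⁻¹ + 16 / γ ^ 2) + κ + 96 / γ) +
        totalRegret d us * (76800 / γ ^ 2) + totalRegret d us * (307200 / γ ^ 2) +
        totalRegret d us * (1638400 / γ ^ 2 * ((γ ^ 2)⁻¹ * (T * Real.exp (-γ ^ 2 / 2)))) :=
        add_le_add (add_le_add (add_le_add b1 b2) b3') b4'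
    _ ≤ _ := by
        have h1 : (400000 : ℝ) / γ ^ 2 = 76800 / γ ^ 2 + 307200 / γ ^ 2 + 16000 / γ ^ 2 := by ring
        have h2 : 0 ≤ totalRegret d us * (16000 / γ ^ 2) := by positivity
        rw [h1]
        linarith

/-! ### Return to the original units. -/

theorem index_eq_nlev {μ : Fin K → ℝ} {σ γ : ℝ} (hσ : 0 < σ) (hγ : 0 < γ) {ξ : ℕ → Ω → ℝ}
    {A : ℕ → Ω → Fin K} {t : ℕ} {a : Fin K} {ω : Ω} (hn : 1 ≤ pulls A t a ω) :
    index μ σ γ ξ A t a ω =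
      bestMean μ + σ * γ * nlev (fun a => gap μ a / (σ * γ)) γ ξ A t a ω := by
  have hn' : (0 : ℝ) < pulls A t a ω := by exact_mod_cast hn
  have hs : 0 < √(pulls A t a ω : ℝ) := Real.sqrt_pos.2 hn'
  have h2 : √(pulls A t a ω : ℝ) ^ 2 = pulls A t a ω := Real.sq_sqrt hn'.le
  have h1 : ∑ s ∈ (Finset.range t).filter (fun s => A s ω = a), reward μ σ ξ A s ω =
      pulls A t a ω * μ a + σ * armSum ξ A t a ω := by
    unfold reward armSum pulls
    rw [Finset.sum_add_distrib, ← Finset.mul_sum]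
    congr 1
    rw [Finset.sum_congr rfl fun s hs => by rw [(Finset.mem_filter.1 hs).2]]
    simp
  unfold index empMean nlev
  rw [h1]
  set n := √(pulls A t a ω : ℝ)
  rw [← h2]
  unfold gap
  field_simp
  ring

theorem sum_gap_arm (μ : Fin K → ℝ) (A : ℕ → Ω → Fin K) (T : ℕ) (ω : Ω) :
    ∑ t ∈ Finset.range T, gap μ (A t ω) = ∑ a, gap μ a * pulls A T a ω := by
  induction T with
  | zero => simp [pulls]
  | succ T ih =>
    rw [Finset.sum_range_succ, ih]
    simp [pulls_succ, mul_add, Finset.sum_add_distrib]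

theorem integrable_noise [MeasurableSpace Ω] {P : Measure Ω} {T : ℕ} {ξ : ℕ → Ω → ℝ}
    (hξ : IsGaussianNoise P T ξ) {t : ℕ} (ht : t < T) :
    Integrable (ξ t) P ∧ ∫ ω, ξ t ω ∂P = 0 := by
  have hm := (hξ.measurable t ht).aemeasurable (μ := P)
  constructor
  · have h : Integrable id (P.map (ξ t)) := by
      rw [hξ.map_eq t ht]
      exact (memLp_id_gaussianReal 1).integrable (by norm_num)
    exact h.comp_aemeasurable hm
  · have h := integral_map hm (f := fun x : ℝ => x) (by fun_prop)
    rw [← h, hξ.map_eq t ht, integral_id_gaussianReal]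

/-- The noise in the rewards has mean zero, so only gaps times pull counts remain. -/
theorem expectedRegret_eq [MeasurableSpace Ω] {P : Measure Ω} [IsProbabilityMeasure P] {T : ℕ}
    {μ : Fin K → ℝ} {σ γ : ℝ} (hσ : 0 < σ) {ξ : ℕ → Ω → ℝ} {A : ℕ → Ω → Fin K}
    (h : IsRun P T (fun a => gap μ a / (σ * γ)) γ ξ A) :
    expectedRegret P T μ σ ξ A =
      σ * γ * ∫ ω, ∑ a, gap μ a / (σ * γ) * (pulls A T a ω : ℝ) ∂P := by
  have hγ := h.pos
  have e : ∀ ω, ∑ t ∈ Finset.range T, (bestMean μ - reward μ σ ξ A t ω) =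
      σ * γ * ∑ a, gap μ a / (σ * γ) * (pulls A T a ω : ℝ) -
        σ * ∑ t ∈ Finset.range T, ξ t ω := by
    intro ω
    have e1 : σ * γ * ∑ a, gap μ a / (σ * γ) * (pulls A T a ω : ℝ) =
        ∑ t ∈ Finset.range T, gap μ (A t ω) := by
      rw [sum_gap_arm, Finset.mul_sum]
      exact Finset.sum_congr rfl fun a _ => by field_simp
    rw [e1, Finset.mul_sum, ← Finset.sum_sub_distrib]
    exact Finset.sum_congr rfl fun t _ => by unfold gap reward; ring
  have hi : ∀ t ∈ Finset.range T, Integrable (fun ω => ξ t ω) P := fun t ht =>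
    (integrable_noise h.noise (Finset.mem_range.1 ht)).1
  unfold expectedRegret
  simp_rw [e]
  rw [integral_sub (h.integrable_regret.const_mul _) ((integrable_finsetSum _ hi).const_mul _),
    integral_const_mul, integral_const_mul, integral_finsetSum _ hi,
    Finset.sum_eq_zero fun t ht => (integrable_noise h.noise (Finset.mem_range.1 ht)).2]
  simp

theorem growth_eq_xc {Δ : Fin K → ℝ} {σ γ n : ℝ} (hn : 0 < n) (hσ : 0 < σ) (hγ : 0 < γ)
    (a : Fin K) : growth Δ σ γ n a =
      xc (fun a => Δ a / (σ * γ)) (1 / √n) a := by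
  have hs : 0 < √n := Real.sqrt_pos.2 hn
  have h2 : √n ^ 2 = n := Real.sq_sqrt hn.le
  have h3 : 1 / √n + Δ a / (σ * γ) = (1 + √n * Δ a / (σ * γ)) / √n := by field_simp
  unfold growth xc
  rw [h3, div_pow, inv_div, h2, ← div_eq_mul_inv]

/-! ### Sizes of the parameters and numerical conclusion. -/

theorem natLog_add_one_le {T : ℕ} (hT : 1 ≤ Real.log T) :
    (Nat.log 2 T : ℝ) + 1 ≤ 3 * Real.log T := by
  have hT0 : T ≠ 0 := by rintro rfl; norm_num at hT
  have h1 : (Nat.log 2 T : ℝ) * Real.log 2 ≤ Real.log T := by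
    rw [← Real.log_pow]
    refine Real.log_le_log (by positivity) ?_
    exact_mod_cast Nat.pow_log_le_self 2 hT0
  have h2 := Real.log_two_gt_d9
  have h3 : (0 : ℝ) ≤ Nat.log 2 T := Nat.cast_nonneg _
  nlinarith

/-- The size conditions implied by a small value of the error. -/
theorem size_of_err_le {T : ℕ} {Δ : Fin K → ℝ} {σ γ : ℝ} (hT : 0 < T) (hK : 0 < K)
    (hγ : 0 < γ) (herr : err T Δ σ γ ≤ 1 / 10 ^ 6) :
    10 ^ 6 ≤ γ ∧ K < T ∧ 1 ≤ Real.log (Real.log T) ∧ 1 ≤ Real.log T ∧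
      Real.log (Real.log T) ≤ γ ^ 2 / 10 ^ 12 ∧ 1 / γ ≤ err T Δ σ γ ∧
      (K : ℝ) / T ≤ err T Δ σ γ ∧ (∀ a, (Δ a / (σ * γ)) ^ 2 ≤ err T Δ σ γ) ∧
      (√(Real.log γ) + √(Real.log (Real.log T))) / γ ≤ err T Δ σ γ := by
  have hT' : (0 : ℝ) < T := by exact_mod_cast hT
  have hK' : (1 : ℝ) ≤ K := by exact_mod_cast hK
  have n1 : 0 ≤ (√(Real.log γ) + √(Real.log (Real.log T))) / γ := by positivity
  have n2 : 0 ≤ (K : ℝ) / T := by positivity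
  have n3 : 0 ≤ ‖fun a => Δ a / σ‖ ^ 2 / γ ^ 2 := by positivity
  have b1 : (√(Real.log γ) + √(Real.log (Real.log T))) / γ ≤ err T Δ σ γ := by
    unfold err; linarith
  have b2 : (K : ℝ) / T ≤ err T Δ σ γ := by unfold err; linarith
  have b3 : ‖fun a => Δ a / σ‖ ^ 2 / γ ^ 2 ≤ err T Δ σ γ := by unfold err; linarith
  have hKT : (K : ℝ) * 10 ^ 6 ≤ T := by
    have := b2.trans herr
    rw [div_le_div_iff₀ hT' (by norm_num)] at this
    linarith
  have he : Real.exp 1 < 2.7182818286 := Real.exp_one_lt_d9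
  -- From K ≥ 1 and K/T ≤ 10⁻⁶ one has T ≥ 10⁶ > e³. This makes log log T at least 1, so the first
  -- term of the error forces γ to be large.
  have hlogT : 3 ≤ Real.log T := by
    rw [Real.le_log_iff_exp_le hT']
    have h1 : Real.exp 3 = Real.exp 1 ^ 3 := by rw [← Real.exp_nat_mul]; norm_num
    have h2 : Real.exp 1 ^ 3 ≤ 3 ^ 3 := by
      have := Real.exp_pos 1
      gcongr; linarith
    rw [h1]
    norm_num at h2
    nlinarith
  have hll : 1 ≤ Real.log (Real.log T) := by
    rw [Real.le_log_iff_exp_le (by linarith)]; linarith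
  have hsll : 1 ≤ √(Real.log (Real.log T)) := Real.one_le_sqrt.2 hll
  have hslg := Real.sqrt_nonneg (Real.log γ)
  have b1' := b1.trans herr
  rw [div_le_div_iff₀ hγ (by norm_num)] at b1'
  refine ⟨by linarith, ?_, hll, by linarith, ?_, ?_, b2, ?_, b1⟩
  · have : (K : ℝ) < T := by nlinarith
    exact_mod_cast this
  · have h1 : √(Real.log (Real.log T)) ≤ γ / 10 ^ 6 := by
      rw [le_div_iff₀ (by norm_num)]; linarith
    have h2 := Real.sq_sqrt (show 0 ≤ Real.log (Real.log T) by linarith)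
    have h3 : √(Real.log (Real.log T)) ^ 2 ≤ (γ / 10 ^ 6) ^ 2 := by gcongr
    rw [h2] at h3
    calc _ ≤ _ := h3
      _ = _ := by rw [div_pow]; norm_num
  · refine le_trans ?_ b1
    gcongr; linarith
  · intro a
    refine le_trans ?_ b3
    rw [← div_div, div_pow]
    refine div_le_div_of_nonneg_right ?_ (by positivity)
    rw [← sq_abs]
    exact pow_le_pow_left₀ (abs_nonneg _) (norm_le_pi_norm (fun a => Δ a / σ) a) 2

/-- The exponent is γ²/64; the gap to γ²/100 absorbs the number of blocks, since log T is at most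
exp(γ²/10¹²). -/
theorem badBound_quarter_le {T : ℕ} {γ : ℝ} (hγ : 10 ^ 6 ≤ γ) (hT : 1 ≤ Real.log T)
    (hll : Real.log (Real.log T) ≤ γ ^ 2 / 10 ^ 12) :
    badBound T (1 / 4 * γ) ≤ Real.exp (-(γ ^ 2 / 100)) := by
  have h1 := natLog_add_one_le hT
  have h2 : Real.log T ≤ Real.exp (γ ^ 2 / 10 ^ 12) := by
    rwa [← Real.log_le_iff_le_exp (by linarith)]
  have h3 : (6 : ℝ) ≤ Real.exp 6 := by linarith [Real.add_one_le_exp (6 : ℝ)]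
  unfold badBound
  calc 2 * ((Nat.log 2 T : ℝ) + 1) * Real.exp (-((1 / 4 * γ) ^ 2 / 4))
      ≤ 2 * (3 * Real.log T) * Real.exp (-((1 / 4 * γ) ^ 2 / 4)) := by gcongr
    _ = 6 * Real.log T * Real.exp (-((1 / 4 * γ) ^ 2 / 4)) := by ring
    _ ≤ Real.exp 6 * Real.exp (γ ^ 2 / 10 ^ 12) * Real.exp (-((1 / 4 * γ) ^ 2 / 4)) := by gcongr
    _ ≤ _ := by
        rw [← Real.exp_add, ← Real.exp_add]
        refine Real.exp_le_exp.2 ?_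
        have : (10 : ℝ) ^ 12 ≤ γ ^ 2 := by
          calc (10 : ℝ) ^ 12 = (10 ^ 6) ^ 2 := by norm_num
            _ ≤ γ ^ 2 := by gcongr
        linarith

/-- The factor 4 makes the exponential at most γ⁻⁴ (log T)⁻⁴, which pays for the order log T dyadic
blocks and leaves γ⁻². -/
theorem badBound_small_le {T : ℕ} {γ : ℝ} (hγ : 10 ^ 6 ≤ γ) (hT : 1 ≤ Real.log T) :
    badBound T (4 * (√(Real.log γ) + √(Real.log (Real.log T)))) ≤ 1 / γ ^ 2 := by
  have h1 := natLog_add_one_le hT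
  have hγ0 : 0 < γ := by linarith
  have hL : 0 < Real.log T := by linarith
  have hlg : 0 ≤ Real.log γ := Real.log_nonneg (by linarith)
  have hll : 0 ≤ Real.log (Real.log T) := Real.log_nonneg hT
  have h2 : 4 * Real.log γ + 4 * Real.log (Real.log T) ≤
      (4 * (√(Real.log γ) + √(Real.log (Real.log T)))) ^ 2 / 4 := by
    nlinarith [Real.sq_sqrt hlg, Real.sq_sqrt hll,
      mul_nonneg (Real.sqrt_nonneg (Real.log γ)) (Real.sqrt_nonneg (Real.log (Real.log T)))]
  have h3 : Real.exp (-((4 * (√(Real.log γ) + √(Real.log (Real.log T)))) ^ 2 / 4)) ≤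
      (γ ^ 4)⁻¹ * (Real.log T ^ 4)⁻¹ := by
    refine (Real.exp_le_exp.2 (neg_le_neg h2)).trans (le_of_eq ?_)
    rw [Real.exp_neg, Real.exp_add, mul_inv]
    have e1 : Real.exp (4 * Real.log γ) = γ ^ 4 := by
      rw [← Real.exp_log (pow_pos hγ0 4), Real.log_pow]; norm_num
    have e2 : Real.exp (4 * Real.log (Real.log T)) = Real.log T ^ 4 := by
      rw [← Real.exp_log (pow_pos hL 4), Real.log_pow]; norm_num
    rw [e1, e2]
  unfold badBound
  calc 2 * ((Nat.log 2 T : ℝ) + 1) *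
        Real.exp (-((4 * (√(Real.log γ) + √(Real.log (Real.log T)))) ^ 2 / 4))
      ≤ 2 * (3 * Real.log T) * ((γ ^ 4)⁻¹ * (Real.log T ^ 4)⁻¹) := by gcongr
    _ = 6 / (γ ^ 4 * Real.log T ^ 3) := by field_simp; ring
    _ ≤ 1 / γ ^ 2 := by
        rw [div_le_div_iff₀ (by positivity) (by positivity)]
        have h4 : 1 ≤ Real.log T ^ 3 := one_le_pow₀ hT
        have h5 : 6 ≤ γ ^ 2 := by nlinarith
        have h6 : γ ^ 4 ≤ γ ^ 4 * Real.log T ^ 3 := le_mul_of_one_le_right (by positivity) h4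
        nlinarith [sq_nonneg γ]

/-- All corrections are linear in e up to constants, as 1/γ² ≤ 10⁻⁶ e. The coefficient 1638400/γ² of
θ is at most 1 because γ ≥ 10⁶. -/
theorem abs_ratio_sub_one_le {R F e γ ε κ θ k : ℝ} (hF : 0 < F) (hγ : 10 ^ 6 ≤ γ)
    (he : e ≤ 1 / 10 ^ 6) (hγe : 1 / γ ≤ e) (hε : 0 ≤ ε) (hεe : ε ≤ 4 * e) (hκ : κ = 4 * e)
    (hθ : 0 ≤ θ) (hk : 0 ≤ k) (hke : k ≤ e)
    (hup : R ≤ F * ((1 + ε) ^ 2 * (((1 - ε) ^ 2)⁻¹ + 16 / γ ^ 2) + κ + 96 / γ +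
        400000 / γ ^ 2 + 1638400 / γ ^ 2 * θ))
    (hlo : F * ((1 - ε) ^ 2 * (((1 + ε) ^ 2)⁻¹ * (1 - k - 6 / γ) - 1 / γ ^ 2)) ≤ R) :
    |R / F - 1| ≤ 10 ^ 6 * (e + θ) := by
  have hγ0 : 0 < γ := by linarith
  have hg0 : 0 < 1 / γ := by positivity
  have hg : 1 / γ ≤ 1 / 10 ^ 6 := one_div_le_one_div_of_le (by norm_num) hγ
  have he0 : 0 ≤ e := hg0.le.trans hγe
  have hg2 : 1 / γ ^ 2 ≤ e * (1 / 10 ^ 6) := by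
    have : 1 / γ ^ 2 = 1 / γ * (1 / γ) := by field_simp
    rw [this]
    exact mul_le_mul hγe hg hg0.le he0
  have hg20 : 0 ≤ 1 / γ ^ 2 := by positivity
  have hε1 : ε ≤ 1 / 8 := by linarith
  have h1 : (1 + ε) ^ 2 * ((1 - ε) ^ 2)⁻¹ ≤ 1 + 6 * ε := by
    have : 0 < 1 - ε := by linarith
    rw [← div_eq_mul_inv, div_le_iff₀ (by positivity)]
    nlinarith [mul_nonneg hε (sub_nonneg.2 hε1), mul_nonneg hε (mul_nonneg hε hε)]
  have h2 : 1 - 4 * ε ≤ (1 - ε) ^ 2 * ((1 + ε) ^ 2)⁻¹ := by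
    rw [← div_eq_mul_inv, le_div_iff₀ (by positivity)]
    nlinarith [mul_nonneg hε hε, mul_nonneg hε (mul_nonneg hε hε)]
  have e1 : (16 : ℝ) / γ ^ 2 = 16 * (1 / γ ^ 2) := by ring
  have e2 : (96 : ℝ) / γ = 96 * (1 / γ) := by ring
  have e3 : (400000 : ℝ) / γ ^ 2 = 400000 * (1 / γ ^ 2) := by ring
  have e4 : (1638400 : ℝ) / γ ^ 2 = 1638400 * (1 / γ ^ 2) := by ring
  have e5 : (6 : ℝ) / γ = 6 * (1 / γ) := by ring
  rw [e1, e2, e3, e4] at hup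
  rw [e5] at hlo
  rw [abs_le]
  constructor
  · rw [neg_le_sub_iff_le_add, ← sub_le_iff_le_add, le_div_iff₀ hF]
    refine le_trans ?_ hlo
    rw [mul_comm]
    refine mul_le_mul_of_nonneg_left ?_ hF.le
    have h3 : 0 ≤ 1 - k - 6 * (1 / γ) := by linarith
    have h4 := mul_le_mul_of_nonneg_right h2 h3
    have h5 : (1 - ε) ^ 2 * (1 / γ ^ 2) ≤ 1 / γ ^ 2 := by
      refine mul_le_of_le_one_left hg20 ?_
      nlinarith
    have h6 : 1 - 4 * ε - (k + 6 * (1 / γ)) ≤ (1 - 4 * ε) * (1 - k - 6 * (1 / γ)) := by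
      have := mul_nonneg hε (show 0 ≤ k + 6 * (1 / γ) by positivity)
      linarith
    linarith
  · rw [sub_le_iff_le_add, div_le_iff₀ hF]
    refine hup.trans ?_
    rw [mul_comm]
    refine mul_le_mul_of_nonneg_right ?_ hF.le
    have h3 : (1 + ε) ^ 2 * (16 * (1 / γ ^ 2)) ≤ 2 * (16 * (1 / γ ^ 2)) := by
      refine mul_le_mul_of_nonneg_right ?_ (by positivity)
      have h5 : (1 + ε) ^ 2 ≤ (1 + 1 / 8) ^ 2 := pow_le_pow_left₀ (by linarith) (by linarith) 2
      linarith
    have h4 : 1638400 * (1 / γ ^ 2) * θ ≤ 1 * θ := by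
      refine mul_le_mul_of_nonneg_right ?_ hθ
      linarith
    rw [mul_add]
    linarith

end UCB

end
theorem mainTheorem1 :
    ∃ C : ℝ, 0 < C ∧
      ∀ (Ω : Type*) [MeasurableSpace Ω] (P : Measure Ω) [IsProbabilityMeasure P]
        (T K : ℕ) (μ : Fin K → ℝ) (σ γ : ℝ) (ξ : ℕ → Ω → ℝ) (A : ℕ → Ω → Fin K),
        0 < T → 0 < σ → 0 < γ →
        (∃ a, 0 < UCB.gap μ a) →
        UCB.IsGaussianNoise P T ξ →
        UCB.IsUCB1 T μ σ γ ξ A →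
        UCB.err T (UCB.gap μ) σ γ ≤ 1 / C →
        |UCB.expectedRegret P T μ σ ξ A / UCB.regStar T (UCB.gap μ) σ γ - 1| ≤
          C * (UCB.err T (UCB.gap μ) σ γ + UCB.thetaStar T γ) := by
  refine ⟨10 ^ 6, by norm_num, ?_⟩
  intro Ω _ P _ T K μ σ γ ξ A hT hσ hγ hgap hξ hA herr
  have hK : 0 < K := by obtain ⟨a, _⟩ := hgap; exact a.pos
  obtain ⟨hγ6, hKT, hll1, hlT, hll, hγe, hKe, hde, hεe⟩ := UCB.size_of_err_le hT hK hγ herr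
  set e := UCB.err T (UCB.gap μ) σ γ with he
  obtain ⟨a₀, ha₀⟩ := UCB.exists_gap_eq_zero hK μ
  have hT' : (0 : ℝ) < T := by exact_mod_cast hT
  obtain ⟨hn0, hnT⟩ := UCB.isFixedPoint_nStar hK hT μ hσ hγ
  set n := UCB.nStar T (UCB.gap μ) σ γ with hn
  set d : Fin K → ℝ := fun a => UCB.gap μ a / (σ * γ) with hd
  have hd0 : ∀ a, 0 ≤ d a := fun a => div_nonneg (UCB.gap_nonneg μ a) (by positivity)
  have hrun : UCB.IsRun P T d γ ξ A := by
    refine ⟨hξ, UCB.measurable_arm_hist hA.adapted, hA.init, ?_, hd0, hKT, hγ⟩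
    intro t h1 h2 ω b
    have hp : ∀ c, 1 ≤ UCB.pulls A t c ω := fun c =>
      (hA.init ω c).symm.le.trans (UCB.pulls_mono A c ω h1)
    have h3 := hA.argmax t h1 h2 ω b
    rw [UCB.index_eq_nlev hσ hγ (hp b), UCB.index_eq_nlev hσ hγ (hp _)] at h3
    exact le_of_mul_le_mul_left (by linarith) (mul_pos hσ hγ)
  set us := 1 / √n with hus
  have hus0 : 0 < us := by positivity
  have hgr : ∀ a, UCB.growth (UCB.gap μ) σ γ n a = UCB.xc d us a := fun a =>
    UCB.growth_eq_xc hn0 hσ hγ a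
  have hG : UCB.totalPulls d us = T := by
    rw [← hnT]; exact Finset.sum_congr rfl fun a _ => (hgr a).symm
  -- Each us² xc is at most 1, so us² T = us² G(us) ≤ K, and K/T is part of the error.
  have hus2 : us ^ 2 ≤ e := by
    refine le_trans ?_ hKe
    have h1 : us ^ 2 * T ≤ K := by
      rw [← hG, UCB.totalPulls, Finset.mul_sum]
      refine (Finset.sum_le_sum (g := fun _ => (1 : ℝ)) fun a _ => ?_).trans (by simp)
      have := hd0 a
      rw [UCB.xc, ← div_eq_mul_inv, div_le_one (by positivity)]
      gcongr; linarith
    rwa [le_div_iff₀ hT']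
  have hκ : ∀ a, (us + d a) ^ 2 ≤ 4 * e := fun a => by
    have := hde a
    nlinarith [sq_nonneg (us - d a)]
  have hd1 : ∀ a, us + d a ≤ 1 := fun a => by
    have h1 := hκ a
    have h2 : e ≤ 1 / 10 ^ 6 := herr
    have := hd0 a
    nlinarith
  have hF : 0 < UCB.totalRegret d us := by
    obtain ⟨a, ha⟩ := hgap
    have hda : 0 < d a := div_pos ha (by positivity)
    refine lt_of_lt_of_le ?_ (Finset.single_le_sum (f := fun a => d a * UCB.xc d us a)
      (fun b _ => mul_nonneg (hd0 b) (UCB.xc_nonneg d us b)) (Finset.mem_univ a))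
    simp only [UCB.xc]
    positivity
  have hreg : UCB.regStar T (UCB.gap μ) σ γ = σ * γ * UCB.totalRegret d us := by
    unfold UCB.regStar UCB.nStarArm UCB.totalRegret
    rw [Finset.mul_sum]
    refine Finset.sum_congr rfl fun a _ => ?_
    rw [← hn, hgr a]
    simp only [hd]
    field_simp
  -- The least accuracy for which `badBound_small_le` applies; it is four times the first term of
  -- the error.
  set ε := 4 * (√(Real.log γ) + √(Real.log (Real.log T))) / γ with hε
  have hε0 : 0 ≤ ε := by positivity
  have hε4 : ε ≤ 4 * e := by
    rw [hε, mul_div_assoc]; linarith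
  have hε1 : ε < 1 := by
    have : e ≤ 1 / 10 ^ 6 := herr
    linarith
  have hp : UCB.badBound T (ε * γ) ≤ 1 / γ ^ 2 := by
    rw [hε, div_mul_cancel₀ _ hγ.ne']
    exact UCB.badBound_small_le hγ6 hlT
  have hup := hrun.integral_regret_le (P := P) (by linarith)
    (UCB.badBound_quarter_le hγ6 hlT hll) (a₀ := a₀) (by simp [hd, ha₀])
    (by obtain ⟨a, ha⟩ := hgap; exact ⟨a, div_pos ha (by positivity)⟩) hε0 hε1 hp hus0 hG hd1 hκ
  have hlo := hrun.le_integral_regret (P := P) (by linarith) hε0 hε1 hp hus0 hG hd1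
  rw [UCB.expectedRegret_eq hσ hrun, hreg, mul_div_mul_left _ _ (mul_pos hσ hγ).ne']
  exact UCB.abs_ratio_sub_one_le hF hγ6 herr hγe hε0 hε4 rfl
    (by unfold UCB.thetaStar; positivity) (by positivity) hKe hup hlo
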